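/- **Setting.** Write $\langle x\rangle=(1+x^2)^{1/2}$, $\mathbb R_\pm=\{x:\pm x>0\}$, $\|\cdot\|$ for the norm of $L^2(\mathbb R)$, and $L^\infty_{\beta}(I)=\{f:\langle x\rangle^{\beta}f\in L^\infty(I)\}$ (functions on $\mathbb R_\pm$ are extended by zero to $\mathbb R$). For $V\in L^2_{\rm loc}(\mathbb R)$ let $H_V$ be the maximal operator $H_Vf=-f''+Vf$, $\mathrm{Dom}(H_V)=\{f\in L^2(\mathbb R): -f''+Vf\in L^2(\mathbb R)\}$. **Assumptions.** Let $N\ge1$ be an integer and let $V:\mathbb R\to\mathbb C$, $V\in W^{N,\infty}_{\rm loc}(\mathbb R)$ (continuous representative), satisfy for some $\nu_\pm\in\mathbb R$ and $\varepsilon_1>0$: (a) $\limsup_{x\to-\infty}\operatorname{Im}V(x)<0$ and $\liminf_{x\to+\infty}\operatorname{Im}V(x)>0$; (b) for all $1\le m\le N$, as $x\to\pm\infty$, $|\operatorname{Im}V^{(m)}(x)|=O(|\operatorname{Im}V(x)|\langle x\rangle^{m\nu_\pm})$ and $|V^{(m)}(x)|=O(|V(x)|\langle x\rangle^{m\nu_\pm})$;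 (c) at each end $\pm\infty$: if $V$ is unbounded at $\pm\infty$, then $\langle x\rangle^{4(\nu_\pm+\varepsilon_1)+2}\left(\langle x\rangle^{4\nu_\pm+2}+|\operatorname{Re}V(x)|\right)=O(|\operatorname{Im}V(x)|^2)$ as $x\to\pm\infty$; if $V$ is bounded at $\pm\infty$, then $\nu_\pm<1$. Suppose moreover that there are $\gamma,\gamma_+,\gamma_-\ge0$ such that $|\operatorname{Im}V(x)|=O(|x|^{\gamma})$ at $+\infty$ or at $-\infty$ (at least one of the two), and $|x|^{\gamma_\pm}=O(|\operatorname{Im}V(x)|)$ as $x\to\pm\infty$ (both), and that, for some $\alpha_\pm\ge0$, $$V^{(N+1)}\in L^2(\mathbb R)+L^\infty_{-\alpha_-}(\mathbb R_-)+L^\infty_{-\alpha_+}(\mathbb R_+).$$ **Pseudomode.** Let $\varepsilon_2>0$ satisfy $\varepsilon_2<1-\nu_\pm$ at each end at which $V$ is bounded. For $\lambda>0$ put $$\delta_\pm=\inf\Big\{\delta\ge0:\ \tfrac{|\operatorname{Im}V(\pm\delta)|^2}{\langle\delta\rangle^{4\nu_\pm+2\varepsilon_1+2}}=\lambda\Big\},\quad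 \Delta_\pm=\tfrac14\delta_\pm^{-\nu_\pm}\qquad\text{if $V$ is unbounded at }\pm\infty,$$ $$\delta_\pm=\lambda^{(1+\varepsilon_2)/2},\quad\Delta_\pm=\tfrac14\delta_\pm\qquad\text{if $V$ is bounded at }\pm\infty,$$ and $\mathcal J_\pm=\{x\in\mathbb R_\pm:|x|<\delta_\pm\}$. Let $\xi=\xi_\lambda\in C_0^\infty(\mathbb R)$ be cut-offs, given for all sufficiently large $\lambda$, with $0\le\xi\le1$, $\xi=1$ on $(-\delta_-+\Delta_-,\delta_+-\Delta_+)$, $\xi=0$ outside $(-\delta_-,\delta_+)$, and $\|\xi^{(j)}\|_{L^\infty(\mathbb R_\pm)}\le C\Delta_\pm^{-j}$ for $j=1,2$ with $C$ independent of $\lambda$. Set $n:=N$. With the principal branch of the square root, define $\psi_{-1},\dots,\psi_{n-1}$ by $\psi_k(0)=0$, $$\psi_{-1}'=i\lambda^{-1/2}(\lambda-V)^{1/2},\qquad \psi_{k+1}'=\frac1{2\psi_{-1}'}\Big(\psi_k''-\sum_{a+b=k,\ a,b\ge0}\psi_a'\psi_b'\Big),\quad -1\le k\le n-2,$$ and put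 $f=\xi\,g$ with $g=\exp\big(-\sum_{k=-1}^{n-1}\lambda^{-k/2}\psi_k\big)$. **Theorem.** Such families of cut-offs exist. For every such family and all sufficiently large $\lambda>0$ we have $0\neq f\in\mathrm{Dom}(H_V)$ and $$\frac{\|(H_V-\lambda)f\|}{\|f\|}=\kappa(\lambda)+\sigma^{(n)}(\lambda)+\tau(\lambda),\qquad \kappa=\kappa_-+\kappa_+,\quad \sigma^{(n)}=\sigma^{(n)}_-+\sigma^{(n)}_+,\quad \tau=\tau_-+\tau_+,$$ where, as $\lambda\to+\infty$: * $\kappa_\pm=O\big(\exp(-c\,\delta_\pm^{\nu_\pm+1+\varepsilon_1})\big)$ if $V$ is unbounded at $\pm\infty$, and $\kappa_\pm=O\big(\exp(-c\,\lambda^{\varepsilon_2/2})\big)$ if $V$ is bounded at $\pm\infty$, with some $c>0$; * if $V$ is unbounded at $\pm\infty$: $\sigma^{(n)}_\pm=O\big(\lambda^{-\frac{n+1}2}\sup_{x\in\mathcal J_\pm}|V(x)|\langle x\rangle^{(n+1)\nu_\pm}\big)$ when $\nu_\pm<0$, and $\sigma^{(n)}_\pm=O\big(\delta_\pm^{(n+1)\nu_\pm}\lambda^{\frac{1-n}2}\big)$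 when $\nu_\pm\ge0$; if $V$ is bounded at $\pm\infty$: $\sigma^{(n)}_\pm=O\big(\lambda^{-\frac{n+1}2}\big)$ when $\nu_\pm<0$, and $\sigma^{(n)}_\pm=O\big(\lambda^{-\frac{n+1}2(1-(1+\varepsilon_2)\nu_\pm)}\big)$ when $\nu_\pm\ge0$; * $\displaystyle\tau_\pm=O\Big(\lambda^{-\frac{N+1}2-\frac1{4(\gamma+1)}}+\lambda^{-\frac{N+1}2+\frac{\gamma-\gamma_\pm+2\alpha_\pm(\gamma+1)}{4(\gamma_\pm+1)(\gamma+1)}}\Big).$ -/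

import Mathlib

open Filter Topology MeasureTheory Asymptotics Set
open scoped ContDiff ENNReal

namespace Pseudomode

/-- The two ends `-∞` and `+∞` of the real line. -/
inductive Side where
  | minus
  | plus

namespace Side

/-- The sign of an end. -/
def sign : Side → ℝ
  | minus => -1
  | plus => 1

/-- The filter `x → -∞` or `x → +∞`. -/
def filter : Side → Filter ℝ
  | minus => atBot
  | plus => atTop

/-- The open half-lines `ℝ₋` and `ℝ₊`. -/
def halfLine : Side → Set ℝ
  | minus => Iio 0
  | plus => Ioi 0

end Side

/-- The bracket `⟨x⟩ = (1 + x²)^{1/2}`. -/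
noncomputable def bracket (x : ℝ) : ℝ := Real.sqrt (1 + x ^ 2)

/-! ### Weak derivatives, local Sobolev spaces, the maximal Schrödinger operator -/

/-- Real-valued test functions of class `C_c^∞(ℝ)`; by linearity they detect the same
distributional identities as the complex-valued ones. -/
def IsTestFunction (φ : ℝ → ℝ) : Prop := ContDiff ℝ ∞ φ ∧ HasCompactSupport φ

/-- `w ∈ L¹_loc(ℝ)` is the weak derivative of order `m` of `v ∈ L¹_loc(ℝ)`. -/
def IsWeakDeriv (m : ℕ) (v w : ℝ → ℂ) : Prop :=
  LocallyIntegrable v volume ∧ LocallyIntegrable w volume ∧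
    ∀ φ : ℝ → ℝ, IsTestFunction φ →
      ∫ x, iteratedDeriv m φ x • v x = (-1 : ℝ) ^ m • ∫ x, φ x • w x

/-- `v ∈ W^{N,∞}_loc(ℝ)`. -/
def MemSobolevLocTop (N : ℕ) (v : ℝ → ℂ) : Prop :=
  ∀ m : ℕ, m ≤ N → ∃ w : ℝ → ℂ, IsWeakDeriv m v w ∧
    ∀ K : Set ℝ, IsCompact K → MemLp w ∞ (volume.restrict K)

/-- `f ∈ Dom(H_V)` and `H_V f = u`, where `H_V = -d²/dx² + V` is the maximal operator in
`L²(ℝ)`: both `f` and the distribution `-f'' + V f = u` are in `L²(ℝ)`. -/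
def IsSchrodingerImage (V f u : ℝ → ℂ) : Prop :=
  MemLp f 2 volume ∧ MemLp u 2 volume ∧ LocallyIntegrable (fun x => V x * f x) volume ∧
    ∀ φ : ℝ → ℝ, IsTestFunction φ →
      ∫ x, (-(iteratedDeriv 2 φ x) • f x + φ x • (V x * f x)) = ∫ x, φ x • u x

/-- `h ∈ L²(ℝ) + L^∞_{-α₋}(ℝ₋) + L^∞_{-α₊}(ℝ₊)`, where `f ∈ L^∞_β(I)` means
`⟨x⟩^β f ∈ L^∞(I)` and functions on half-lines are extended by zero. -/
def MemL2AddWeightedLInfty (α : Side → ℝ) (h : ℝ → ℂ) : Prop :=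
  ∃ h₂ : ℝ → ℂ, ∃ k : Side → ℝ → ℂ, MemLp h₂ 2 volume ∧
    (∀ s : Side, MemLp (fun x => ((bracket x ^ (-α s) : ℝ) : ℂ) * k s x) ∞
      (volume.restrict s.halfLine)) ∧
    h =ᵐ[volume] fun x => h₂ x + (Side.minus.halfLine).indicator (k .minus) x
      + (Side.plus.halfLine).indicator (k .plus) x

/-! ### The class of potentials -/

/-- `V` is bounded in a neighbourhood of the end `s`. -/
def BoundedAt (V : ℝ → ℂ) (s : Side) : Prop := ∃ C : ℝ, ∀ᶠ x in s.filter, ‖V x‖ ≤ C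

/-- The basic assumption on the potential; `V` denotes the continuous representative. The
derivatives of `V` are weak ones, so that the bounds on them hold almost everywhere. -/
structure BasicAssumption (N : ℕ) (V : ℝ → ℂ) (ν : Side → ℝ) (ε₁ : ℝ) : Prop where
  cont : Continuous V
  sobolev : MemSobolevLocTop N V
  im_minus : limsup (fun x => (((V x).im : ℝ) : EReal)) atBot < 0
  im_plus : 0 < liminf (fun x => (((V x).im : ℝ) : EReal)) atTop
  im_deriv_bound : ∀ s : Side, ∀ m : ℕ, 1 ≤ m → m ≤ N → ∀ w : ℝ → ℂ, IsWeakDeriv m V w →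
    (fun x => (w x).im) =O[s.filter ⊓ ae volume]
      (fun x => |(V x).im| * bracket x ^ ((m : ℝ) * ν s))
  deriv_bound : ∀ s : Side, ∀ m : ℕ, 1 ≤ m → m ≤ N → ∀ w : ℝ → ℂ, IsWeakDeriv m V w →
    w =O[s.filter ⊓ ae volume] (fun x => ‖V x‖ * bracket x ^ ((m : ℝ) * ν s))
  eps_pos : 0 < ε₁
  unbounded : ∀ s : Side, ¬ BoundedAt V s →
    (fun x => bracket x ^ (4 * (ν s + ε₁) + 2) * (bracket x ^ (4 * ν s + 2) + |(V x).re|))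
      =O[s.filter] (fun x => |(V x).im| ^ 2)
  bounded : ∀ s : Side, BoundedAt V s → ν s < 1

/-! ### The cut-off -/

open Classical in
/-- The cut-off radii `δ_±(λ)`. In the unbounded case the set is non-empty for all
sufficiently large `λ`. -/
noncomputable def delta (V : ℝ → ℂ) (ν : Side → ℝ) (ε₁ ε₂ : ℝ) (s : Side) (lam : ℝ) : ℝ :=
  if BoundedAt V s then lam ^ ((1 + ε₂) / 2)
  else sInf {d : ℝ | 0 ≤ d ∧
    |(V (s.sign * d)).im| ^ 2 / bracket d ^ (4 * ν s + 2 * ε₁ + 2) = lam}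

open Classical in
/-- The widths `Δ_±(λ)` of the transition regions. -/
noncomputable def Delta (V : ℝ → ℂ) (ν : Side → ℝ) (ε₁ ε₂ : ℝ) (s : Side) (lam : ℝ) : ℝ :=
  if BoundedAt V s then delta V ν ε₁ ε₂ s lam / 4
  else delta V ν ε₁ ε₂ s lam ^ (-ν s) / 4

/-- The half intervals `J_± = {x ∈ ℝ_± : |x| < δ_±}`. -/
def halfInterval (V : ℝ → ℂ) (ν : Side → ℝ) (ε₁ ε₂ : ℝ) (s : Side) (lam : ℝ) : Set ℝ :=
  {x : ℝ | x ∈ s.halfLine ∧ |x| < delta V ν ε₁ ε₂ s lam}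

/-- `ξ ∈ C_c^∞(ℝ)`, `0 ≤ ξ ≤ 1`, `ξ = 1` on `(-δ₋ + Δ₋, δ₊ - Δ₊)`, `ξ = 0` outside
`(-δ₋, δ₊)`, and `|ξ^{(j)}| ≤ C Δ_±^{-j}` on `ℝ_±` for `j = 1, 2`. -/
structure IsCutoff (δ Δ : Side → ℝ) (C : ℝ) (ξ : ℝ → ℝ) : Prop where
  smooth : ContDiff ℝ ∞ ξ
  compact : HasCompactSupport ξ
  nonneg : ∀ x, 0 ≤ ξ x
  le_one : ∀ x, ξ x ≤ 1
  eq_one : ∀ x ∈ Ioo (-δ .minus + Δ .minus) (δ .plus - Δ .plus), ξ x = 1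
  eq_zero : ∀ x, x ∉ Ioo (-δ .minus) (δ .plus) → ξ x = 0
  deriv_bound : ∀ s : Side, ∀ j ∈ Finset.Icc 1 2, ∀ x ∈ s.halfLine,
    |iteratedDeriv j ξ x| ≤ C * (Δ s ^ j)⁻¹

/-- A family of cut-offs indexed by (large) `λ`, with derivative bounds uniform in `λ`. -/
def IsCutoffFamily (V : ℝ → ℂ) (ν : Side → ℝ) (ε₁ ε₂ : ℝ) (ξ : ℝ → ℝ → ℝ) : Prop :=
  ∃ C : ℝ, ∀ᶠ lam in atTop,
    IsCutoff (fun s => delta V ν ε₁ ε₂ s lam) (fun s => Delta V ν ε₁ ε₂ s lam) C (ξ lam)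

/-! ### The JWKB ansatz -/

/-- The functions `ψ'_k` of the JWKB expansion with the index shifted by one: `psiDeriv V lam j`
is `ψ'_{j-1}`. Thus `ψ'_{-1} = i λ^{-1/2} (λ - V)^{1/2}` with the principal branch, and
`ψ'_{k+1} = (2 ψ'_{-1})⁻¹ (ψ''_k - ∑ ψ'_a ψ'_b)` with the sum over `a, b ≥ 0`, `a + b = k`. -/
noncomputable def psiDeriv (V : ℝ → ℂ) (lam : ℝ) : ℕ → ℝ → ℂ
  | 0 => fun x => Complex.I * ((lam ^ (-(1 / 2 : ℝ)) : ℝ) : ℂ)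
      * ((lam : ℂ) - V x) ^ (1 / 2 : ℂ)
  | j + 1 => fun x => 1 / (2 * psiDeriv V lam 0 x)
      * (deriv (psiDeriv V lam j) x
        - ∑ a : Fin j, psiDeriv V lam (a.val + 1) x * psiDeriv V lam (j - a.val) x)
termination_by j => j
decreasing_by all_goals omega

/-- `g = exp (- ∑_{k=-1}^{n-1} λ^{-k/2} ψ_k)`, where `ψ_k(x) = ∫₀ˣ ψ'_k`; here `j = k + 1`. -/
noncomputable def ansatz (V : ℝ → ℂ) (n : ℕ) (lam : ℝ) (x : ℝ) : ℂ :=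
  Complex.exp (-∑ j ∈ Finset.range (n + 1),
    ((lam ^ (-((j : ℝ) - 1) / 2) : ℝ) : ℂ) * ∫ t in (0 : ℝ)..x, psiDeriv V lam j t)

/-- The pseudomode `f = ξ g`. -/
noncomputable def pseudomode (V : ℝ → ℂ) (n : ℕ) (ξ : ℝ → ℝ → ℝ) (lam : ℝ) (x : ℝ) : ℂ :=
  (ξ lam x : ℂ) * ansatz V n lam x

/-! ### The rates -/

open Classical in
/-- The rate of the contribution of the cut-off, with a constant `c > 0`. -/
noncomputable def kappaRate (V : ℝ → ℂ) (ν : Side → ℝ) (ε₁ ε₂ c : ℝ) (s : Side) (lam : ℝ) : ℝ :=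
  if BoundedAt V s then Real.exp (-c * lam ^ (ε₂ / 2))
  else Real.exp (-c * delta V ν ε₁ ε₂ s lam ^ (ν s + 1 + ε₁))

open Classical in
/-- The rate of the regular part of the remainder. -/
noncomputable def sigmaRate (V : ℝ → ℂ) (n : ℕ) (ν : Side → ℝ) (ε₁ ε₂ : ℝ) (s : Side)
    (lam : ℝ) : ℝ :=
  if BoundedAt V s then
    if ν s < 0 then lam ^ (-((n : ℝ) + 1) / 2)
    else lam ^ (-((n : ℝ) + 1) / 2 * (1 - (1 + ε₂) * ν s))
  else
    if ν s < 0 then lam ^ (-((n : ℝ) + 1) / 2) *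
      sSup ((fun x => ‖V x‖ * bracket x ^ (((n : ℝ) + 1) * ν s)) ''
        halfInterval V ν ε₁ ε₂ s lam)
    else delta V ν ε₁ ε₂ s lam ^ (((n : ℝ) + 1) * ν s) * lam ^ ((1 - (n : ℝ)) / 2)

/-- The rate of the contribution of the derivative of `V` of order `N + 1`; `γ'` and `α` are the
exponents `γ_±` and `α_±`. -/
noncomputable def tauRate (N : ℕ) (γ : ℝ) (γ' α : Side → ℝ) (s : Side) (lam : ℝ) : ℝ :=
  lam ^ (-((N : ℝ) + 1) / 2 - 1 / (4 * (γ + 1)))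
    + lam ^ (-((N : ℝ) + 1) / 2
      + (γ - γ' s + 2 * α s * (γ + 1)) / (4 * (γ' s + 1) * (γ + 1)))

end Pseudomode

open Pseudomode

/-! Write p for the sum of λ^{-k/2} ψ'_k over -1 ≤ k ≤ N-1. Then g' = -p g and (H_V - λ)(ξ g) =
(-ξ'' + 2 ξ' p) g + ξ (p' - p² + V - λ) g.

The Riccati expression p' - p² + V - λ is what the recursion annihilates order by order. Only the
derivative of the last term and the products of too high total order survive (`riccati_remainder`).
Each term is an isobaric polynomial in the quotients q_i = V^{(i)}/(λ - V), divided by a power of (λ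
- V)^{1/2}, and its highest derivative enters linearly (`exists_isobaric_wkbTerm`). Since q_i = O(ρ
μ^i) with ρ = (1 + |V|)/λ and μ = ⟨x⟩^ν, the remainder is O(ρ μ^{N+1} λ^{-(N-1)/2}), the source of
σ, plus O(λ^{-(N+1)/2} |V^{(N+1)}|), the source of τ (`exists_wkb_bounds`).

The modulus of g is exp(-Re ∫ p). The leading term of p has real part of size Im V / √λ. The term k
= 0 integrates exactly to a difference of logarithms of λ - V, of bounded real part. The terms k ≥ 1
are dominated by the leading one, because up to the radii δ_± one has |Re V| ≤ λ/2, V = O(λ) and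
⟨x⟩^{2ν} = o(λ). By the sign condition on Im V, |g| is thus trapped, up to constant factors, between
two exponentials of -∫|Im V| / √λ with different constants (`exists_eventually_phase_bounds`). Where
ξ' lives, this integral divided by √λ is at least a multiple of δ^{ν+1+ε₁}, respectively λ^{ε₂/2}
(`exists_cutoffExponent_le_integral`). The exponential smallness absorbs the accompanying powers of
λ and δ (`eventually_log_le`), and this gives κ.

At an end where Im V = O(|x|^γ), |f| is bounded below on an interval of length about λ^{1/(2(γ+1))},
so ‖f‖ is at least a multiple of λ^{1/(4(γ+1))}. The lower bounds on Im V give |f| =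
O(exp(-c|x|^{γ'+1}/√λ)), a profile of width λ^{1/(2(γ'+1))}. The L² part of V^{(N+1)} is multiplied
by a bounded f, the weighted bounded part by this profile. Division by ‖f‖ produces the two summands
of τ.

As for regularity, V is of class C^N and V^{(N)} is locally absolutely continuous, hence so is f'.
Integration by parts then identifies the almost everywhere f'' with the distributional one
(`isSchrodingerImage_pseudomode`). Finally, a quotient bounded by a multiple of the sum of all rates
can be shared out in proportion to the rates, so the required identity is exact. -/

namespace Pseudomode

/-! ### Locally absolutely continuous functions and weak derivatives -/

/-- Absolute continuity on every compact interval. -/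
def LocallyAC (f : ℝ → ℂ) : Prop := ∀ a b : ℝ, AbsolutelyContinuousOnInterval f a b

theorem LocallyAC.add {f g : ℝ → ℂ} (hf : LocallyAC f) (hg : LocallyAC g) :
    LocallyAC (fun x => f x + g x) := fun a b => (hf a b).fun_add (hg a b)

theorem LocallyAC.mul {f g : ℝ → ℂ} (hf : LocallyAC f) (hg : LocallyAC g) :
    LocallyAC (fun x => f x * g x) := fun a b => (hf a b).fun_smul (hg a b)

theorem LocallyAC.continuous {f : ℝ → ℂ} (hf : LocallyAC f) : Continuous f := by
  rw [continuous_iff_continuousAt]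
  intro x
  refine (hf (x - 1) (x + 1)).continuousOn.continuousAt ?_
  rw [uIcc_of_le (by linarith)]
  exact Icc_mem_nhds (by linarith) (by linarith)

theorem _root_.ContDiff.locallyAC {f : ℝ → ℂ} (hf : ContDiff ℝ 1 f) : LocallyAC f :=
  fun _ _ => hf.contDiffOn.absolutelyContinuousOnInterval

theorem _root_.MeasureTheory.LocallyIntegrable.intervalIntegrable' {E : Type*}
    [NormedAddCommGroup E] {h : ℝ → E} (hh : LocallyIntegrable h volume) (a b : ℝ) :
    IntervalIntegrable h volume a b :=
  (hh.integrableOn_isCompact isCompact_uIcc).intervalIntegrable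

theorem locallyAC_integral_real {h : ℝ → ℝ} (hh : LocallyIntegrable h volume) (a b : ℝ) :
    AbsolutelyContinuousOnInterval (fun x => ∫ t in (0 : ℝ)..x, h t) a b := by
  -- The interval is enlarged so as to contain the base point 0 along with a and b.
  have H : AbsolutelyContinuousOnInterval (fun x => ∫ t in (0 : ℝ)..x, h t)
      (-(|a| + |b|)) (|a| + |b|) := by
    apply (hh.intervalIntegrable' _ _).absolutelyContinuousOnInterval_intervalIntegral
    rw [uIcc_of_le (by linarith [abs_nonneg a, abs_nonneg b])]
    constructor <;> linarith [abs_nonneg a, abs_nonneg b]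
  refine H.mono ?_
  rw [uIcc_of_le (by linarith [abs_nonneg a, abs_nonneg b] : -(|a| + |b|) ≤ |a| + |b|)]
  intro x hx
  rcases abs_le.1 (le_refl |a|) with ⟨h1, h2⟩
  rcases abs_le.1 (le_refl |b|) with ⟨h3, h4⟩
  have := abs_nonneg a
  have := abs_nonneg b
  rcases mem_uIcc.1 hx with h | h <;> constructor <;> linarith [h.1, h.2]

theorem locallyAC_integral {h : ℝ → ℂ} (hh : LocallyIntegrable h volume) (c : ℂ) :
    LocallyAC (fun x => c + ∫ t in (0 : ℝ)..x, h t) := by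
  have hre : LocallyIntegrable (fun x => (h x).re) volume := by
    intro x
    obtain ⟨s, hs, hi⟩ := hh x
    exact ⟨s, hs, hi.re⟩
  have him : LocallyIntegrable (fun x => (h x).im) volume := by
    intro x
    obtain ⟨s, hs, hi⟩ := hh x
    exact ⟨s, hs, hi.im⟩
  have e : (fun x => c + ∫ t in (0 : ℝ)..x, h t) = fun x => c +
      ((∫ t in (0 : ℝ)..x, (h t).re) • (1 : ℂ) + (∫ t in (0 : ℝ)..x, (h t).im) • Complex.I) := by
    funext x
    congr 1
    have h1 := hh.intervalIntegrable' 0 x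
    apply Complex.ext
    · have := intervalIntegral.intervalIntegral_eq_integral_uIoc h 0 x volume
      have h2 := Complex.reCLM.intervalIntegral_comp_comm h1
      simp only [Complex.reCLM_apply] at h2
      simp [h2]
    · have h2 := Complex.imCLM.intervalIntegral_comp_comm h1
      simp only [Complex.imCLM_apply] at h2
      simp [h2]
  rw [e]
  intro a b
  have hc : ∀ z : ℂ, AbsolutelyContinuousOnInterval (fun _ : ℝ => z) a b :=
    fun z => (contDiff_const : ContDiff ℝ 1 fun _ : ℝ => z).locallyAC a b
  exact (hc c).fun_add (((locallyAC_integral_real hre a b).fun_smul (hc 1)).fun_add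
    ((locallyAC_integral_real him a b).fun_smul (hc _)))

/-- F minus a primitive of F' is absolutely continuous with derivative zero almost everywhere, hence
constant. -/
theorem LocallyAC.integral_eq_sub {F F' : ℝ → ℂ} (hF : LocallyAC F)
    (hF' : LocallyIntegrable F' volume) (hd : ∀ᵐ x, HasDerivAt F (F' x) x) (a b : ℝ) :
    ∫ x in a..b, F' x = F b - F a := by
  have hG := locallyAC_integral hF' 0
  have hn : ∀ a b, AbsolutelyContinuousOnInterval
      (fun x => F x + (-1 : ℂ) * (0 + ∫ t in (0 : ℝ)..x, F' t)) a b := fun a b =>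
    (hF.add ((contDiff_const : ContDiff ℝ 1 fun _ : ℝ => (-1 : ℂ)).locallyAC.mul hG)) a b
  obtain ⟨C, hC⟩ := (hn a b).const_of_ae_hasDerivAt_zero (by
    filter_upwards [hd, LocallyIntegrable.ae_hasDerivAt_integral hF'] with x h1 h2 _
    have := h1.add (((h2 0).const_add (0 : ℂ)).const_mul (-1 : ℂ))
    convert! this using 1
    ring)
  have ha := hC a left_mem_uIcc
  have hb := hC b right_mem_uIcc
  have : ∫ x in a..b, F' x = (∫ x in (0 : ℝ)..b, F' x) - ∫ x in (0 : ℝ)..a, F' x :=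
    (intervalIntegral.integral_interval_sub_left (hF'.intervalIntegrable' _ _)
      (hF'.intervalIntegrable' _ _)).symm
  rw [this]
  linear_combination ha - hb

theorem IsTestFunction.contDiff_ofReal {φ : ℝ → ℝ} (hφ : IsTestFunction φ) :
    ContDiff ℝ 1 (fun x => (φ x : ℂ)) :=
  Complex.ofRealCLM.contDiff.comp (hφ.1.of_le (by exact_mod_cast le_top))

theorem IsTestFunction.deriv {φ : ℝ → ℝ} (hφ : IsTestFunction φ) : IsTestFunction (deriv φ) :=
  ⟨(contDiff_infty_iff_deriv.1 hφ.1).2, hφ.2.deriv⟩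

theorem IsTestFunction.hasDerivAt {φ : ℝ → ℝ} (hφ : IsTestFunction φ) (x : ℝ) :
    HasDerivAt φ (_root_.deriv φ x) x :=
  ((hφ.1.differentiable (by simp)) x).hasDerivAt

theorem IsTestFunction.exists_bound {φ : ℝ → ℝ} (hφ : IsTestFunction φ) :
    ∃ R : ℝ, 0 < R ∧ ∀ x, x ∉ Ioo (-R) R → φ x = 0 := by
  obtain ⟨R, hR⟩ := hφ.2.isCompact.isBounded.subset_closedBall 0
  refine ⟨|R| + 1, by positivity, fun x hx => ?_⟩
  by_contra h
  have := hR (subset_tsupport _ h)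
  rw [mem_closedBall_zero_iff, Real.norm_eq_abs] at this
  apply hx
  have h1 := abs_le.1 (this.trans (le_abs_self R))
  constructor <;> linarith [h1.1, h1.2]

theorem IsTestFunction.integrable_smul {φ : ℝ → ℝ} (hφ : IsTestFunction φ) {F : ℝ → ℂ}
    (hF : LocallyIntegrable F volume) : Integrable (fun x => φ x • F x) volume :=
  hF.integrable_smul_left_of_hasCompactSupport hφ.1.continuous hφ.2

theorem LocallyAC.integral_deriv_smul {F F' : ℝ → ℂ} (hF : LocallyAC F)
    (hF' : LocallyIntegrable F' volume) (hd : ∀ᵐ x, HasDerivAt F (F' x) x)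
    {φ : ℝ → ℝ} (hφ : IsTestFunction φ) :
    ∫ x, deriv φ x • F x = -∫ x, φ x • F' x := by
  have hac := hφ.contDiff_ofReal.locallyAC.mul hF
  have i1 := hφ.deriv.integrable_smul hF.continuous.locallyIntegrable
  have i2 := hφ.integrable_smul hF'
  have key := hac.integral_eq_sub (F' := fun x => deriv φ x • F x + φ x • F' x)
    (i1.locallyIntegrable.add i2.locallyIntegrable) (by
      filter_upwards [hd] with x hx
      have := (hφ.hasDerivAt x).ofReal_comp.mul hx
      simpa [Pi.mul_def] using this)
  obtain ⟨R, hR, h0⟩ := hφ.exists_bound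
  have h1 : ∫ x, (deriv φ x • F x + φ x • F' x) = ∫ x in (-R)..R,
      (deriv φ x • F x + φ x • F' x) := by
    rw [intervalIntegral.integral_of_le (by linarith)]
    symm
    have hz : ∀ x, x ∉ Icc (-R) R → deriv φ x • F x + φ x • F' x = 0 := by
      intro x hx
      have ho : (Icc (-R) R)ᶜ ∈ 𝓝 x := isClosed_Icc.isOpen_compl.mem_nhds hx
      have e : φ =ᶠ[𝓝 x] fun _ => 0 := by
        filter_upwards [ho] with y hy
        exact h0 y fun h => hy ⟨h.1.le, h.2.le⟩
      rw [e.deriv_eq, e.eq_of_nhds]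
      simp
    rw [← integral_Icc_eq_integral_Ioc]
    exact setIntegral_eq_integral_of_forall_compl_eq_zero hz
  rw [key, integral_add i1 i2, h0 R (by simp), h0 (-R) (by simp)] at h1
  simp only [Complex.ofReal_zero, zero_mul, sub_self] at h1
  exact eq_neg_of_add_eq_zero_left h1

theorem integral_deriv_smul_primitive {h : ℝ → ℂ} (hh : LocallyIntegrable h volume) (c : ℂ)
    {φ : ℝ → ℝ} (hφ : IsTestFunction φ) :
    ∫ x, deriv φ x • (c + ∫ t in (0 : ℝ)..x, h t) = -∫ x, φ x • h x :=
  (locallyAC_integral hh c).integral_deriv_smul hh (by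
    filter_upwards [LocallyIntegrable.ae_hasDerivAt_integral hh] with x hx using (hx 0).const_add c) hφ

theorem exists_isTestFunction_integral_eq_one :
    ∃ φ : ℝ → ℝ, IsTestFunction φ ∧ ∫ x, φ x = 1 := by
  let f : ContDiffBump (0 : ℝ) := ⟨1, 2, by norm_num, by norm_num⟩
  exact ⟨f.normed volume, ⟨f.contDiff_normed, f.hasCompactSupport_normed⟩, f.integral_normed⟩

theorem IsTestFunction.exists_primitive {φ : ℝ → ℝ} (hφ : IsTestFunction φ)
    (h0 : ∫ x, φ x = 0) : ∃ Φ : ℝ → ℝ, IsTestFunction Φ ∧ _root_.deriv Φ = φ := by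
  obtain ⟨R, hR, hz⟩ := hφ.exists_bound
  have hc := hφ.1.continuous
  have hi : Integrable φ volume := hc.integrable_of_hasCompactSupport hφ.2
  have hd : ∀ x, HasDerivAt (fun x => ∫ t in (-R)..x, φ t) (φ x) x := fun x =>
    intervalIntegral.integral_hasDerivAt_right (hc.intervalIntegrable _ _)
      hc.stronglyMeasurable.stronglyMeasurableAtFilter hc.continuousAt
  have hde : _root_.deriv (fun x => ∫ t in (-R)..x, φ t) = φ := funext fun x => (hd x).deriv
  refine ⟨fun x => ∫ t in (-R)..x, φ t, ⟨?_, ?_⟩, hde⟩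
  · rw [contDiff_infty_iff_deriv, hde]
    exact ⟨fun x => (hd x).differentiableAt, hφ.1⟩
  · apply HasCompactSupport.of_support_subset_isCompact (isCompact_Icc (a := -R) (b := R))
    intro x hx
    by_contra hn
    apply hx
    rw [mem_Icc, not_and_or, not_le, not_le] at hn
    rcases hn with h | h
    · apply intervalIntegral.integral_zero_ae
      refine Eventually.of_forall fun t ht => hz t fun h' => ?_
      rw [uIoc_of_ge h.le] at ht
      linarith [ht.2, h'.1]
    · show ∫ t in (-R)..x, φ t = 0
      rw [intervalIntegral.integral_of_le (by linarith), ← h0]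
      apply setIntegral_eq_integral_of_forall_compl_eq_zero
      intro t ht
      apply hz
      intro h'
      exact ht ⟨h'.1, h'.2.le.trans h.le⟩

/-- The du Bois-Reymond lemma. Subtracting m φ₀ from a test function φ of integral m leaves integral
zero, hence the derivative of a test function. So u - c annihilates every φ, where c is the integral
of φ₀ u. -/
theorem ae_eq_const_of_integral_deriv_smul_eq_zero {u : ℝ → ℂ}
    (hu : LocallyIntegrable u volume)
    (h : ∀ φ : ℝ → ℝ, IsTestFunction φ → ∫ x, deriv φ x • u x = 0) :
    ∃ c : ℂ, u =ᵐ[volume] fun _ => c := by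
  obtain ⟨φ₀, hφ₀, h₀⟩ := exists_isTestFunction_integral_eq_one
  set c : ℂ := ∫ x, φ₀ x • u x with hc
  refine ⟨c, ?_⟩
  have key : ∀ φ : ℝ → ℝ, ContDiff ℝ ∞ φ → HasCompactSupport φ →
      ∫ x, φ x • (u x - c) = 0 := by
    intro φ h1 h2
    have hφ : IsTestFunction φ := ⟨h1, h2⟩
    have hi : Integrable φ volume := h1.continuous.integrable_of_hasCompactSupport h2
    have hi₀ : Integrable φ₀ volume := hφ₀.1.continuous.integrable_of_hasCompactSupport hφ₀.2
    set m := ∫ x, φ x with hm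
    have ht : IsTestFunction (fun x => φ x - m * φ₀ x) := by
      refine ⟨h1.sub (contDiff_const.mul hφ₀.1), ?_⟩
      have := h2.sub (hφ₀.2.mul_left (f := fun _ => m))
      exact this
    obtain ⟨Φ, hΦ, hΦd⟩ := ht.exists_primitive (by
      rw [integral_sub hi (hi₀.const_mul m), integral_const_mul, h₀]; simp [hm])
    have := h Φ hΦ
    rw [hΦd] at this
    have e1 : ∫ x, (φ x - m * φ₀ x) • u x = (∫ x, φ x • u x) - m • c := by
      simp only [sub_smul, mul_smul]
      rw [integral_sub (hφ.integrable_smul hu)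
        (show Integrable (fun x => m • φ₀ x • u x) from (hφ₀.integrable_smul hu).smul m),
        integral_smul]
    have e2 : ∫ x, φ x • (u x - c) = (∫ x, φ x • u x) - m • c := by
      simp only [smul_sub]
      rw [integral_sub (hφ.integrable_smul hu) (hi.smul_const c), integral_smul_const]
    rw [e2, ← e1, this]
  have := ae_eq_zero_of_integral_contDiff_smul_eq_zero
    (hu.sub (locallyIntegrable_const c)) key
  filter_upwards [this] with x hx
  simpa [sub_eq_zero] using hx

theorem ae_eq_primitive_of_integral_deriv_smul {w z : ℝ → ℂ}
    (hw : LocallyIntegrable w volume) (hz : LocallyIntegrable z volume)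
    (h : ∀ φ : ℝ → ℝ, IsTestFunction φ → ∫ x, deriv φ x • w x = -∫ x, φ x • z x) :
    ∃ c : ℂ, w =ᵐ[volume] fun x => c + ∫ t in (0 : ℝ)..x, z t := by
  have hP := (locallyAC_integral hz 0).continuous.locallyIntegrable (μ := volume)
  obtain ⟨c, hc⟩ := ae_eq_const_of_integral_deriv_smul_eq_zero (hw.sub hP) (by
    intro φ hφ
    have : ∀ x, deriv φ x • (w - fun x => 0 + ∫ t in (0 : ℝ)..x, z t) x =
      deriv φ x • w x - deriv φ x • (0 + ∫ t in (0 : ℝ)..x, z t) := by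
      intro x; simp [smul_sub]
    simp_rw [this]
    rw [integral_sub (hφ.deriv.integrable_smul hw) (hφ.deriv.integrable_smul hP), h φ hφ,
      integral_deriv_smul_primitive hz 0 hφ, sub_self])
  refine ⟨c, ?_⟩
  filter_upwards [hc] with x hx
  simp only [Pi.sub_apply, zero_add] at hx
  rw [← hx]; ring

theorem IsWeakDeriv.integral_deriv_smul {m : ℕ} {v w z : ℝ → ℂ} (hw : IsWeakDeriv m v w)
    (hz : IsWeakDeriv (m + 1) v z) (φ : ℝ → ℝ) (hφ : IsTestFunction φ) :
    ∫ x, deriv φ x • w x = -∫ x, φ x • z x := by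
  have h1 := hw.2.2 _ hφ.deriv
  have h2 := hz.2.2 _ hφ
  rw [iteratedDeriv_succ', h1, pow_succ, mul_comm, mul_smul] at h2
  rcases neg_one_pow_eq_or ℝ m with h | h <;> simp only [h, one_smul, neg_smul] at h2
  · exact h2
  · have := neg_injective h2
    simpa using this

theorem IsWeakDeriv.congr {m : ℕ} {v w w' : ℝ → ℂ} (hw : IsWeakDeriv m v w)
    (hww : w =ᵐ[volume] w') : IsWeakDeriv m v w' := by
  refine ⟨hw.1, hw.2.1.congr hww, fun φ hφ => ?_⟩
  rw [hw.2.2 φ hφ]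
  congr 1
  apply integral_congr_ae
  filter_upwards [hww] with x hx using by rw [hx]

theorem contDiff_of_hasDerivAt_chain {N : ℕ} (v : ℕ → ℝ → ℂ)
    (hc : ∀ m ≤ N, Continuous (v m))
    (hd : ∀ m < N, ∀ x, HasDerivAt (v m) (v (m + 1) x) x) :
    ContDiff ℝ N (v 0) ∧ ∀ m ≤ N, iteratedDeriv m (v 0) = v m := by
  have hi : ∀ m ≤ N, iteratedDeriv m (v 0) = v m := by
    intro m
    induction m with
    | zero => intro _; simp
    | succ m ih =>
      intro hm
      rw [iteratedDeriv_succ, ih (by omega)]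
      exact funext fun x => (hd m (by omega) x).deriv
  refine ⟨?_, hi⟩
  rw [contDiff_nat_iff_iteratedDeriv]
  constructor
  · intro m hm
    have hm' : m ≤ N := by exact_mod_cast hm
    rw [hi m hm']
    exact hc m hm'
  · intro m hm
    have hm' : m < N := by exact_mod_cast hm
    rw [hi m hm'.le]
    exact fun x => (hd m hm' x).differentiableAt

/-- A continuous function with weak derivatives up to order `N + 1` is of class `C^N`, and its
`N`-th derivative is a primitive of the weak derivative of order `N + 1`. -/
theorem contDiff_of_isWeakDeriv {N : ℕ} {V h : ℝ → ℂ} (hV : Continuous V)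
    (hw : ∀ m ≤ N, ∃ w, IsWeakDeriv m V w) (hh : IsWeakDeriv (N + 1) V h) :
    ContDiff ℝ N V ∧
    (∀ x, iteratedDeriv N V x = iteratedDeriv N V 0 + ∫ t in (0 : ℝ)..x, h t) ∧
    ∀ m ≤ N, IsWeakDeriv m V (iteratedDeriv m V) := by
  -- The choice is pinned at both ends: w 0 is V itself and w (N + 1) is the given h, so that the
  -- chain of primitives starts and stops at these functions.
  have hw' : ∀ m, ∃ w, m ≤ N + 1 → (IsWeakDeriv m V w ∧ (m = 0 → w = V) ∧ (m = N + 1 → w = h)) := by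
    intro m
    rcases Nat.eq_zero_or_pos m with rfl | h0
    · exact ⟨V, fun _ => ⟨⟨hV.locallyIntegrable, hV.locallyIntegrable, by simp⟩, fun _ => rfl,
        fun h => by omega⟩⟩
    rcases lt_trichotomy m (N + 1) with h1 | rfl | h1
    · obtain ⟨w, hw⟩ := hw m (by omega)
      exact ⟨w, fun _ => ⟨hw, by omega, by omega⟩⟩
    · exact ⟨h, fun _ => ⟨hh, by omega, fun _ => rfl⟩⟩
    · exact ⟨V, fun h => by omega⟩
  choose w hw using hw'
  have hc : ∀ m, ∃ c : ℂ, m ≤ N → w m =ᵐ[volume] fun x => c + ∫ t in (0 : ℝ)..x, w (m + 1) t := by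
    intro m
    by_cases hm : m ≤ N
    · obtain ⟨c, hc⟩ := ae_eq_primitive_of_integral_deriv_smul (hw m (by omega)).1.2.1
        (hw (m + 1) (by omega)).1.2.1
        ((hw m (by omega)).1.integral_deriv_smul (hw (m + 1) (by omega)).1)
      exact ⟨c, fun _ => hc⟩
    · exact ⟨0, fun h => absurd h hm⟩
  choose c hc using hc
  -- v m is the continuous representative of w m. Replacing w (m + 1) by v (m + 1) under the
  -- integral turns the almost everywhere relation v m' = w (m + 1) into one that holds everywhere
  -- for m < N.
  set v : ℕ → ℝ → ℂ := fun m x => c m + ∫ t in (0 : ℝ)..x, w (m + 1) t with hv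
  have hvc : ∀ m ≤ N, Continuous (v m) := fun m hm =>
    (locallyAC_integral (hw (m + 1) (by omega)).1.2.1 (c m)).continuous
  have hv0 : V = v 0 := by
    apply (hV.ae_eq_iff_eq volume (hvc 0 (by omega))).1
    have := hc 0 (by omega)
    rwa [(hw 0 (by omega)).2.1 rfl] at this
  have hvd : ∀ m < N, ∀ x, HasDerivAt (v m) (v (m + 1) x) x := by
    intro m hm x
    have e : v m = fun x => c m + ∫ t in (0 : ℝ)..x, v (m + 1) t := by
      funext y
      simp only [hv]
      congr 1
      apply intervalIntegral.integral_congr_ae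
      filter_upwards [hc (m + 1) (by omega)] with t ht _ using ht
    rw [e]
    have hcc := hvc (m + 1) (by omega)
    exact (intervalIntegral.integral_hasDerivAt_right (hcc.intervalIntegrable _ _)
      hcc.stronglyMeasurable.stronglyMeasurableAtFilter hcc.continuousAt).const_add _
  obtain ⟨h1, h2⟩ := contDiff_of_hasDerivAt_chain v hvc hvd
  rw [← hv0] at h1 h2
  refine ⟨h1, ?_, fun m hm => ?_⟩
  · intro x
    rw [h2 N le_rfl]
    simp only [hv, intervalIntegral.integral_same, add_zero, (hw (N + 1) le_rfl).2.2 rfl]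
  · rw [h2 m hm]
    exact (hw m (by omega)).1.congr (hc m hm)

/-! ### From bounds almost everywhere to bounds everywhere -/

/-- By continuity the inequality fails on an open set, and a nonempty open set is not null. -/
theorem exists_forall_norm_le_of_isBigO_ae {f : ℝ → ℂ} {g : ℝ → ℝ} (hf : Continuous f)
    (hg : Continuous g) (s : Side) (h : f =O[s.filter ⊓ ae volume] g) :
    ∃ C R : ℝ, 0 < C ∧ 0 < R ∧ ∀ t, R ≤ t → ‖f (s.sign * t)‖ ≤ C * |g (s.sign * t)| := by
  obtain ⟨C, hC, hb⟩ := h.exists_pos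
  obtain ⟨S, hS, T, hT, hST⟩ := mem_inf_iff.1 hb.bound
  obtain ⟨R, hR, hRS⟩ : ∃ R : ℝ, 0 < R ∧ ∀ t, R < t → S ∈ 𝓝 (s.sign * t) := by
    cases s with
    | minus =>
      obtain ⟨a, ha⟩ := mem_atBot_sets.1 hS
      refine ⟨|a| + 1, by positivity, fun t ht => mem_of_superset (Iio_mem_nhds ?_)
        fun y (hy : y < a) => ha y hy.le⟩
      simp only [Side.sign]
      linarith [neg_abs_le a]
    | plus =>
      obtain ⟨a, ha⟩ := mem_atTop_sets.1 hS
      refine ⟨|a| + 1, by positivity, fun t ht => mem_of_superset (Ioi_mem_nhds ?_)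
        fun y (hy : a < y) => ha y hy.le⟩
      simp only [Side.sign]
      linarith [le_abs_self a]
  refine ⟨C, R + 1, hC, by linarith, fun t ht => ?_⟩
  by_contra hlt
  rw [not_le] at hlt
  have h1 : {x | C * |g x| < ‖f x‖} ∈ 𝓝 (s.sign * t) :=
    (isOpen_lt (by fun_prop) (by fun_prop)).mem_nhds hlt
  have h2 := inter_mem h1 (hRS t (by linarith))
  have h3 : volume ({x | C * |g x| < ‖f x‖} ∩ S) = 0 := by
    refine measure_mono_null (fun x hx => ?_) (mem_ae_iff.1 hT)
    intro hxT
    have : x ∈ S ∩ T := ⟨hx.2, hxT⟩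
    rw [← hST] at this
    simp only [mem_ofPred_eq, Real.norm_eq_abs] at this
    exact absurd hx.1 (not_lt.2 this)
  exact (Measure.measure_pos_of_mem_nhds volume h2).ne' h3

/-! ### The algebra of the JWKB recursion -/

/-- The quotient `d_i / (λ - d₀)`, where `d_i` stands for the `i`-th derivative of `V = d₀`. -/
noncomputable def quot (d : ℕ → ℝ → ℂ) (i : ℕ) (lam x : ℝ) : ℂ := d i x / ((lam : ℂ) - d 0 x)

/-- Isobaric polynomials of weight `m` without constant term in the quotients `quot d i`,
`1 ≤ i ≤ M`, where `quot d i` has weight `i`. -/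
inductive Isobaric (d : ℕ → ℝ → ℂ) (M : ℕ) : ℕ → (ℝ → ℝ → ℂ) → Prop
  | zero (m : ℕ) : Isobaric d M m (fun _ _ => 0)
  | gen (i : ℕ) (h1 : 1 ≤ i) (hM : i ≤ M) : Isobaric d M i (quot d i)
  | smul {m : ℕ} {F : ℝ → ℝ → ℂ} (c : ℂ) (hF : Isobaric d M m F) :
      Isobaric d M m (fun lam x => c * F lam x)
  | add {m : ℕ} {F G : ℝ → ℝ → ℂ} (hF : Isobaric d M m F) (hG : Isobaric d M m G) :
      Isobaric d M m (fun lam x => F lam x + G lam x)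
  | mul {m k : ℕ} {F G : ℝ → ℝ → ℂ} (hF : Isobaric d M m F) (hG : Isobaric d M k G) :
      Isobaric d M (m + k) (fun lam x => F lam x * G lam x)

namespace Isobaric

variable {d : ℕ → ℝ → ℂ}

theorem mono {M M' m : ℕ} {F : ℝ → ℝ → ℂ} (hF : Isobaric d M m F) (h : M ≤ M') :
    Isobaric d M' m F := by
  induction hF with
  | zero m => exact .zero m
  | gen i h1 hM => exact .gen i h1 (hM.trans h)
  | smul c _ ih => exact .smul c ih
  | add _ _ ih1 ih2 => exact .add ih1 ih2
  | mul _ _ ih1 ih2 => exact .mul ih1 ih2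

theorem sum {M m : ℕ} {ι : Type*} (S : Finset ι) {F : ι → ℝ → ℝ → ℂ}
    (hF : ∀ a ∈ S, Isobaric d M m (F a)) :
    Isobaric d M m (fun lam x => ∑ a ∈ S, F a lam x) := by
  classical
  induction S using Finset.induction_on with
  | empty => simpa using Isobaric.zero m
  | insert a S ha ih =>
    simp only [Finset.sum_insert ha]
    exact .add (hF a (by simp)) (ih fun b hb => hF b (by simp [hb]))

end Isobaric

theorem hasDerivAt_quot {d : ℕ → ℝ → ℂ} {i : ℕ} {lam x : ℝ} (hU : (lam : ℂ) - d 0 x ≠ 0)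
    (h0 : HasDerivAt (d 0) (d 1 x) x) (hi : HasDerivAt (d i) (d (i + 1) x) x) :
    HasDerivAt (quot d i lam) (quot d (i + 1) lam x + quot d i lam x * quot d 1 lam x) x := by
  have := hi.div (h0.const_sub (lam : ℂ)) hU
  convert! this using 1
  simp only [quot]
  field_simp
  ring

namespace Isobaric

variable {d : ℕ → ℝ → ℂ}

/-- Since q_i' = q_{i+1} + q_i q_1, differentiation raises by one both the weight and the largest
index that can occur. The resulting polynomial does not depend on λ or x. -/
theorem exists_hasDerivAt {M m : ℕ} {F : ℝ → ℝ → ℂ} (hF : Isobaric d M m F) :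
    ∃ F' : ℝ → ℝ → ℂ, Isobaric d (M + 1) (m + 1) F' ∧ ∀ lam x : ℝ, (lam : ℂ) - d 0 x ≠ 0 →
      (∀ i ≤ M, HasDerivAt (d i) (d (i + 1) x) x) → HasDerivAt (F lam) (F' lam x) x := by
  induction hF with
  | zero m => exact ⟨_, .zero _, fun lam x _ _ => hasDerivAt_const x 0⟩
  | gen i h1 hM =>
    exact ⟨_, .add (.gen (i + 1) (by omega) (by omega))
      (.mul (.gen i h1 (by omega)) (.gen 1 le_rfl (by omega))),
      fun lam x hU h => hasDerivAt_quot hU (h 0 (by omega)) (h i hM)⟩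
  | smul c _ ih =>
    obtain ⟨F', h1, h2⟩ := ih
    exact ⟨_, .smul c h1, fun lam x hU h => (h2 lam x hU h).const_mul c⟩
  | add _ _ ih1 ih2 =>
    obtain ⟨F', h1, h2⟩ := ih1
    obtain ⟨G', h3, h4⟩ := ih2
    exact ⟨_, .add h1 h3, fun lam x hU h => (h2 lam x hU h).add (h4 lam x hU h)⟩
  | @mul m k F G hF hG ih1 ih2 =>
    obtain ⟨F', h1, h2⟩ := ih1
    obtain ⟨G', h3, h4⟩ := ih2
    refine ⟨fun lam x => F' lam x * G lam x + F lam x * G' lam x, ?_,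
      fun lam x hU h => (h2 lam x hU h).mul (h4 lam x hU h)⟩
    have h5 := Isobaric.mul (hF.mono (Nat.le_succ M)) h3
    refine .add ?_ h5
    have := h1.mul (hG.mono (Nat.le_succ M))
    rwa [show m + 1 + k = m + k + 1 by omega] at this

/-- There is no constant term, so every monomial carries at least one factor ρ; further factors are
absorbed by ρ ≤ B. The powers of μ add up to the weight. -/
theorem exists_norm_le {M m : ℕ} {F : ℝ → ℝ → ℂ} (hF : Isobaric d M m F) (A B : ℝ) :
    ∃ C : ℝ, 0 ≤ C ∧ ∀ lam x ρ μ : ℝ, 0 ≤ ρ → ρ ≤ B → 0 ≤ μ →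
      (∀ i, 1 ≤ i → i ≤ M → ‖quot d i lam x‖ ≤ A * (ρ * μ ^ i)) →
      ‖F lam x‖ ≤ C * (ρ * μ ^ m) := by
  induction hF with
  | zero m => exact ⟨0, le_rfl, fun lam x ρ μ _ _ _ _ => by simp⟩
  | gen i h1 hM =>
    refine ⟨|A|, abs_nonneg A, fun lam x ρ μ h2 _ h3 h => (h i h1 hM).trans ?_⟩
    exact mul_le_mul_of_nonneg_right (le_abs_self A) (by positivity)
  | smul c _ ih =>
    obtain ⟨C, hC, h⟩ := ih
    refine ⟨‖c‖ * C, by positivity, fun lam x ρ μ h1 h2 h3 h4 => ?_⟩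
    rw [norm_mul, mul_assoc]
    exact mul_le_mul_of_nonneg_left (h lam x ρ μ h1 h2 h3 h4) (norm_nonneg c)
  | add _ _ ih1 ih2 =>
    obtain ⟨C, hC, h⟩ := ih1
    obtain ⟨D, hD, h'⟩ := ih2
    refine ⟨C + D, by positivity, fun lam x ρ μ h1 h2 h3 h4 => (norm_add_le _ _).trans ?_⟩
    rw [add_mul]
    exact add_le_add (h lam x ρ μ h1 h2 h3 h4) (h' lam x ρ μ h1 h2 h3 h4)
  | @mul m k F G _ _ ih1 ih2 =>
    obtain ⟨C, hC, h⟩ := ih1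
    obtain ⟨D, hD, h'⟩ := ih2
    refine ⟨C * D * |B|, by positivity, fun lam x ρ μ h1 h2 h3 h4 => ?_⟩
    rw [norm_mul]
    calc ‖F lam x‖ * ‖G lam x‖ ≤ (C * (ρ * μ ^ m)) * (D * (ρ * μ ^ k)) :=
          mul_le_mul (h lam x ρ μ h1 h2 h3 h4) (h' lam x ρ μ h1 h2 h3 h4) (norm_nonneg _)
            (by positivity)
      _ = (C * D * (ρ * μ ^ (m + k))) * ρ := by rw [pow_add]; ring
      _ ≤ (C * D * (ρ * μ ^ (m + k))) * |B| :=
          mul_le_mul_of_nonneg_left (h2.trans (le_abs_self B)) (by positivity)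
      _ = _ := by ring

theorem continuous {M m : ℕ} {F : ℝ → ℝ → ℂ} (hF : Isobaric d M m F) {lam : ℝ}
    (hU : ∀ x, (lam : ℂ) - d 0 x ≠ 0) (hd : ∀ i ≤ M, Continuous (d i)) :
    Continuous (F lam) := by
  induction hF with
  | zero m => exact continuous_const
  | gen i h1 hM =>
    exact (hd i hM).div (continuous_const.sub (hd 0 (by omega))) hU
  | smul c _ ih => exact continuous_const.mul ih
  | add _ _ ih1 ih2 => exact ih1.add ih2
  | mul _ _ ih1 ih2 => exact ih1.mul ih2

theorem locallyAC {M m : ℕ} {F : ℝ → ℝ → ℂ} (hF : Isobaric d M m F) {lam : ℝ}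
    (hU : LocallyAC fun x => 1 / ((lam : ℂ) - d 0 x)) (hd : ∀ i ≤ M, LocallyAC (d i)) :
    LocallyAC (F lam) := by
  have hc : ∀ c : ℂ, LocallyAC fun _ => c := fun c =>
    (contDiff_const : ContDiff ℝ 1 fun _ : ℝ => c).locallyAC
  induction hF with
  | zero m => exact hc 0
  | gen i h1 hM =>
    have := (hd i hM).mul hU
    simp only [mul_one_div] at this
    exact this
  | smul c _ ih => exact (hc c).mul ih
  | add _ _ ih1 ih2 => exact ih1.add ih2
  | mul _ _ ih1 ih2 => exact ih1.mul ih2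

end Isobaric

/-! ### The JWKB terms as isobaric expressions -/

theorem psiDeriv_zero (V : ℝ → ℂ) (lam x : ℝ) : psiDeriv V lam 0 x =
    Complex.I * ((lam ^ (-(1 / 2 : ℝ)) : ℝ) : ℂ) * ((lam : ℂ) - V x) ^ (1 / 2 : ℂ) := by
  rw [psiDeriv]

theorem psiDeriv_succ (V : ℝ → ℂ) (lam : ℝ) (j : ℕ) (x : ℝ) : psiDeriv V lam (j + 1) x =
    1 / (2 * psiDeriv V lam 0 x) * (deriv (psiDeriv V lam j) x
      - ∑ a ∈ Finset.range j, psiDeriv V lam (a + 1) x * psiDeriv V lam (j - a) x) := by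
  rw [Finset.sum_range]
  conv_lhs => rw [psiDeriv]

theorem psiDeriv_zero_ne_zero {V : ℝ → ℂ} {lam x : ℝ} (hlam : 0 < lam)
    (hU : (lam : ℂ) - V x ∈ Complex.slitPlane) : psiDeriv V lam 0 x ≠ 0 := by
  rw [psiDeriv_zero]
  refine mul_ne_zero (mul_ne_zero Complex.I_ne_zero ?_) ?_
  · exact_mod_cast (Real.rpow_pos_of_pos hlam _).ne'
  · rw [Complex.cpow_ne_zero_iff]
    exact Or.inl (Complex.slitPlane_ne_zero hU)

theorem hasDerivAt_psiDeriv_zero {d : ℕ → ℝ → ℂ} {lam x : ℝ}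
    (hU : (lam : ℂ) - d 0 x ∈ Complex.slitPlane) (h0 : HasDerivAt (d 0) (d 1 x) x)  :
    HasDerivAt (psiDeriv (d 0) lam 0) (-(psiDeriv (d 0) lam 0 x * quot d 1 lam x / 2)) x := by
  have hc : ContinuousAt (d 0) x := h0.continuousAt
  have hne : ∀ᶠ y in 𝓝 x, (lam : ℂ) - d 0 y ≠ 0 :=
    (continuousAt_const.sub hc).eventually_ne (Complex.slitPlane_ne_zero hU)
  have e : psiDeriv (d 0) lam 0 =ᶠ[𝓝 x] fun y => Complex.I * ((lam ^ (-(1 / 2 : ℝ)) : ℝ) : ℂ) *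
      Complex.exp (Complex.log ((lam : ℂ) - d 0 y) * (1 / 2 : ℂ)) := by
    filter_upwards [hne] with y hy
    rw [psiDeriv_zero, Complex.cpow_def_of_ne_zero hy]
  have h1 := ((((h0.const_sub (lam : ℂ)).clog_real hU).mul_const (1 / 2 : ℂ)).cexp).const_mul
    (Complex.I * ((lam ^ (-(1 / 2 : ℝ)) : ℝ) : ℂ))
  refine (h1.congr_of_eventuallyEq e).congr_deriv ?_
  rw [e.eq_of_nhds, quot]
  ring

/-- The structure of the JWKB terms: `ψ'_{j-1} = Q_j / (ψ'_{-1})^{j-1}`, where `Q_j` is isobaric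
of weight `j` and linear in the highest derivative. -/
theorem exists_isobaric_psiDeriv (d : ℕ → ℝ → ℂ) (N : ℕ) (j : ℕ) (h1 : 1 ≤ j) (hj : j ≤ N) :
    ∃ (c : ℂ) (G : ℝ → ℝ → ℂ), Isobaric d (j - 1) j G ∧ ∀ lam : ℝ, 0 < lam →
      (∀ x, (lam : ℂ) - d 0 x ∈ Complex.slitPlane) →
      (∀ i < N, ∀ x, HasDerivAt (d i) (d (i + 1) x) x) → ∀ x,
        psiDeriv (d 0) lam j x
          = (c * quot d j lam x + G lam x) / psiDeriv (d 0) lam 0 x ^ (j - 1) := by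
  induction j using Nat.strong_induction_on with
  | _ j ih =>
  obtain ⟨k, rfl⟩ : ∃ k, j = k + 1 := ⟨j - 1, by omega⟩
  rcases Nat.eq_zero_or_pos k with rfl | hk
  -- From ψ''_{-1} = -ψ'_{-1} q_1 / 2 the recursion gives ψ'_0 = -q_1 / 4.
  · refine ⟨-1 / 4, _, .zero 1, fun lam hlam hU hd x => ?_⟩
    have hb := psiDeriv_zero_ne_zero hlam (hU x)
    rw [psiDeriv_succ, (hasDerivAt_psiDeriv_zero (hU x) (hd 0 (by omega) x)).deriv]
    simp only [Finset.range_zero, Finset.sum_empty, sub_zero, zero_add, pow_zero,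
      Nat.sub_self, add_zero, div_one]
    field_simp
    ring
  have ih' : ∀ i, ∃ (c : ℂ) (G : ℝ → ℝ → ℂ), 1 ≤ i → i ≤ k → Isobaric d (i - 1) i G ∧
      ∀ lam : ℝ, 0 < lam → (∀ x, (lam : ℂ) - d 0 x ∈ Complex.slitPlane) →
      (∀ i < N, ∀ x, HasDerivAt (d i) (d (i + 1) x) x) → ∀ x,
        psiDeriv (d 0) lam i x
          = (c * quot d i lam x + G lam x) / psiDeriv (d 0) lam 0 x ^ (i - 1) := by
    intro i
    by_cases hi : 1 ≤ i ∧ i ≤ k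
    · obtain ⟨c, G, h⟩ := ih i (by omega) hi.1 (by omega)
      exact ⟨c, G, fun _ _ => h⟩
    · exact ⟨0, fun _ _ => 0, fun h1 h2 => absurd ⟨h1, h2⟩ hi⟩
  choose c G hG using ih'
  obtain ⟨G', hG', hGd⟩ := (hG k hk le_rfl).1.exists_hasDerivAt
  have hQ : ∀ i, 1 ≤ i → i ≤ k →
      Isobaric d k i (fun lam x => c i * quot d i lam x + G i lam x) := fun i h1 h2 =>
    .add (.smul _ (.gen i h1 h2)) ((hG i h1 h2).1.mono (by omega))
  have hk1 : k - 1 + 1 = k := by omega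
  rw [hk1] at hG'
  -- All contributions to the bracket of the recursion have denominator (ψ'_{-1})^{k-1}, and the
  -- prefactor 1/(2 ψ'_{-1}) adds the factor 1/2 and one more power. The term with (k - 1)/2 comes
  -- from differentiating the denominator, ψ'_{-1} having logarithmic derivative -q_1/2. Only c_k
  -- q_k' produces q_{k+1}.
  refine ⟨c k / 2, fun lam x => (1 / 2 : ℂ) * ((c k * (quot d k lam x * quot d 1 lam x)
      + G' lam x) + (((k - 1 : ℕ) : ℂ) / 2 * ((c k * quot d k lam x + G k lam x) * quot d 1 lam x)
      + (-1) * ∑ a ∈ Finset.range k, (c (a + 1) * quot d (a + 1) lam x + G (a + 1) lam x)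
          * (c (k - a) * quot d (k - a) lam x + G (k - a) lam x))), ?_, ?_⟩
  · rw [show k + 1 - 1 = k by omega]
    refine .smul _ (.add (.add (.smul _ (.mul (.gen k hk le_rfl) (.gen 1 le_rfl hk))) hG')
      (.add (.smul _ (.mul (hQ k hk le_rfl) (.gen 1 le_rfl hk))) (.smul _ (.sum _ ?_))))
    intro a ha
    have ha := Finset.mem_range.1 ha
    have := (hQ (a + 1) (by omega) (by omega)).mul (hQ (k - a) (by omega) (by omega))
    rwa [show a + 1 + (k - a) = k + 1 by omega] at this
  · intro lam hlam hU hd x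
    have hb := psiDeriv_zero_ne_zero hlam (hU x)
    have hb' := hasDerivAt_psiDeriv_zero (hU x) (hd 0 (by omega) x)
    have hq := hasDerivAt_quot (i := k) (Complex.slitPlane_ne_zero (hU x)) (hd 0 (by omega) x)
      (hd k (by omega) x)
    have hGx := hGd lam x (Complex.slitPlane_ne_zero (hU x))
      (fun i hi => hd i (by omega) x)
    have hder := ((hq.const_mul (c k)).add hGx).div (hb'.pow (k - 1)) (pow_ne_zero _ hb)
    have e : psiDeriv (d 0) lam k = fun y =>
        (c k * quot d k lam y + G k lam y) / psiDeriv (d 0) lam 0 y ^ (k - 1) :=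
      funext fun y => (hG k hk le_rfl).2 lam hlam hU hd y
    have hdv : deriv (psiDeriv (d 0) lam k) x = ((c k * (quot d (k + 1) lam x + quot d k lam x *
        quot d 1 lam x) + G' lam x) + ((k - 1 : ℕ) : ℂ) / 2 *
        ((c k * quot d k lam x + G k lam x) * quot d 1 lam x)) /
          psiDeriv (d 0) lam 0 x ^ (k - 1) := by
      rw [e]
      refine (HasDerivAt.deriv hder).trans ?_
      rcases Nat.exists_eq_add_of_lt hk with ⟨l, rfl⟩
      rw [show 0 + l + 1 - 1 = l by omega]
      simp only [Pi.add_apply, Pi.pow_apply]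
      rcases l with _ | l
      · simp
      · rw [show l + 1 - 1 = l by omega]
        field_simp
        ring
    have hs : ∑ a ∈ Finset.range k, psiDeriv (d 0) lam (a + 1) x * psiDeriv (d 0) lam (k - a) x
        = (∑ a ∈ Finset.range k, (c (a + 1) * quot d (a + 1) lam x + G (a + 1) lam x)
          * (c (k - a) * quot d (k - a) lam x + G (k - a) lam x)) /
            psiDeriv (d 0) lam 0 x ^ (k - 1) := by
      rw [Finset.sum_div]
      refine Finset.sum_congr rfl fun a ha => ?_
      have ha := Finset.mem_range.1 ha
      rw [(hG (a + 1) (by omega) (by omega)).2 lam hlam hU hd x,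
        (hG (k - a) (by omega) (by omega)).2 lam hlam hU hd x, div_mul_div_comm, ← pow_add]
      congr 2
      omega
    rw [psiDeriv_succ, hdv, hs, show k + 1 - 1 = (k - 1) + 1 by omega, pow_succ]
    field_simp
    ring

/-! ### The rescaled terms and the Riccati remainder -/

/-- The term `λ^{-k/2} ψ'_k` of the logarithmic derivative of the ansatz; here `j = k + 1`. -/
noncomputable def wkbTerm (V : ℝ → ℂ) (lam : ℝ) (j : ℕ) (x : ℝ) : ℂ :=
  ((lam ^ (-((j : ℝ) - 1) / 2) : ℝ) : ℂ) * psiDeriv V lam j x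

theorem scale_succ {lam : ℝ} (hlam : 0 < lam) (j : ℕ) :
    lam ^ (-(((j + 1 : ℕ) : ℝ) - 1) / 2) = (Real.sqrt lam ^ j)⁻¹ := by
  rw [Real.sqrt_eq_rpow, ← Real.rpow_natCast, ← Real.rpow_mul hlam.le, ← Real.rpow_neg hlam.le]
  congr 1
  push_cast
  ring

theorem scale_zero (lam : ℝ) : lam ^ (-(((0 : ℕ) : ℝ) - 1) / 2) = Real.sqrt lam := by
  rw [Real.sqrt_eq_rpow]
  norm_num

theorem wkbTerm_zero (V : ℝ → ℂ) {lam : ℝ} (hlam : 0 < lam) (x : ℝ) :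
    wkbTerm V lam 0 x = Complex.I * ((lam : ℂ) - V x) ^ (1 / 2 : ℂ) := by
  have h1 : ((Real.sqrt lam : ℝ) : ℂ) * ((lam ^ (-(1 / 2 : ℝ)) : ℝ) : ℂ) = 1 := by
    rw [← Complex.ofReal_mul, Real.sqrt_eq_rpow, ← Real.rpow_add hlam]
    norm_num
  rw [wkbTerm, psiDeriv_zero, scale_zero]
  linear_combination (Complex.I * ((lam : ℂ) - V x) ^ (1 / 2 : ℂ)) * h1

theorem wkbTerm_zero_sq (V : ℝ → ℂ) {lam : ℝ} (hlam : 0 < lam) (x : ℝ) :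
    wkbTerm V lam 0 x ^ 2 = -((lam : ℂ) - V x) := by
  rw [wkbTerm_zero V hlam, mul_pow, Complex.I_sq, one_div]
  have : (((lam : ℂ) - V x) ^ ((2 : ℂ)⁻¹)) ^ 2 = (lam : ℂ) - V x := by
    have := Complex.cpow_nat_inv_pow ((lam : ℂ) - V x) (n := 2) two_ne_zero
    exact_mod_cast this
  rw [this]
  ring

theorem wkbTerm_zero_ne_zero {V : ℝ → ℂ} {lam x : ℝ} (hlam : 0 < lam)
    (hU : (lam : ℂ) - V x ∈ Complex.slitPlane) : wkbTerm V lam 0 x ≠ 0 := by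
  intro h
  have := wkbTerm_zero_sq V hlam x
  rw [h] at this
  exact Complex.slitPlane_ne_zero hU (by linear_combination this)

theorem norm_wkbTerm_zero_sq (V : ℝ → ℂ) {lam : ℝ} (hlam : 0 < lam) (x : ℝ) :
    ‖wkbTerm V lam 0 x‖ ^ 2 = ‖(lam : ℂ) - V x‖ := by
  rw [← norm_pow, wkbTerm_zero_sq V hlam, norm_neg]

theorem wkbTerm_succ {V : ℝ → ℂ} {lam x : ℝ} (hlam : 0 < lam)
    (hU : (lam : ℂ) - V x ∈ Complex.slitPlane) (j : ℕ) :
    2 * wkbTerm V lam 0 x * wkbTerm V lam (j + 1) x = deriv (wkbTerm V lam j) x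
      - ∑ a ∈ Finset.range j, wkbTerm V lam (a + 1) x * wkbTerm V lam (j - a) x := by
  have hs : ((Real.sqrt lam : ℝ) : ℂ) ≠ 0 := by exact_mod_cast (Real.sqrt_pos.2 hlam).ne'
  have hb := psiDeriv_zero_ne_zero hlam hU
  have e : wkbTerm V lam j = fun y => ((lam ^ (-((j : ℝ) - 1) / 2) : ℝ) : ℂ) *
    psiDeriv V lam j y := rfl
  rw [e, deriv_const_mul_field]
  have hsum : ∑ a ∈ Finset.range j, wkbTerm V lam (a + 1) x * wkbTerm V lam (j - a) x =
      ((lam ^ (-((j : ℝ) - 1) / 2) : ℝ) : ℂ) *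
      ∑ a ∈ Finset.range j, psiDeriv V lam (a + 1) x * psiDeriv V lam (j - a) x := by
    rw [Finset.mul_sum]
    refine Finset.sum_congr rfl fun a ha => ?_
    obtain ⟨l, rfl⟩ : ∃ l, j = a + l + 1 := ⟨j - a - 1, by have := Finset.mem_range.1 ha; omega⟩
    rw [show a + l + 1 - a = l + 1 by omega, wkbTerm, wkbTerm, scale_succ hlam, scale_succ hlam,
      scale_succ hlam, pow_add, mul_inv]
    push_cast
    ring
  rw [hsum, wkbTerm, wkbTerm, scale_zero, scale_succ hlam, psiDeriv_succ]
  rcases j with _ | j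
  · rw [scale_zero]
    simp
    field_simp
  · rw [scale_succ hlam, pow_succ]
    push_cast
    field_simp

theorem exists_isobaric_wkbTerm (d : ℕ → ℝ → ℂ) (N : ℕ) (j : ℕ) (h1 : 1 ≤ j) (hj : j ≤ N) :
    ∃ (c : ℂ) (G : ℝ → ℝ → ℂ), Isobaric d (j - 1) j G ∧ ∀ lam : ℝ, 0 < lam →
      (∀ x, (lam : ℂ) - d 0 x ∈ Complex.slitPlane) →
      (∀ i < N, ∀ x, HasDerivAt (d i) (d (i + 1) x) x) → ∀ x,
        wkbTerm (d 0) lam j x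
          = (c * quot d j lam x + G lam x) / wkbTerm (d 0) lam 0 x ^ (j - 1) := by
  obtain ⟨c, G, hG, h⟩ := exists_isobaric_psiDeriv d N j h1 hj
  refine ⟨c, G, hG, fun lam hlam hU hd x => ?_⟩
  have hs : ((Real.sqrt lam : ℝ) : ℂ) ≠ 0 := by exact_mod_cast (Real.sqrt_pos.2 hlam).ne'
  have hb := psiDeriv_zero_ne_zero hlam (hU x)
  obtain ⟨k, rfl⟩ : ∃ k, j = k + 1 := ⟨j - 1, by omega⟩
  rw [wkbTerm, h lam hlam hU hd x, wkbTerm, scale_zero, scale_succ hlam,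
    show k + 1 - 1 = k by omega, mul_pow]
  push_cast
  field_simp

theorem hasDerivAt_wkbTerm_zero {d : ℕ → ℝ → ℂ} {lam x : ℝ}
    (hU : (lam : ℂ) - d 0 x ∈ Complex.slitPlane) (h0 : HasDerivAt (d 0) (d 1 x) x) :
    HasDerivAt (wkbTerm (d 0) lam 0) (-(wkbTerm (d 0) lam 0 x * quot d 1 lam x / 2)) x := by
  refine ((hasDerivAt_psiDeriv_zero hU h0).const_mul _).congr_deriv ?_
  rw [wkbTerm]
  ring

/-- Substitute i = a and k = j - a - 1, so that j = i + k + 1. The products occurring in the first N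
recursion steps are thereby recognised inside the square of the whole sum. -/
theorem sum_range_sum_range_sub {R : Type*} [AddCommGroup R] (f : ℕ → ℕ → R) (N : ℕ) :
    ∑ j ∈ Finset.range N, ∑ a ∈ Finset.range j, f (a + 1) (j - a) =
    ∑ i ∈ Finset.range N, ∑ k ∈ Finset.range N,
      if i + k + 1 < N then f (i + 1) (k + 1) else 0 := by
  rw [Finset.sum_sigma', Finset.sum_sigma', ← Finset.sum_filter]
  refine Finset.sum_nbij' (fun p => ⟨p.2, p.1 - p.2 - 1⟩) (fun p => ⟨p.1 + p.2 + 1, p.1⟩)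
    ?_ ?_ ?_ ?_ ?_
  · rintro ⟨j, a⟩ h
    simp only [Finset.mem_sigma, Finset.mem_range, Finset.mem_filter] at h ⊢
    omega
  · rintro ⟨j, a⟩ h
    simp only [Finset.mem_sigma, Finset.mem_range, Finset.mem_filter] at h ⊢
    omega
  · rintro ⟨j, a⟩ h
    simp only [Finset.mem_sigma, Finset.mem_range] at h
    simp only [Sigma.mk.injEq, heq_eq_eq, and_true]
    omega
  · rintro ⟨j, a⟩ h
    simp only [Sigma.mk.injEq, heq_eq_eq, true_and]
    omega
  · rintro ⟨j, a⟩ h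
    simp only [Finset.mem_sigma, Finset.mem_range] at h
    simp only
    congr 1
    omega

/-- The logarithmic derivative of the ansatz, up to sign. -/
noncomputable def phaseDeriv (V : ℝ → ℂ) (N : ℕ) (lam x : ℝ) : ℂ :=
  ∑ j ∈ Finset.range (N + 1), wkbTerm V lam j x

/-- The truncated JWKB expansion solves the Riccati equation up to terms of high order. -/
theorem riccati_remainder {V : ℝ → ℂ} {N : ℕ} {lam x : ℝ} {D : ℂ} (hlam : 0 < lam)
    (hU : (lam : ℂ) - V x ∈ Complex.slitPlane)
    (hd : ∀ j < N, DifferentiableAt ℝ (wkbTerm V lam j) x)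
    (hD : HasDerivAt (wkbTerm V lam N) D x) :
    ∃ D', HasDerivAt (phaseDeriv V N lam) D' x ∧
      D' - phaseDeriv V N lam x ^ 2 + V x - lam = D - ∑ i ∈ Finset.range N,
        ∑ k ∈ Finset.range N, if i + k + 1 < N then 0 else
          wkbTerm V lam (i + 1) x * wkbTerm V lam (k + 1) x := by
  refine ⟨(∑ j ∈ Finset.range N, deriv (wkbTerm V lam j) x) + D, ?_, ?_⟩
  · have h1 := (HasDerivAt.fun_sum fun j hj =>
      (hd j (Finset.mem_range.1 hj)).hasDerivAt).add hD
    refine h1.congr_of_eventuallyEq (Eventually.of_forall fun y => ?_)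
    rw [phaseDeriv, Finset.sum_range_succ, Pi.add_apply]
  -- Summing the recursion over j < N expresses the derivatives of the first N terms by the cross
  -- terms 2 w_0 w_{j+1} and the products with i + k + 1 < N. Both cancel against the square of the
  -- phase derivative, and w_0² = V - λ removes the potential.
  · have h1 : ∑ j ∈ Finset.range N, deriv (wkbTerm V lam j) x =
        2 * wkbTerm V lam 0 x * ∑ j ∈ Finset.range N, wkbTerm V lam (j + 1) x +
        ∑ j ∈ Finset.range N, ∑ a ∈ Finset.range j,
          wkbTerm V lam (a + 1) x * wkbTerm V lam (j - a) x := by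
      rw [Finset.mul_sum, ← Finset.sum_add_distrib]
      refine Finset.sum_congr rfl fun j _ => ?_
      rw [wkbTerm_succ hlam hU j]
      ring
    have h2 : (∑ j ∈ Finset.range N, wkbTerm V lam (j + 1) x) ^ 2 =
        ∑ i ∈ Finset.range N, ∑ k ∈ Finset.range N,
          wkbTerm V lam (i + 1) x * wkbTerm V lam (k + 1) x := by
      rw [sq, Finset.sum_mul_sum]
    have h3 : ∑ i ∈ Finset.range N, ∑ k ∈ Finset.range N,
          wkbTerm V lam (i + 1) x * wkbTerm V lam (k + 1) x =
        (∑ i ∈ Finset.range N, ∑ k ∈ Finset.range N, if i + k + 1 < N then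
          wkbTerm V lam (i + 1) x * wkbTerm V lam (k + 1) x else 0) +
        ∑ i ∈ Finset.range N, ∑ k ∈ Finset.range N, if i + k + 1 < N then 0 else
          wkbTerm V lam (i + 1) x * wkbTerm V lam (k + 1) x := by
      rw [← Finset.sum_add_distrib]
      refine Finset.sum_congr rfl fun i _ => ?_
      rw [← Finset.sum_add_distrib]
      refine Finset.sum_congr rfl fun k _ => ?_
      split_ifs <;> simp
    rw [sum_range_sum_range_sub (fun i k => wkbTerm V lam i x * wkbTerm V lam k x)] at h1
    have h4 := wkbTerm_zero_sq V hlam x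
    rw [phaseDeriv, Finset.sum_range_succ', h1]
    linear_combination -h4 - h2 - h3

theorem differentiableAt_wkbTerm {d : ℕ → ℝ → ℂ} {N : ℕ} {lam : ℝ} (hlam : 0 < lam)
    (hU : ∀ x, (lam : ℂ) - d 0 x ∈ Complex.slitPlane)
    (hd : ∀ i < N, ∀ x, HasDerivAt (d i) (d (i + 1) x) x) {j : ℕ} (hj : j ≤ N) {x : ℝ}
    (hx : ∀ i ≤ j, HasDerivAt (d i) (d (i + 1) x) x) :
    DifferentiableAt ℝ (wkbTerm (d 0) lam j) x := by
  have h0 := hasDerivAt_wkbTerm_zero (hU x) (hx 0 (by omega))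
  rcases Nat.eq_zero_or_pos j with rfl | hj0
  · exact h0.differentiableAt
  obtain ⟨c, G, hG, h⟩ := exists_isobaric_wkbTerm d N j hj0 hj
  obtain ⟨G', _, hGd⟩ := hG.exists_hasDerivAt
  have h1 := hGd lam x (Complex.slitPlane_ne_zero (hU x)) fun i hi => hx i (by omega)
  have h2 := hasDerivAt_quot (Complex.slitPlane_ne_zero (hU x)) (hx 0 (by omega)) (hx j le_rfl)
  rw [show wkbTerm (d 0) lam j = fun x => (c * quot d j lam x + G lam x) /
    wkbTerm (d 0) lam 0 x ^ (j - 1) from funext fun x => h lam hlam hU hd x]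
  exact (((h2.differentiableAt.const_mul c).add h1.differentiableAt).div
    (h0.differentiableAt.pow _) (pow_ne_zero _ (wkbTerm_zero_ne_zero hlam (hU x))))

theorem half_sqrt_le_norm_wkbTerm_zero {V : ℝ → ℂ} {lam x : ℝ} (hlam : 0 < lam)
    (h : lam / 2 ≤ ‖(lam : ℂ) - V x‖) : Real.sqrt lam / 2 ≤ ‖wkbTerm V lam 0 x‖ := by
  have h1 := norm_wkbTerm_zero_sq V hlam x
  have h2 := Real.sq_sqrt hlam.le
  refine abs_le_of_sq_le_sq' ?_ (norm_nonneg _) |>.2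
  rw [h1, div_pow, h2]
  linarith

theorem norm_div_wkbTerm_zero_pow_le {V : ℝ → ℂ} {lam x : ℝ} (hlam : 0 < lam)
    (h : lam / 2 ≤ ‖(lam : ℂ) - V x‖) (z : ℂ) (k : ℕ) :
    ‖z / wkbTerm V lam 0 x ^ k‖ ≤ 2 ^ k * ‖z‖ / Real.sqrt lam ^ k := by
  have hs := Real.sqrt_pos.2 hlam
  have h1 := half_sqrt_le_norm_wkbTerm_zero hlam h
  rw [norm_div, norm_pow]
  calc ‖z‖ / ‖wkbTerm V lam 0 x‖ ^ k ≤ ‖z‖ / (Real.sqrt lam / 2) ^ k := by gcongr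
    _ = _ := by rw [div_pow]; field_simp

/-- Pointwise bounds on the JWKB terms and on the remainder. -/
theorem exists_wkb_bounds (d : ℕ → ℝ → ℂ) (N : ℕ) (hN : 1 ≤ N) (A B : ℝ) :
    ∃ C : ℝ, 0 ≤ C ∧ ∀ lam ρ μ x : ℝ, 0 < lam →
      (∀ y, (lam : ℂ) - d 0 y ∈ Complex.slitPlane) →
      (∀ i < N, ∀ y, HasDerivAt (d i) (d (i + 1) y) y) →
      0 ≤ ρ → ρ ≤ B → 0 ≤ μ → μ ≤ B * Real.sqrt lam → lam / 2 ≤ ‖(lam : ℂ) - d 0 x‖ →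
      (∀ i, 1 ≤ i → i ≤ N → ‖quot d i lam x‖ ≤ A * (ρ * μ ^ i)) →
      (∀ j, 1 ≤ j → j ≤ N →
        ‖wkbTerm (d 0) lam j x‖ ≤ C * (ρ * μ ^ j) / Real.sqrt lam ^ (j - 1)) ∧
      (HasDerivAt (d N) (d (N + 1) x) x → ∃ D, HasDerivAt (phaseDeriv (d 0) N lam) D x ∧
        ‖D - phaseDeriv (d 0) N lam x ^ 2 + d 0 x - lam‖ ≤
          C * (ρ * μ ^ (N + 1) / Real.sqrt lam ^ (N - 1)) +
          C * ‖d (N + 1) x‖ / Real.sqrt lam ^ (N + 1)) := by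
  -- With B ≥ 1 every power of B that occurs below is at most B^(2N).
  wlog hB : 1 ≤ B generalizing B
  · obtain ⟨C, hC, h⟩ := this 1 le_rfl
    refine ⟨C, hC, fun lam ρ μ x h1 h2 h3 h4 h5 h6 h7 h8 h9 => ?_⟩
    refine h lam ρ μ x h1 h2 h3 h4 (by linarith) h6 (h7.trans ?_) h8 h9
    exact mul_le_mul_of_nonneg_right (by linarith) (Real.sqrt_nonneg _)
  have hterm : ∀ j, ∃ C : ℝ, 0 ≤ C ∧ (1 ≤ j → j ≤ N → ∀ lam ρ μ x : ℝ, 0 < lam →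
      (∀ y, (lam : ℂ) - d 0 y ∈ Complex.slitPlane) →
      (∀ i < N, ∀ y, HasDerivAt (d i) (d (i + 1) y) y) →
      0 ≤ ρ → ρ ≤ B → 0 ≤ μ → lam / 2 ≤ ‖(lam : ℂ) - d 0 x‖ →
      (∀ i, 1 ≤ i → i ≤ N → ‖quot d i lam x‖ ≤ A * (ρ * μ ^ i)) →
        ‖wkbTerm (d 0) lam j x‖ ≤ C * (ρ * μ ^ j) / Real.sqrt lam ^ (j - 1)) := by
    intro j
    by_cases hj : 1 ≤ j ∧ j ≤ N
    · obtain ⟨c, G, hG, h⟩ := exists_isobaric_wkbTerm d N j hj.1 hj.2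
      have hQ : Isobaric d N j (fun lam x => c * quot d j lam x + G lam x) :=
        .add (.smul _ (.gen j hj.1 hj.2)) (hG.mono (by omega))
      obtain ⟨C, hC, hb⟩ := hQ.exists_norm_le A B
      refine ⟨2 ^ (j - 1) * C, by positivity, fun _ _ lam ρ μ x h1 h2 h3 h4 h5 h6 h7 h8 => ?_⟩
      rw [h lam h1 h2 h3 x]
      refine (norm_div_wkbTerm_zero_pow_le h1 h7 _ _).trans ?_
      rw [mul_assoc]
      gcongr
      exact hb lam x ρ μ h4 h5 h6 h8
    · exact ⟨0, le_rfl, fun h1 h2 => absurd ⟨h1, h2⟩ hj⟩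
  choose K hK0 hK using hterm
  set K' := ∑ j ∈ Finset.range (N + 1), K j with hK'
  have hK'0 : 0 ≤ K' := Finset.sum_nonneg fun j _ => hK0 j
  have hKle : ∀ j ≤ N, K j ≤ K' := fun j hj =>
    Finset.single_le_sum (f := K) (fun i _ => hK0 i) (Finset.mem_range.2 (by omega))
  -- The last term is differentiated explicitly. As G involves derivatives of V of order at most N -
  -- 1, the derivative of order N + 1 appears only in c q_{N+1}; the rest of the numerator is
  -- isobaric of weight N + 1.
  obtain ⟨c, G, hG, hNform⟩ := exists_isobaric_wkbTerm d N N hN le_rfl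
  obtain ⟨G', hG', hGd⟩ := hG.exists_hasDerivAt
  have hk1 : N - 1 + 1 = N := by omega
  rw [hk1] at hG'
  have hE : Isobaric d N (N + 1) (fun lam x => (c * (quot d N lam x * quot d 1 lam x) + G' lam x) +
      ((N - 1 : ℕ) : ℂ) / 2 * ((c * quot d N lam x + G lam x) * quot d 1 lam x)) :=
    .add (.add (.smul _ (.mul (.gen N hN le_rfl) (.gen 1 le_rfl hN))) hG')
      (.smul _ (.mul (.add (.smul _ (.gen N hN le_rfl)) (hG.mono (by omega)))
        (.gen 1 le_rfl hN)))
  obtain ⟨C₁, hC₁, hE⟩ := hE.exists_norm_le A B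
  set C := K' + (2 ^ (N - 1) * C₁ + N * N * (K' * K' * B * B ^ (2 * N))) +
    2 ^ (N - 1) * (2 * ‖c‖) with hCdef
  have hB0 : 0 ≤ B := by linarith
  have hC2 : 0 ≤ 2 ^ (N - 1) * C₁ + N * N * (K' * K' * B * B ^ (2 * N)) := by positivity
  have hC3 : 0 ≤ 2 ^ (N - 1) * (2 * ‖c‖) := by positivity
  refine ⟨C, by positivity, fun lam ρ μ x h1 h2 h3 h4 h5 h6 h6' h7 h8 => ?_⟩
  have hs := Real.sqrt_pos.2 h1
  have hterm : ∀ j, 1 ≤ j → j ≤ N →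
      ‖wkbTerm (d 0) lam j x‖ ≤ K' * (ρ * μ ^ j) / Real.sqrt lam ^ (j - 1) := by
    intro j hj1 hj2
    refine (hK j hj1 hj2 lam ρ μ x h1 h2 h3 h4 h5 h6 h7 h8).trans ?_
    gcongr
    exact hKle j hj2
  refine ⟨fun j hj1 hj2 => (hterm j hj1 hj2).trans ?_, fun hdN => ?_⟩
  · gcongr
    linarith
  have hd' : ∀ i ≤ N, HasDerivAt (d i) (d (i + 1) x) x := by
    intro i hi
    rcases hi.lt_or_eq with h | rfl
    · exact h3 i h x
    · exact hdN
  have hU0 := Complex.slitPlane_ne_zero (h2 x)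
  have hb := wkbTerm_zero_ne_zero h1 (h2 x)
  have hb' := hasDerivAt_wkbTerm_zero (h2 x) (h3 0 (by omega) x)
  have hq := hasDerivAt_quot (i := N) hU0 (h3 0 (by omega) x) hdN
  have hGx := hGd lam x hU0 (fun i hi => hd' i (by omega))
  have hder := ((hq.const_mul c).add hGx).div (hb'.pow (N - 1)) (pow_ne_zero _ hb)
  have hDN : HasDerivAt (wkbTerm (d 0) lam N)
      ((((c * (quot d N lam x * quot d 1 lam x) + G' lam x) +
      ((N - 1 : ℕ) : ℂ) / 2 * ((c * quot d N lam x + G lam x) * quot d 1 lam x))) /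
        wkbTerm (d 0) lam 0 x ^ (N - 1) +
        c * quot d (N + 1) lam x / wkbTerm (d 0) lam 0 x ^ (N - 1)) x := by
    rw [show wkbTerm (d 0) lam N = fun x => (c * quot d N lam x + G lam x) /
      wkbTerm (d 0) lam 0 x ^ (N - 1) from funext fun x => hNform lam h1 h2 h3 x]
    refine hder.congr_deriv ?_
    rcases Nat.exists_eq_add_of_lt hN with ⟨l, hl⟩
    simp only [Pi.add_apply, Pi.pow_apply]
    obtain ⟨l, hl⟩ : ∃ l, N - 1 = l := ⟨_, rfl⟩
    rw [hl]
    rcases l with _ | l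
    · simp
      ring
    · rw [show l + 1 - 1 = l by omega]
      field_simp
      ring
  obtain ⟨D', hD', hR⟩ := riccati_remainder h1 (h2 x)
    (fun j hj => differentiableAt_wkbTerm h1 h2 h3 hj.le fun i hi => h3 i (by omega) x) hDN
  refine ⟨D', hD', ?_⟩
  rw [hR]
  have b1 := (norm_div_wkbTerm_zero_pow_le h1 h7 ((c * (quot d N lam x * quot d 1 lam x) +
      G' lam x) + ((N - 1 : ℕ) : ℂ) / 2 * ((c * quot d N lam x + G lam x) * quot d 1 lam x))
      (N - 1)).trans (div_le_div_of_nonneg_right (mul_le_mul_of_nonneg_left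
        (hE lam x ρ μ h4 h5 h6 h8) (by positivity)) (by positivity))
  have b2 : ‖c * quot d (N + 1) lam x / wkbTerm (d 0) lam 0 x ^ (N - 1)‖ ≤
      2 ^ (N - 1) * (2 * ‖c‖) * ‖d (N + 1) x‖ / Real.sqrt lam ^ (N + 1) := by
    refine (norm_div_wkbTerm_zero_pow_le h1 h7 _ _).trans ?_
    have : ‖c * quot d (N + 1) lam x‖ ≤ 2 * ‖c‖ * ‖d (N + 1) x‖ / Real.sqrt lam ^ 2 := by
      rw [Real.sq_sqrt h1.le, norm_mul, quot, norm_div]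
      calc ‖c‖ * (‖d (N + 1) x‖ / ‖(lam : ℂ) - d 0 x‖)
          ≤ ‖c‖ * (‖d (N + 1) x‖ / (lam / 2)) := by gcongr
        _ = _ := by field_simp
    calc 2 ^ (N - 1) * ‖c * quot d (N + 1) lam x‖ / Real.sqrt lam ^ (N - 1)
        ≤ 2 ^ (N - 1) * (2 * ‖c‖ * ‖d (N + 1) x‖ / Real.sqrt lam ^ 2)
          / Real.sqrt lam ^ (N - 1) := by gcongr
      _ = _ := by
        rw [show N + 1 = (N - 1) + 2 by omega, pow_add]
        field_simp
  have b3 : ‖∑ i ∈ Finset.range N, ∑ k ∈ Finset.range N, (if i + k + 1 < N then (0 : ℂ) else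
      wkbTerm (d 0) lam (i + 1) x * wkbTerm (d 0) lam (k + 1) x)‖ ≤
      N * N * (K' * K' * B * B ^ (2 * N)) * (ρ * μ ^ (N + 1) / Real.sqrt lam ^ (N - 1)) := by
    have hone : ∀ i ∈ Finset.range N, ∀ k ∈ Finset.range N, ‖(if i + k + 1 < N then (0 : ℂ) else
      wkbTerm (d 0) lam (i + 1) x * wkbTerm (d 0) lam (k + 1) x)‖ ≤
        (K' * K' * B * B ^ (2 * N)) * (ρ * μ ^ (N + 1) / Real.sqrt lam ^ (N - 1)) := by
      intro i hi k hk
      have hi := Finset.mem_range.1 hi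
      have hk := Finset.mem_range.1 hk
      split_ifs with hik
      · simp only [norm_zero]; positivity
      -- e is the excess over the lowest surviving order. Each excess step costs a factor μ / √λ ≤
      -- B.
      · obtain ⟨e, he⟩ : ∃ e, i + k = N - 1 + e := ⟨i + k - (N - 1), by omega⟩
        rw [norm_mul]
        refine (mul_le_mul (hterm (i + 1) (by omega) hi) (hterm (k + 1) (by omega) hk)
          (norm_nonneg _) (by positivity)).trans ?_
        have e1 : K' * (ρ * μ ^ (i + 1)) / Real.sqrt lam ^ (i + 1 - 1) *
            (K' * (ρ * μ ^ (k + 1)) / Real.sqrt lam ^ (k + 1 - 1)) =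
            K' * K' * ρ * (μ / Real.sqrt lam) ^ e *
              (ρ * μ ^ (N + 1) / Real.sqrt lam ^ (N - 1)) := by
          have p1 : μ ^ (i + 1) * μ ^ (k + 1) = μ ^ (N + 1) * μ ^ e := by
            rw [← pow_add, ← pow_add]; congr 1; omega
          have p2 : Real.sqrt lam ^ (i + 1 - 1) * Real.sqrt lam ^ (k + 1 - 1) =
              Real.sqrt lam ^ (N - 1) * Real.sqrt lam ^ e := by
            rw [← pow_add, ← pow_add]; congr 1
          rw [div_mul_div_comm, p2, div_pow]
          have : K' * (ρ * μ ^ (i + 1)) * (K' * (ρ * μ ^ (k + 1))) =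
            K' * K' * ρ * ρ * (μ ^ (N + 1) * μ ^ e) := by rw [← p1]; ring
          rw [this]
          field_simp
        rw [e1]
        refine mul_le_mul_of_nonneg_right ?_ (by positivity)
        have e2 : (μ / Real.sqrt lam) ^ e ≤ B ^ (2 * N) := by
          calc (μ / Real.sqrt lam) ^ e ≤ B ^ e := by
                gcongr
                rwa [div_le_iff₀ hs]
            _ ≤ B ^ (2 * N) := pow_le_pow_right₀ hB (by omega)
        gcongr
    calc _ ≤ ∑ i ∈ Finset.range N, ‖∑ k ∈ Finset.range N, (if i + k + 1 < N then (0 : ℂ) else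
          wkbTerm (d 0) lam (i + 1) x * wkbTerm (d 0) lam (k + 1) x)‖ := norm_sum_le _ _
      _ ≤ ∑ i ∈ Finset.range N, ∑ k ∈ Finset.range N,
          (K' * K' * B * B ^ (2 * N)) * (ρ * μ ^ (N + 1) / Real.sqrt lam ^ (N - 1)) :=
        Finset.sum_le_sum fun i hi => (norm_sum_le _ _).trans
          (Finset.sum_le_sum fun k hk => hone i hi k hk)
      _ = _ := by simp; ring
  refine (norm_sub_le _ _).trans ((add_le_add ((norm_add_le _ _).trans (add_le_add b1 b2))
    b3).trans ?_)
  have hX : 0 ≤ ρ * μ ^ (N + 1) / Real.sqrt lam ^ (N - 1) := by positivity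
  have hY : 0 ≤ ‖d (N + 1) x‖ / Real.sqrt lam ^ (N + 1) := by positivity
  set X := ρ * μ ^ (N + 1) / Real.sqrt lam ^ (N - 1)
  set Y := ‖d (N + 1) x‖ / Real.sqrt lam ^ (N + 1)
  have l1 : 2 ^ (N - 1) * (C₁ * (ρ * μ ^ (N + 1))) / Real.sqrt lam ^ (N - 1) =
    2 ^ (N - 1) * C₁ * X := by simp only [X]; ring
  have l2 : 2 ^ (N - 1) * (2 * ‖c‖) * ‖d (N + 1) x‖ / Real.sqrt lam ^ (N + 1) =
    2 ^ (N - 1) * (2 * ‖c‖) * Y := by simp only [Y]; ring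
  have l3 : C * ‖d (N + 1) x‖ / Real.sqrt lam ^ (N + 1) = C * Y := by simp only [Y]; ring
  rw [l1, l2, l3]
  have m1 := mul_nonneg hK'0 hX
  have m2 := mul_nonneg hK'0 hY
  have m3 := mul_nonneg hC2 hY
  have m4 := mul_nonneg hC3 hX
  rw [hCdef]
  nlinarith [m1, m2, m3, m4]

/-! ### The bracket -/

theorem one_le_bracket (x : ℝ) : 1 ≤ bracket x := by
  rw [bracket, Real.one_le_sqrt]
  nlinarith [sq_nonneg x]

theorem bracket_pos (x : ℝ) : 0 < bracket x := one_pos.trans_le (one_le_bracket x)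

theorem continuous_bracket : Continuous bracket := by
  unfold bracket
  fun_prop

theorem le_bracket (x : ℝ) : x ≤ bracket x := by
  rw [bracket]
  exact Real.le_sqrt_of_sq_le (by linarith)

theorem bracket_le_two_mul {x : ℝ} (hx : 1 ≤ x) : bracket x ≤ 2 * x := by
  rw [bracket, Real.sqrt_le_left (by linarith)]
  nlinarith

theorem bracket_mono {x y : ℝ} (hx : 0 ≤ x) (hxy : x ≤ y) : bracket x ≤ bracket y := by
  unfold bracket
  apply Real.sqrt_le_sqrt
  nlinarith

theorem continuous_bracket_rpow (p : ℝ) : Continuous fun x => bracket x ^ p :=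
  continuous_bracket.rpow_const fun x => Or.inl (bracket_pos x).ne'

theorem bracket_rpow_le {x : ℝ} (hx : 1 ≤ x) (p : ℝ) : bracket x ^ p ≤ 2 ^ |p| * x ^ p := by
  have hx0 : 0 < x := by linarith
  rcases le_total 0 p with hp | hp
  · rw [abs_of_nonneg hp, ← Real.mul_rpow (by norm_num) hx0.le]
    exact Real.rpow_le_rpow (bracket_pos x).le (bracket_le_two_mul hx) hp
  · have h1 : bracket x ^ p ≤ x ^ p :=
      Real.rpow_le_rpow_of_nonpos hx0 (le_bracket x) hp
    have h2 : (1 : ℝ) ≤ 2 ^ |p| := Real.one_le_rpow (by norm_num) (abs_nonneg p)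
    have h3 : 0 ≤ x ^ p := (Real.rpow_pos_of_pos hx0 p).le
    nlinarith

theorem rpow_le_bracket_rpow {x : ℝ} (hx : 1 ≤ x) (p : ℝ) : x ^ p ≤ 2 ^ |p| * bracket x ^ p := by
  have hx0 : 0 < x := by linarith
  have h := bracket_rpow_le hx (-p)
  rw [abs_neg, Real.rpow_neg (bracket_pos x).le, Real.rpow_neg hx0.le] at h
  have h1 := Real.rpow_pos_of_pos hx0 p
  have h2 := Real.rpow_pos_of_pos (bracket_pos x) p
  rw [inv_eq_one_div, inv_eq_one_div, div_le_iff₀ h2] at h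
  calc x ^ p = x ^ p * 1 := (mul_one _).symm
    _ ≤ x ^ p * (2 ^ |p| * (1 / x ^ p) * bracket x ^ p) := by gcongr
    _ = _ := by field_simp

/-! ### The two ends -/

theorem Side.abs_sign (s : Side) : |s.sign| = 1 := by cases s <;> simp [Side.sign]

theorem Side.sign_mul_self (s : Side) : s.sign * s.sign = 1 := by cases s <;> simp [Side.sign]

theorem Side.sign_sq (s : Side) : s.sign ^ 2 = 1 := by cases s <;> simp [Side.sign]

theorem bracket_sign_mul (s : Side) (t : ℝ) : bracket (s.sign * t) = bracket t := by
  rw [bracket, bracket, mul_pow, s.sign_sq, one_mul]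

theorem Side.tendsto_sign_mul (s : Side) : Tendsto (fun t => s.sign * t) atTop s.filter := by
  cases s with
  | minus => simpa [Side.sign, Side.filter] using tendsto_neg_atTop_atBot
  | plus => simp only [Side.sign, Side.filter, one_mul]; exact tendsto_id

theorem Side.eventually_filter_iff (s : Side) {p : ℝ → Prop} :
    (∀ᶠ x in s.filter, p x) ↔ ∀ᶠ t in atTop, p (s.sign * t) := by
  refine ⟨fun h => s.tendsto_sign_mul.eventually h, fun h => ?_⟩
  cases s with
  | minus =>
    have := tendsto_neg_atBot_atTop.eventually h
    simpa [Side.sign, Side.filter] using this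
  | plus => simpa [Side.sign, Side.filter] using h

theorem Side.mem_halfLine_iff (s : Side) (x : ℝ) : x ∈ s.halfLine ↔ 0 < s.sign * x := by
  cases s <;> simp [Side.sign, Side.halfLine]

/-- The imaginary part of `v` along the end `s`, with the sign that makes it positive. -/
noncomputable def imAlong (v : ℝ → ℂ) (s : Side) (t : ℝ) : ℝ := s.sign * (v (s.sign * t)).im

theorem abs_imAlong (v : ℝ → ℂ) (s : Side) (t : ℝ) : |imAlong v s t| = |(v (s.sign * t)).im| := by
  rw [imAlong, abs_mul, s.abs_sign, one_mul]

theorem imAlong_sq (v : ℝ → ℂ) (s : Side) (t : ℝ) :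
    imAlong v s t ^ 2 = |(v (s.sign * t)).im| ^ 2 := by
  rw [← abs_imAlong, sq_abs]

theorem continuous_imAlong {v : ℝ → ℂ} (hv : Continuous v) (s : Side) :
    Continuous (imAlong v s) := by
  unfold imAlong
  fun_prop

/-- Quantitative form of the assumptions on the potential `d₀` and its derivatives `d_i` at the
end `s`. -/
structure EndData (N : ℕ) (d : ℕ → ℝ → ℂ) (ν ε₁ : ℝ) (s : Side) (R C c : ℝ) : Prop where
  one_le_R : 1 ≤ R
  C_pos : 0 < C
  c_pos : 0 < c
  cont : Continuous (d 0)
  hasDerivAt : ∀ x, HasDerivAt (d 0) (d 1 x) x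
  eps_pos : 0 < ε₁
  im_ge : ∀ t, R ≤ t → c ≤ imAlong (d 0) s t
  deriv_le : ∀ i, 1 ≤ i → i ≤ N → ∀ t, R ≤ t →
    ‖d i (s.sign * t)‖ ≤ C * (‖d 0 (s.sign * t)‖ * bracket t ^ ((i : ℝ) * ν))
  im_deriv_le : ∀ t, R ≤ t →
    |(d 1 (s.sign * t)).im| ≤ C * (imAlong (d 0) s t * bracket t ^ ν)
  unbdd : ¬ BoundedAt (d 0) s → ∀ t, R ≤ t →
    bracket t ^ (4 * (ν + ε₁) + 2) * (bracket t ^ (4 * ν + 2) + |(d 0 (s.sign * t)).re|)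
      ≤ C * imAlong (d 0) s t ^ 2
  bdd : BoundedAt (d 0) s → ∀ t, R ≤ t → ‖d 0 (s.sign * t)‖ ≤ C

theorem exists_eventually_im_ge {N : ℕ} {V : ℝ → ℂ} {ν : Side → ℝ} {ε₁ : ℝ}
    (hV : BasicAssumption N V ν ε₁) (s : Side) :
    ∃ c : ℝ, 0 < c ∧ ∀ᶠ t in atTop, c ≤ imAlong V s t := by
  cases s with
  | plus =>
    obtain ⟨a, h1, h2⟩ := EReal.lt_iff_exists_real_btwn.1 hV.im_plus
    refine ⟨a, by exact_mod_cast h1, ?_⟩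
    filter_upwards [eventually_lt_of_lt_liminf h2] with x hx
    simp only [imAlong, Side.sign, one_mul]
    exact_mod_cast hx.le
  | minus =>
    obtain ⟨a, h1, h2⟩ := EReal.lt_iff_exists_real_btwn.1 hV.im_minus
    have h2 : a < 0 := by exact_mod_cast h2
    refine ⟨-a, by linarith, ?_⟩
    have h3 := tendsto_neg_atTop_atBot.eventually (eventually_lt_of_limsup_lt h1)
    filter_upwards [h3] with x hx
    simp only [imAlong, Side.sign, neg_mul, one_mul]
    have : (V (-x)).im < a := by exact_mod_cast hx
    linarith

theorem exists_endData {N : ℕ} (hN : 1 ≤ N) {V : ℝ → ℂ} {ν : Side → ℝ} {ε₁ : ℝ}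
    (hV : BasicAssumption N V ν ε₁) {d : ℕ → ℝ → ℂ} (h0 : d 0 = V)
    (hc : ∀ i ≤ N, Continuous (d i)) (hd : ∀ i < N, ∀ x, HasDerivAt (d i) (d (i + 1) x) x)
    (hw : ∀ i ≤ N, IsWeakDeriv i V (d i)) (s : Side) :
    ∃ R C c : ℝ, EndData N d (ν s) ε₁ s R C c := by
  obtain ⟨c, hc0, hcE⟩ := exists_eventually_im_ge hV s
  have h1 : ∀ i, ∃ C : ℝ, 0 ≤ C ∧ (1 ≤ i → i ≤ N → ∀ᶠ t in atTop,
      ‖d i (s.sign * t)‖ ≤ C * (‖d 0 (s.sign * t)‖ * bracket t ^ ((i : ℝ) * ν s))) := by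
    intro i
    by_cases hi : 1 ≤ i ∧ i ≤ N
    · obtain ⟨C, R, hC, hR, h⟩ := exists_forall_norm_le_of_isBigO_ae (hc i hi.2)
        (hV.cont.norm.mul (continuous_bracket_rpow _)) s
        (hV.deriv_bound s i hi.1 hi.2 _ (hw i hi.2))
      refine ⟨C, hC.le, fun _ _ => ?_⟩
      filter_upwards [eventually_ge_atTop R] with t ht
      have := h t ht
      simp only [Pi.mul_apply] at this
      rwa [bracket_sign_mul, abs_of_nonneg (mul_nonneg (norm_nonneg _)
        (Real.rpow_nonneg (bracket_pos t).le _)), ← h0] at this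
    · exact ⟨0, le_rfl, fun h1 h2 => absurd ⟨h1, h2⟩ hi⟩
  choose K hK0 hK using h1
  obtain ⟨C₁, hC₁⟩ : ∃ C₁ : ℝ, ∀ᶠ t in atTop,
      |(d 1 (s.sign * t)).im| ≤ C₁ * (|(V (s.sign * t)).im| * bracket t ^ ν s) := by
    have h2 := hV.im_deriv_bound s 1 le_rfl hN _ (hw 1 hN)
    have h3 : (fun x => (((d 1 x).im : ℝ) : ℂ)) =O[s.filter ⊓ ae volume]
        (fun x => |(V x).im| * bracket x ^ (((1 : ℕ) : ℝ) * ν s)) := by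
      refine IsBigO.of_norm_left ?_
      simpa using h2
    obtain ⟨C, R, hC, hR, h⟩ := exists_forall_norm_le_of_isBigO_ae
      (by have := hc 1 hN; fun_prop) (by
        have := hV.cont
        exact (by fun_prop : Continuous fun x => |(V x).im|).mul (continuous_bracket_rpow _)) s h3
    refine ⟨C, ?_⟩
    filter_upwards [eventually_ge_atTop R] with t ht
    have := h t ht
    rw [bracket_sign_mul, abs_of_nonneg (mul_nonneg (abs_nonneg _)
      (Real.rpow_nonneg (bracket_pos t).le _)), Complex.norm_real, Real.norm_eq_abs] at this
    simpa using this
  obtain ⟨C₂, hC₂⟩ : ∃ C₂ : ℝ, ¬ BoundedAt V s → ∀ᶠ t in atTop,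
      bracket t ^ (4 * (ν s + ε₁) + 2) * (bracket t ^ (4 * ν s + 2) + |(V (s.sign * t)).re|)
      ≤ C₂ * imAlong V s t ^ 2 := by
    by_cases hb : BoundedAt V s
    · exact ⟨0, fun h => absurd hb h⟩
    · obtain ⟨C, hC⟩ := (hV.unbounded s hb).bound
      refine ⟨C, fun _ => ?_⟩
      filter_upwards [s.tendsto_sign_mul.eventually hC] with t ht
      rw [bracket_sign_mul, Real.norm_eq_abs, Real.norm_eq_abs, abs_pow, abs_abs] at ht
      rw [imAlong_sq]
      exact (le_abs_self _).trans ht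
  obtain ⟨C₃, hC₃⟩ : ∃ C₃ : ℝ, BoundedAt V s → ∀ᶠ t in atTop, ‖V (s.sign * t)‖ ≤ C₃ := by
    by_cases hb : BoundedAt V s
    · obtain ⟨C, hC⟩ := hb
      exact ⟨C, fun _ => s.tendsto_sign_mul.eventually hC⟩
    · exact ⟨0, fun h => absurd h hb⟩
  have hEK : ∀ᶠ t in atTop, ∀ i ∈ Finset.Icc 1 N,
      ‖d i (s.sign * t)‖ ≤ K i * (‖d 0 (s.sign * t)‖ * bracket t ^ ((i : ℝ) * ν s)) := by
    rw [Filter.eventually_all_finset]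
    intro i hi
    exact hK i (Finset.mem_Icc.1 hi).1 (Finset.mem_Icc.1 hi).2
  have hE2 : ∀ᶠ t in atTop, ¬ BoundedAt V s →
      bracket t ^ (4 * (ν s + ε₁) + 2) * (bracket t ^ (4 * ν s + 2) + |(V (s.sign * t)).re|)
      ≤ C₂ * imAlong V s t ^ 2 := by
    by_cases hb : BoundedAt V s
    · exact Eventually.of_forall fun t h => absurd hb h
    · filter_upwards [hC₂ hb] with t ht _ using ht
  have hE3 : ∀ᶠ t in atTop, BoundedAt V s → ‖V (s.sign * t)‖ ≤ C₃ := by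
    by_cases hb : BoundedAt V s
    · filter_upwards [hC₃ hb] with t ht _ using ht
    · exact Eventually.of_forall fun t h => absurd h hb
  obtain ⟨R, hR⟩ := eventually_atTop.1 (hcE.and (hEK.and (hC₁.and (hE2.and hE3))))
  set KS := ∑ i ∈ Finset.range (N + 1), K i
  have hKS0 : 0 ≤ KS := Finset.sum_nonneg fun j _ => hK0 j
  have hKS : ∀ i ≤ N, K i ≤ KS := fun j hj =>
    Finset.single_le_sum (f := K) (fun i _ => hK0 i) (Finset.mem_range.2 (by omega))
  set C := 1 + KS + |C₁| + |C₂| + |C₃| with hC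
  have a1 := abs_nonneg C₁
  have a2 := abs_nonneg C₂
  have a3 := abs_nonneg C₃
  have b1 := le_abs_self C₁
  have b2 := le_abs_self C₂
  have b3 := le_abs_self C₃
  refine ⟨max 1 R, C, c, le_max_left _ _, by positivity, hc0, h0 ▸ hV.cont,
    hd 0 (by omega), hV.eps_pos, ?_, ?_, ?_, ?_, ?_⟩
  · intro t ht
    rw [h0]
    exact (hR t ((le_max_right _ _).trans ht)).1
  · intro i h1 h2 t ht
    refine ((hR t ((le_max_right _ _).trans ht)).2.1 i (Finset.mem_Icc.2 ⟨h1, h2⟩)).trans ?_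
    refine mul_le_mul_of_nonneg_right ?_ (mul_nonneg (norm_nonneg _)
      (Real.rpow_nonneg (bracket_pos t).le _))
    linarith [hKS i h2]
  · intro t ht
    have h4 := hR t ((le_max_right _ _).trans ht)
    have h5 : |(V (s.sign * t)).im| = imAlong V s t := by
      rw [← abs_imAlong, abs_of_nonneg (hc0.le.trans h4.1)]
    rw [h0]
    refine (h4.2.2.1).trans ?_
    rw [h5]
    refine mul_le_mul_of_nonneg_right (by linarith) (mul_nonneg (hc0.le.trans h4.1)
      (Real.rpow_nonneg (bracket_pos t).le _))
  · rw [h0]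
    intro hb t ht
    refine ((hR t ((le_max_right _ _).trans ht)).2.2.2.1 hb).trans ?_
    exact mul_le_mul_of_nonneg_right (by linarith) (sq_nonneg _)
  · rw [h0]
    intro hb t ht
    refine ((hR t ((le_max_right _ _).trans ht)).2.2.2.2 hb).trans ?_
    linarith

theorem exists_abs_le_on_Icc {g : ℝ → ℝ} (hg : Continuous g) (T : ℝ) :
    ∃ M : ℝ, 0 < M ∧ ∀ t ∈ Icc 0 T, |g t| ≤ M := by
  obtain ⟨M, hM⟩ := isCompact_Icc.exists_bound_of_continuousOn (s := Icc 0 T) hg.continuousOn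
  exact ⟨|M| + 1, by positivity, fun t ht => (hM t ht).trans (by linarith [le_abs_self M])⟩

/-- Grönwall's inequality in logarithmic form. -/
theorem log_norm_sub_log_norm_le {z z' : ℝ → ℂ} {φ φ' : ℝ → ℝ} {a b : ℝ} (hab : a ≤ b)
    (hz : ∀ t ∈ Icc a b, HasDerivAt z (z' t) t) (hne : ∀ t ∈ Icc a b, z t ≠ 0)
    (hφ : ∀ t ∈ Icc a b, HasDerivAt φ (φ' t) t)
    (hle : ∀ t ∈ Icc a b, ‖z' t‖ ≤ ‖z t‖ * φ' t) :
    Real.log ‖z b‖ - Real.log ‖z a‖ ≤ φ b - φ a := by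
  -- The squared norm is differentiable, so log ‖z‖² - 2φ is shown to be nonincreasing.
  have hd : ∀ t ∈ Icc a b, HasDerivAt (fun t => Real.log (‖z t‖ ^ 2) - 2 * φ t)
      ((2 * inner ℝ (z t) (z' t)) / ‖z t‖ ^ 2 - 2 * φ' t) t := by
    intro t ht
    have h1 := (hz t ht).norm_sq
    exact (h1.log (by simpa using hne t ht)).sub ((hφ t ht).const_mul 2)
  have hanti : AntitoneOn (fun t => Real.log (‖z t‖ ^ 2) - 2 * φ t) (Icc a b) := by
    apply antitoneOn_of_deriv_nonpos (convex_Icc a b)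
    · exact fun t ht => (hd t ht).continuousAt.continuousWithinAt
    · exact fun t ht => ((hd t (interior_subset ht)).differentiableAt).differentiableWithinAt
    · intro t ht
      have ht := interior_subset ht
      rw [(hd t ht).deriv]
      have h1 : 0 < ‖z t‖ := norm_pos_iff.2 (hne t ht)
      have h2 : inner ℝ (z t) (z' t) ≤ ‖z t‖ * ‖z' t‖ := real_inner_le_norm _ _
      have h3 := hle t ht
      rw [sub_nonpos, div_le_iff₀ (by positivity)]
      nlinarith [mul_le_mul_of_nonneg_left h3 h1.le]
  have := hanti (left_mem_Icc.2 hab) (right_mem_Icc.2 hab) hab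
  simp only [Real.log_pow, Nat.cast_ofNat] at this
  linarith

/-! ### Consequences of the assumptions at one end; the cut-off radius -/

section

variable {N : ℕ} {d : ℕ → ℝ → ℂ} {ν : Side → ℝ} {ε₁ ε₂ : ℝ} {s : Side} {R C c : ℝ}

theorem hasDerivAt_comp_sign_mul {v v' : ℝ → ℂ} (hv : ∀ x, HasDerivAt v (v' x) x) (s : Side)
    (t : ℝ) : HasDerivAt (fun t => v (s.sign * t)) (s.sign * v' (s.sign * t)) t := by
  have h1 : HasDerivAt (fun t : ℝ => s.sign * t) s.sign t := by
    simpa using (hasDerivAt_id t).const_mul s.sign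
  have := HasDerivAt.scomp t (hv (s.sign * t)) h1
  simpa [Function.comp_def] using this

namespace EndData

theorem im_pos (E : EndData N d (ν s) ε₁ s R C c) {t : ℝ} (ht : R ≤ t) :
    0 < imAlong (d 0) s t := E.c_pos.trans_le (E.im_ge t ht)

theorem abs_im (E : EndData N d (ν s) ε₁ s R C c) {t : ℝ} (ht : R ≤ t) :
    |imAlong (d 0) s t| = imAlong (d 0) s t := abs_of_pos (E.im_pos ht)

theorem cont_im (E : EndData N d (ν s) ε₁ s R C c) : Continuous (imAlong (d 0) s) :=
  continuous_imAlong E.cont s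

theorem hasDerivAt_im (E : EndData N d (ν s) ε₁ s R C c) (t : ℝ) :
    HasDerivAt (imAlong (d 0) s) (d 1 (s.sign * t)).im t := by
  have h := ((Complex.imCLM.hasFDerivAt.comp_hasDerivAt t
    (hasDerivAt_comp_sign_mul E.hasDerivAt s t))).const_mul s.sign
  refine h.congr_deriv ?_
  simp only [Complex.imCLM_apply, Complex.im_ofReal_mul]
  rw [← mul_assoc, s.sign_mul_self, one_mul]

theorem ne_zero (E : EndData N d (ν s) ε₁ s R C c) {t : ℝ} (ht : R ≤ t) :
    d 0 (s.sign * t) ≠ 0 := by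
  intro h
  have := E.im_pos ht
  rw [imAlong, h] at this
  simp at this

theorem log_im_sub_le (E : EndData N d (ν s) ε₁ s R C c) {φ φ' : ℝ → ℝ} {a b : ℝ}
    (ha : R ≤ a) (hab : a ≤ b) (hφ : ∀ t ∈ Icc a b, HasDerivAt φ (φ' t) t)
    (hle : ∀ t ∈ Icc a b, C * bracket t ^ ν s ≤ φ' t) :
    Real.log (imAlong (d 0) s b) - Real.log (imAlong (d 0) s a) ≤ φ b - φ a := by
  have h := log_norm_sub_log_norm_le (z := fun t => ((imAlong (d 0) s t : ℝ) : ℂ))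
    (z' := fun t => (((d 1 (s.sign * t)).im : ℝ) : ℂ)) hab
    (fun t _ => (E.hasDerivAt_im t).ofReal_comp)
    (fun t ht => by exact_mod_cast (E.im_pos (ha.trans ht.1)).ne') hφ
    (fun t ht => by
      have h1 := E.im_deriv_le t (ha.trans ht.1)
      have h2 := E.im_pos (ha.trans ht.1)
      rw [Complex.norm_real, Complex.norm_real, Real.norm_eq_abs, Real.norm_eq_abs,
        E.abs_im (ha.trans ht.1)]
      refine h1.trans ?_
      rw [mul_left_comm]
      exact mul_le_mul_of_nonneg_left (hle t ht) h2.le)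
  simpa using h

/-- For ν < -1 the weight in |V'| ≤ C |V| ⟨x⟩^ν is integrable at infinity, so Grönwall's inequality
keeps log |V| bounded. This bound on ν is used repeatedly at unbounded ends. -/
theorem neg_one_le_of_not_bounded (E : EndData N d (ν s) ε₁ s R C c) (hN : 1 ≤ N)
    (hb : ¬ BoundedAt (d 0) s) : -1 ≤ ν s := by
  by_contra hν
  rw [not_le] at hν
  apply hb
  have hp : ν s + 1 < 0 := by linarith
  set K := C * 2 ^ |ν s| / (-(ν s + 1)) with hK
  have hK0 : 0 ≤ K := div_nonneg (mul_nonneg E.C_pos.le (by positivity)) (by linarith)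
  have key : ∀ t, R ≤ t → Real.log ‖d 0 (s.sign * t)‖ ≤
      Real.log ‖d 0 (s.sign * R)‖ + K * R ^ (ν s + 1) := by
    intro t ht
    have h := log_norm_sub_log_norm_le (z := fun t => d 0 (s.sign * t))
      (z' := fun t => s.sign * d 1 (s.sign * t)) (φ := fun t => -K * t ^ (ν s + 1))
      (φ' := fun t => C * 2 ^ |ν s| * t ^ ν s) ht
      (fun t _ => hasDerivAt_comp_sign_mul E.hasDerivAt s t)
      (fun t ht => E.ne_zero ht.1) (fun u hu => by
        have h0 : u ≠ 0 := by linarith [E.one_le_R, hu.1]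
        have := (Real.hasDerivAt_rpow_const (x := u) (p := ν s + 1) (Or.inl h0)).const_mul (-K)
        refine this.congr_deriv ?_
        rw [hK, add_sub_cancel_right]
        have : ν s + 1 ≠ 0 := hp.ne
        field_simp)
      (fun u hu => by
        have h1 := E.deriv_le 1 le_rfl hN u hu.1
        rw [norm_mul, Complex.norm_real, Real.norm_eq_abs, s.abs_sign, one_mul]
        refine h1.trans ?_
        rw [mul_left_comm, Nat.cast_one, one_mul, mul_assoc C]
        have := bracket_rpow_le (E.one_le_R.trans hu.1) (ν s)
        have := E.C_pos.le
        gcongr)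
    have h3 : 0 ≤ K * t ^ (ν s + 1) :=
      mul_nonneg hK0 (Real.rpow_nonneg (by linarith [E.one_le_R]) _)
    linarith
  refine ⟨Real.exp (Real.log ‖d 0 (s.sign * R)‖ + K * R ^ (ν s + 1)), ?_⟩
  rw [s.eventually_filter_iff]
  filter_upwards [eventually_ge_atTop R] with t ht
  have := Real.exp_le_exp.2 (key t ht)
  rwa [Real.exp_log (norm_pos_iff.2 (E.ne_zero ht))] at this

/-- The quantity whose level sets define the cut-off radius at an end where `V` is unbounded. -/
theorem bracket_rpow_le_im (E : EndData N d (ν s) ε₁ s R C c) (hb : ¬ BoundedAt (d 0) s)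
    {t : ℝ} (ht : R ≤ t) :
    bracket t ^ (4 * ν s + 2 * ε₁ + 2) ≤ (C + 1) * imAlong (d 0) s t := by
  have h1 := E.unbdd hb t ht
  have h2 := E.im_pos ht
  have hX := bracket_pos t
  have h3 : (bracket t ^ (4 * ν s + 2 * ε₁ + 2)) ^ 2 ≤ C * imAlong (d 0) s t ^ 2 := by
    refine le_trans ?_ h1
    rw [mul_add, ← Real.rpow_add hX, sq, ← Real.rpow_add hX]
    have h4 : 0 ≤ bracket t ^ (4 * (ν s + ε₁) + 2) * |(d 0 (s.sign * t)).re| := by positivity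
    have h5 : 4 * ν s + 2 * ε₁ + 2 + (4 * ν s + 2 * ε₁ + 2) =
      4 * (ν s + ε₁) + 2 + (4 * ν s + 2) := by ring
    rw [h5]
    linarith
  refine abs_le_of_sq_le_sq' ?_ (mul_nonneg (by linarith [E.C_pos]) h2.le) |>.2
  refine h3.trans ?_
  rw [mul_pow]
  have := E.C_pos
  gcongr
  nlinarith

theorem abs_re_le (E : EndData N d (ν s) ε₁ s R C c) (hb : ¬ BoundedAt (d 0) s)
    {t : ℝ} (ht : R ≤ t) : |(d 0 (s.sign * t)).re| ≤
      C * imAlong (d 0) s t ^ 2 * bracket t ^ (-(4 * (ν s + ε₁) + 2)) := by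
  have h1 := E.unbdd hb t ht
  have hX := bracket_pos t
  have h2 : bracket t ^ (4 * (ν s + ε₁) + 2) * |(d 0 (s.sign * t)).re| ≤
      C * imAlong (d 0) s t ^ 2 := by
    refine le_trans ?_ h1
    have : 0 ≤ bracket t ^ (4 * ν s + 2) := by positivity
    gcongr
    linarith
  rw [Real.rpow_neg hX.le, ← div_eq_mul_inv, le_div_iff₀ (by positivity), mul_comm]
  exact h2

/-- The level function in the definition of the cut-off radius. -/
noncomputable def level (d : ℕ → ℝ → ℂ) (ν : Side → ℝ) (ε₁ : ℝ) (s : Side) (t : ℝ) : ℝ :=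
  |(d 0 (s.sign * t)).im| ^ 2 / bracket t ^ (4 * ν s + 2 * ε₁ + 2)

theorem continuous_level (E : EndData N d (ν s) ε₁ s R C c) : Continuous (level d ν ε₁ s) := by
  have := E.cont
  unfold level
  refine Continuous.div (by fun_prop) (continuous_bracket_rpow _) fun x =>
    (Real.rpow_pos_of_pos (bracket_pos x) _).ne'

/-- Let p be the exponent of the bracket. If p < 0, Im V stays away from zero while the weight
grows. If p > 0, then ⟨t⟩^p ≤ (C + 1) |Im V| makes the level at least ⟨t⟩^p / (C + 1)². If p = 0, a
bounded level would bound Im V, and then Re V by assumption (c), contradicting that V is unbounded.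
-/
theorem exists_lt_level (E : EndData N d (ν s) ε₁ s R C c) (hb : ¬ BoundedAt (d 0) s) (M : ℝ) :
    ∃ t, 0 ≤ t ∧ M < level d ν ε₁ s t := by
  set p := 4 * ν s + 2 * ε₁ + 2 with hp
  have hR := E.one_le_R
  have hl : ∀ t, level d ν ε₁ s t = imAlong (d 0) s t ^ 2 / bracket t ^ p := fun t => by
    rw [level, imAlong_sq]
  have hten : ∀ q : ℝ, 0 < q → ∀ K : ℝ, ∃ t, R ≤ t ∧ K < bracket t ^ q := by
    intro q hq K
    obtain ⟨t, h1, h2⟩ := ((eventually_ge_atTop R).and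
      ((tendsto_rpow_atTop hq).eventually (eventually_gt_atTop K))).exists
    exact ⟨t, h1, h2.trans_le (Real.rpow_le_rpow (by linarith) (le_bracket t) hq.le)⟩
  have hC1 : 0 < C + 1 := by linarith [E.C_pos]
  rcases lt_trichotomy p 0 with h | h | h
  · obtain ⟨t, h1, h2⟩ := hten (-p) (by linarith) (|M| / c ^ 2)
    refine ⟨t, by linarith, ?_⟩
    rw [hl, div_eq_mul_inv, ← Real.rpow_neg (bracket_pos t).le]
    have h3 := E.im_ge t h1
    rw [div_lt_iff₀ (pow_pos E.c_pos 2)] at h2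
    calc M ≤ |M| := le_abs_self M
      _ < bracket t ^ (-p) * c ^ 2 := h2
      _ ≤ bracket t ^ (-p) * imAlong (d 0) s t ^ 2 := by
        have := E.c_pos
        have := (Real.rpow_pos_of_pos (bracket_pos t) (-p)).le
        gcongr
      _ = _ := mul_comm _ _
  · by_contra hcon
    push Not at hcon
    apply hb
    have hy : ∀ t, R ≤ t → imAlong (d 0) s t ^ 2 ≤ |M| := by
      intro t ht
      have := hcon t (by linarith)
      rw [hl, h, Real.rpow_zero, div_one] at this
      exact this.trans (le_abs_self M)
    refine ⟨C * |M| + (|M| + 1), ?_⟩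
    rw [s.eventually_filter_iff]
    filter_upwards [eventually_ge_atTop R] with t ht
    have h1 := E.abs_re_le hb ht
    have h2 := hy t ht
    have h3 : bracket t ^ (-(4 * (ν s + ε₁) + 2)) ≤ 1 :=
      Real.rpow_le_one_of_one_le_of_nonpos (one_le_bracket t) (by linarith [E.eps_pos])
    have h4 : |(d 0 (s.sign * t)).re| ≤ C * |M| := by
      refine h1.trans ?_
      have h0 := E.C_pos.le
      have := (Real.rpow_pos_of_pos (bracket_pos t) (-(4 * (ν s + ε₁) + 2))).le
      calc C * imAlong (d 0) s t ^ 2 * bracket t ^ (-(4 * (ν s + ε₁) + 2))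
          ≤ C * |M| * 1 := by gcongr
        _ = _ := mul_one _
    have h5 : |(d 0 (s.sign * t)).im| ≤ |M| + 1 := by
      rw [← abs_imAlong]
      have := abs_nonneg M
      nlinarith [sq_abs (imAlong (d 0) s t)]
    exact (Complex.norm_le_abs_re_add_abs_im _).trans (add_le_add h4 h5)
  · obtain ⟨t, h1, h2⟩ := hten p h (|M| * (C + 1) ^ 2)
    refine ⟨t, by linarith, ?_⟩
    have h3 := E.bracket_rpow_le_im hb h1
    rw [← hp] at h3
    rw [hl]
    have hX := Real.rpow_pos_of_pos (bracket_pos t) p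
    rw [lt_div_iff₀ hX]
    have h4 := le_abs_self M
    have h6 : (bracket t ^ p) ^ 2 ≤ (C + 1) ^ 2 * imAlong (d 0) s t ^ 2 := by
      rw [← mul_pow]; gcongr
    have h7 : |M| * (C + 1) ^ 2 * bracket t ^ p < (bracket t ^ p) ^ 2 := by
      rw [sq (bracket t ^ p)]; exact mul_lt_mul_of_pos_right h2 hX
    have h8 : (C + 1) ^ 2 * (|M| * bracket t ^ p) < (C + 1) ^ 2 * imAlong (d 0) s t ^ 2 := by
      linarith
    have h9 := lt_of_mul_lt_mul_left h8 (by positivity)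
    have := mul_le_mul_of_nonneg_right h4 hX.le
    linarith

theorem delta_eq (hb : ¬ BoundedAt (d 0) s) (lam : ℝ) : delta (d 0) ν ε₁ ε₂ s lam =
    sInf {t : ℝ | 0 ≤ t ∧ level d ν ε₁ s t = lam} := by
  rw [delta, if_neg hb]
  rfl

/-- The level set is closed and nonempty, so its infimum is attained. A value above λ before δ
would, by the intermediate value theorem, force an earlier crossing. -/
theorem delta_spec (E : EndData N d (ν s) ε₁ s R C c) (hb : ¬ BoundedAt (d 0) s) {lam : ℝ}
    (hlam : level d ν ε₁ s 0 ≤ lam) :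
    0 ≤ delta (d 0) ν ε₁ ε₂ s lam ∧ level d ν ε₁ s (delta (d 0) ν ε₁ ε₂ s lam) = lam ∧
      ∀ t ∈ Icc 0 (delta (d 0) ν ε₁ ε₂ s lam), level d ν ε₁ s t ≤ lam := by
  have hcont := E.continuous_level
  set S := {t : ℝ | 0 ≤ t ∧ level d ν ε₁ s t = lam} with hS
  have hivt : ∀ t, 0 ≤ t → lam ≤ level d ν ε₁ s t → ∃ u ∈ Icc 0 t, level d ν ε₁ s u = lam := by
    intro t ht h
    exact intermediate_value_Icc ht hcont.continuousOn ⟨hlam, h⟩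
  have hne : S.Nonempty := by
    obtain ⟨t, ht, h⟩ := E.exists_lt_level hb lam
    obtain ⟨u, hu, hul⟩ := hivt t ht h.le
    exact ⟨u, hu.1, hul⟩
  have hcl : IsClosed S := (isClosed_Ici (a := (0 : ℝ))).inter
    (isClosed_eq hcont continuous_const)
  have hbd : BddBelow S := ⟨0, fun t ht => ht.1⟩
  have hmem := hcl.csInf_mem hne hbd
  rw [delta_eq hb]
  refine ⟨hmem.1, hmem.2, fun t ht => ?_⟩
  by_contra hlt
  rw [not_le] at hlt
  obtain ⟨u, hu, hul⟩ := hivt t ht.1 hlt.le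
  have h1 : sInf S ≤ u := csInf_le hbd ⟨hu.1, hul⟩
  have h2 : u = t := le_antisymm hu.2 (ht.2.trans h1)
  rw [h2] at hul
  linarith

theorem tendsto_delta (E : EndData N d (ν s) ε₁ s R C c) (hε₂ : 0 < ε₂) :
    Tendsto (delta (d 0) ν ε₁ ε₂ s) atTop atTop := by
  by_cases hb : BoundedAt (d 0) s
  · have : delta (d 0) ν ε₁ ε₂ s = fun lam => lam ^ ((1 + ε₂) / 2) := by
      funext lam; rw [delta, if_pos hb]
    rw [this]
    exact tendsto_rpow_atTop (by linarith)
  · rw [tendsto_atTop]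
    intro T
    obtain ⟨M, _, hM⟩ := exists_abs_le_on_Icc E.continuous_level T
    filter_upwards [eventually_gt_atTop M, eventually_ge_atTop (level d ν ε₁ s 0)] with lam h1 h2
    obtain ⟨h3, h4, _⟩ := E.delta_spec (ε₂ := ε₂) hb h2
    by_contra hlt
    have := (le_abs_self _).trans (hM _ ⟨h3, (not_le.1 hlt).le⟩)
    linarith

/-- On the interval up to the cut-off radius the imaginary part is controlled by `λ`. -/
theorem eventually_im_sq_le (E : EndData N d (ν s) ε₁ s R C c) (hb : ¬ BoundedAt (d 0) s) :
    ∀ᶠ lam in atTop, ∀ t ∈ Icc 0 (delta (d 0) ν ε₁ ε₂ s lam),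
      imAlong (d 0) s t ^ 2 ≤ lam * bracket t ^ (4 * ν s + 2 * ε₁ + 2) := by
  filter_upwards [eventually_ge_atTop (level d ν ε₁ s 0)] with lam h1 t ht
  have := (E.delta_spec (ε₂ := ε₂) hb h1).2.2 t ht
  rwa [level, ← imAlong_sq, div_le_iff₀ (Real.rpow_pos_of_pos (bracket_pos t) _)] at this

theorem eventually_im_sq_eq (E : EndData N d (ν s) ε₁ s R C c) (hb : ¬ BoundedAt (d 0) s) :
    ∀ᶠ lam in atTop, imAlong (d 0) s (delta (d 0) ν ε₁ ε₂ s lam) ^ 2 =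
      lam * bracket (delta (d 0) ν ε₁ ε₂ s lam) ^ (4 * ν s + 2 * ε₁ + 2) := by
  filter_upwards [eventually_ge_atTop (level d ν ε₁ s 0)] with lam h1
  have := (E.delta_spec (ε₂ := ε₂) hb h1).2.1
  rwa [level, ← imAlong_sq, div_eq_iff (Real.rpow_pos_of_pos (bracket_pos _) _).ne'] at this

/-- Write y for |Im V| and p for the exponent in the level. Then y² ≤ λ ⟨t⟩^p and ⟨t⟩^p ≤ (C + 1) y;
one factor y cancels. -/
theorem eventually_im_le (E : EndData N d (ν s) ε₁ s R C c) (hb : ¬ BoundedAt (d 0) s) :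
    ∀ᶠ lam in atTop, ∀ t ∈ Icc R (delta (d 0) ν ε₁ ε₂ s lam),
      imAlong (d 0) s t ≤ (C + 1) * lam := by
  filter_upwards [E.eventually_im_sq_le (ε₂ := ε₂) hb, eventually_gt_atTop 0] with lam h1 h0 t ht
  have h2 := h1 t ⟨by linarith [E.one_le_R, ht.1], ht.2⟩
  have h3 := E.bracket_rpow_le_im hb ht.1
  have h4 := E.im_pos ht.1
  have h5 : imAlong (d 0) s t * imAlong (d 0) s t ≤
      imAlong (d 0) s t * ((C + 1) * lam) := by nlinarith
  exact le_of_mul_le_mul_left h5 h4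

end EndData

end

open Classical in
/-- The exponent in the rate of the contribution of the cut-off. -/
noncomputable def cutoffExponent (V : ℝ → ℂ) (ν : Side → ℝ) (ε₁ ε₂ : ℝ) (s : Side)
    (lam : ℝ) : ℝ :=
  if BoundedAt V s then lam ^ (ε₂ / 2) else delta V ν ε₁ ε₂ s lam ^ (ν s + 1 + ε₁)

theorem kappaRate_eq (V : ℝ → ℂ) (ν : Side → ℝ) (ε₁ ε₂ c : ℝ) (s : Side) (lam : ℝ) :
    kappaRate V ν ε₁ ε₂ c s lam = Real.exp (-c * cutoffExponent V ν ε₁ ε₂ s lam) := by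
  unfold kappaRate cutoffExponent
  split_ifs <;> rfl

theorem eventually_const_mul_rpow_le {e f : ℝ} (hef : e < f) (K : ℝ) {η : ℝ} (hη : 0 < η) :
    ∀ᶠ x : ℝ in atTop, K * x ^ e ≤ η * x ^ f := by
  have h2 := (tendsto_rpow_neg_atTop (sub_pos.2 hef)).eventually
    (eventually_le_nhds (show 0 < η / (|K| + 1) by positivity))
  filter_upwards [h2, eventually_gt_atTop 0] with x hx h0
  have hx : x ^ e ≤ η / (|K| + 1) * x ^ f := by
    calc x ^ e = x ^ (-(f - e)) * x ^ f := by rw [← Real.rpow_add h0]; congr 1; ring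
      _ ≤ _ := by gcongr
  calc K * x ^ e ≤ (|K| + 1) * x ^ e := by
        gcongr
        linarith [le_abs_self K]
    _ ≤ (|K| + 1) * (η / (|K| + 1) * x ^ f) := by gcongr
    _ = η * x ^ f := by field_simp

theorem eventually_const_mul_log_le {f : ℝ} (hf : 0 < f) (K : ℝ) {η : ℝ} (hη : 0 < η) :
    ∀ᶠ x : ℝ in atTop, K * Real.log x ≤ η * x ^ f := by
  have h2 := (isLittleO_log_rpow_atTop hf).def (c := η / (|K| + 1)) (by positivity)
  filter_upwards [h2, eventually_ge_atTop 1] with x hx h0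
  have hl := Real.log_nonneg h0
  rw [Real.norm_of_nonneg hl, Real.norm_of_nonneg (by positivity)] at hx
  calc K * Real.log x ≤ (|K| + 1) * Real.log x := by
        gcongr
        linarith [le_abs_self K]
    _ ≤ (|K| + 1) * (η / (|K| + 1) * x ^ f) := by gcongr
    _ = η * x ^ f := by field_simp

theorem exists_bracket_rpow_neg_le {q η : ℝ} (hq : 0 < q) (hη : 0 < η) (R : ℝ) :
    ∃ T, R ≤ T ∧ ∀ t, T ≤ t → bracket t ^ (-q) ≤ η := by
  have h := (tendsto_rpow_neg_atTop hq).eventually (eventually_le_nhds hη)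
  obtain ⟨T, hT⟩ := eventually_atTop.1 (h.and (eventually_gt_atTop 0))
  refine ⟨max R T, le_max_left _ _, fun t ht => ?_⟩
  have h1 := hT t ((le_max_right _ _).trans ht)
  exact (Real.rpow_le_rpow_of_nonpos h1.2 (le_bracket t) (by linarith)).trans h1.1

theorem rpow_le_two_rpow_mul {t x : ℝ} (hx : 0 < x) (h1 : x / 2 ≤ t) (h2 : t ≤ x) (p : ℝ) :
    t ^ p ≤ 2 ^ |p| * x ^ p := by
  rcases le_total 0 p with hp | hp
  · have h3 : t ^ p ≤ x ^ p := Real.rpow_le_rpow (by linarith) h2 hp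
    have h4 : (1 : ℝ) ≤ 2 ^ |p| := Real.one_le_rpow (by norm_num) (abs_nonneg p)
    have h5 : 0 ≤ x ^ p := (Real.rpow_pos_of_pos hx p).le
    nlinarith
  · have h3 : t ^ p ≤ (x / 2) ^ p := Real.rpow_le_rpow_of_nonpos (by linarith) h1 hp
    refine h3.trans (le_of_eq ?_)
    rw [div_eq_inv_mul, Real.mul_rpow (by norm_num) hx.le, abs_of_nonpos hp,
      Real.inv_rpow (by norm_num), ← Real.rpow_neg (by norm_num)]

/-! ### Size of the potential and of the weights up to the cut-off radius -/

namespace EndData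

variable {N : ℕ} {d : ℕ → ℝ → ℂ} {ν : Side → ℝ} {ε₁ ε₂ : ℝ} {s : Side} {R C c : ℝ}

theorem exists_norm_le_of_bounded (E : EndData N d (ν s) ε₁ s R C c) (hb : BoundedAt (d 0) s) :
    ∃ M, 0 < M ∧ ∀ t, 0 ≤ t → ‖d 0 (s.sign * t)‖ ≤ M := by
  have := E.cont
  obtain ⟨M, hM0, hM⟩ := exists_abs_le_on_Icc (g := fun t => ‖d 0 (s.sign * t)‖) (by fun_prop) R
  refine ⟨M + C, by linarith [E.C_pos], fun t ht => ?_⟩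
  rcases le_total t R with h | h
  · have := hM t ⟨ht, h⟩
    rw [abs_norm] at this
    linarith [E.C_pos]
  · linarith [E.bdd hb t h]

/-- At an unbounded end, assumption (c) and the level bound give |Re V| ≤ C λ ⟨t⟩^{-2ε₁}, which is
small compared with λ beyond a fixed point. Consequently Re(λ - V) ≥ λ/2 on the whole interval. -/
theorem eventually_abs_re_le (E : EndData N d (ν s) ε₁ s R C c) :
    ∀ᶠ lam in atTop, ∀ t ∈ Icc 0 (delta (d 0) ν ε₁ ε₂ s lam),
      |(d 0 (s.sign * t)).re| ≤ lam / 2 := by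
  by_cases hb : BoundedAt (d 0) s
  · obtain ⟨M, _, hM⟩ := E.exists_norm_le_of_bounded hb
    filter_upwards [eventually_ge_atTop (2 * M)] with lam h t ht
    linarith [hM t ht.1, Complex.abs_re_le_norm (d 0 (s.sign * t))]
  · have h0 := E.C_pos
    obtain ⟨T, hRT, hT⟩ := exists_bracket_rpow_neg_le (q := 2 * ε₁) (η := 1 / (2 * C))
      (by linarith [E.eps_pos]) (by positivity) R
    have := E.cont
    obtain ⟨M, hM0, hM⟩ := exists_abs_le_on_Icc (g := fun t => (d 0 (s.sign * t)).re)
      (by fun_prop) T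
    filter_upwards [eventually_ge_atTop (2 * M), E.eventually_im_sq_le (ε₂ := ε₂) hb]
      with lam h1 h2 t ht
    rcases le_total t T with h | h
    · linarith [hM t ⟨ht.1, h⟩]
    · have h3 := E.abs_re_le hb (hRT.trans h)
      have hX := bracket_pos t
      have hlam : 0 < lam := by linarith
      calc |(d 0 (s.sign * t)).re| ≤
          C * imAlong (d 0) s t ^ 2 * bracket t ^ (-(4 * (ν s + ε₁) + 2)) := h3
        _ ≤ C * (lam * bracket t ^ (4 * ν s + 2 * ε₁ + 2)) *
            bracket t ^ (-(4 * (ν s + ε₁) + 2)) := by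
          gcongr
          exact h2 t ht
        _ = C * lam * bracket t ^ (-(2 * ε₁)) := by
          rw [mul_assoc, mul_assoc lam, ← Real.rpow_add hX, ← mul_assoc]
          congr 2
          ring
        _ ≤ C * lam * (1 / (2 * C)) := by
          gcongr
          exact hT t h
        _ = lam / 2 := by field_simp

theorem exists_eventually_norm_le (E : EndData N d (ν s) ε₁ s R C c) :
    ∃ B, 0 < B ∧ ∀ᶠ lam in atTop, ∀ t ∈ Icc 0 (delta (d 0) ν ε₁ ε₂ s lam),
      ‖d 0 (s.sign * t)‖ ≤ B * lam := by
  have h0 := E.C_pos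
  by_cases hb : BoundedAt (d 0) s
  · obtain ⟨M, hM0, hM⟩ := E.exists_norm_le_of_bounded hb
    refine ⟨M, hM0, ?_⟩
    filter_upwards [eventually_ge_atTop 1] with lam h t ht
    nlinarith [hM t ht.1]
  · have := E.cont
    obtain ⟨M, hM0, hM⟩ := exists_abs_le_on_Icc (g := fun t => ‖d 0 (s.sign * t)‖)
      (by fun_prop) R
    refine ⟨C + 2, by linarith, ?_⟩
    filter_upwards [eventually_ge_atTop M, E.eventually_abs_re_le (ε₂ := ε₂),
      E.eventually_im_le (ε₂ := ε₂) hb] with lam h1 h2 h3 t ht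
    rcases le_total t R with h | h
    · have := hM t ⟨ht.1, h⟩
      rw [abs_norm] at this
      nlinarith
    · have h4 := h3 t ⟨h, ht.2⟩
      rw [← E.abs_im h, abs_imAlong] at h4
      have := h2 t ht
      have := Complex.norm_le_abs_re_add_abs_im (d 0 (s.sign * t))
      linarith

/-- At a bounded end with ν > 0, ⟨t⟩^{2ν} is at most a multiple of λ^{(1+ε₂)ν}, and ε₂ < 1 - ν makes
this exponent less than 1. At an unbounded end ν ≥ -1 gives ⟨t⟩^{2ν+2ε₁} ≤ ⟨t⟩^{4ν+2ε₁+2} = O(Im V)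
= O(λ), and the surplus ⟨t⟩^{-2ε₁} supplies the small factor. -/
theorem eventually_bracket_rpow_le (E : EndData N d (ν s) ε₁ s R C c) (hN : 1 ≤ N)
    (hε₂ : 0 < ε₂) (hbν : BoundedAt (d 0) s → ε₂ < 1 - ν s) {η : ℝ} (hη : 0 < η) :
    ∀ᶠ lam in atTop, ∀ t ∈ Icc 0 (delta (d 0) ν ε₁ ε₂ s lam),
      bracket t ^ (2 * ν s) ≤ η * lam := by
  by_cases hb : BoundedAt (d 0) s
  · set n := max (ν s) 0 with hn
    have he : (1 + ε₂) * n < 1 := by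
      have := hbν hb
      rcases max_cases (ν s) 0 with h | h
      · rw [hn, h.1]; nlinarith
      · rw [hn, h.1]; norm_num
    have h1 := eventually_const_mul_rpow_le he (2 ^ (2 * n)) hη
    filter_upwards [h1, eventually_ge_atTop 1, (E.tendsto_delta hε₂).eventually_ge_atTop 1]
      with lam h2 h3 h4 t ht
    rw [Real.rpow_one] at h2
    refine le_trans ?_ h2
    have hd : delta (d 0) ν ε₁ ε₂ s lam = lam ^ ((1 + ε₂) / 2) := by rw [delta, if_pos hb]
    have hn0 : 0 ≤ n := le_max_right _ _
    calc bracket t ^ (2 * ν s) ≤ bracket t ^ (2 * n) :=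
          Real.rpow_le_rpow_of_exponent_le (one_le_bracket t) (by linarith [le_max_left (ν s) 0])
      _ ≤ (2 * delta (d 0) ν ε₁ ε₂ s lam) ^ (2 * n) :=
          Real.rpow_le_rpow (bracket_pos t).le
            ((bracket_mono ht.1 ht.2).trans (bracket_le_two_mul h4)) (by linarith)
      _ = 2 ^ (2 * n) * lam ^ ((1 + ε₂) * n) := by
          rw [Real.mul_rpow (by norm_num) (by linarith), hd, ← Real.rpow_mul (by linarith)]
          congr 2
          ring
  · have h0 := E.C_pos
    have hν := E.neg_one_le_of_not_bounded hN hb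
    obtain ⟨T, hRT, hT⟩ := exists_bracket_rpow_neg_le (q := 2 * ε₁) (η := η / ((C + 1) * (C + 1)))
      (by linarith [E.eps_pos]) (by positivity) R
    obtain ⟨M, hM0, hM⟩ := exists_abs_le_on_Icc (continuous_bracket_rpow (2 * ν s)) T
    filter_upwards [eventually_ge_atTop (M / η), E.eventually_im_le (ε₂ := ε₂) hb,
      eventually_gt_atTop 0] with lam h1 h2 hlam t ht
    rcases le_total t T with h | h
    · rw [div_le_iff₀ hη] at h1
      have := (le_abs_self _).trans (hM t ⟨ht.1, h⟩)
      linarith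
    · have hX := one_le_bracket t
      have hX0 := bracket_pos t
      have h3 : bracket t ^ (2 * ν s + 2 * ε₁) ≤ (C + 1) * ((C + 1) * lam) :=
        calc bracket t ^ (2 * ν s + 2 * ε₁) ≤ bracket t ^ (4 * ν s + 2 * ε₁ + 2) :=
              Real.rpow_le_rpow_of_exponent_le hX (by linarith)
          _ ≤ (C + 1) * imAlong (d 0) s t := E.bracket_rpow_le_im hb (hRT.trans h)
          _ ≤ _ := by
            have := h2 t ⟨hRT.trans h, ht.2⟩
            gcongr
      calc bracket t ^ (2 * ν s)
          = bracket t ^ (2 * ν s + 2 * ε₁) * bracket t ^ (-(2 * ε₁)) := by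
            rw [← Real.rpow_add hX0]; congr 1; ring
        _ ≤ ((C + 1) * ((C + 1) * lam)) * (η / ((C + 1) * (C + 1))) := by
            have := hT t h
            gcongr
        _ = η * lam := by field_simp

theorem eventually_bracket_rpow_le_sqrt (E : EndData N d (ν s) ε₁ s R C c) (hN : 1 ≤ N)
    (hε₂ : 0 < ε₂) (hbν : BoundedAt (d 0) s → ε₂ < 1 - ν s) :
    ∀ᶠ lam in atTop, ∀ t ∈ Icc 0 (delta (d 0) ν ε₁ ε₂ s lam),
      bracket t ^ ν s ≤ Real.sqrt lam := by
  filter_upwards [E.eventually_bracket_rpow_le hN hε₂ hbν one_pos] with lam h t ht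
  apply Real.le_sqrt_of_sq_le
  have := h t ht
  rw [one_mul] at this
  rwa [← Real.rpow_natCast, ← Real.rpow_mul (bracket_pos t).le, Nat.cast_ofNat, mul_comm]

/-- This makes the JWKB terms with k ≥ 1 small compared with (1 + |Im V|)/√λ. The critical
contribution is that of Re V: bounding one of the two factors Im V in assumption (c) by √λ
⟨t⟩^{2ν+ε₁+1} leaves the bracket with exponent -1 - 3ε₁, and a spare √λ. -/
theorem eventually_weighted_norm_le (E : EndData N d (ν s) ε₁ s R C c) (hN : 1 ≤ N)
    (hε₂ : 0 < ε₂) (hbν : BoundedAt (d 0) s → ε₂ < 1 - ν s) {η : ℝ} (hη : 0 < η) :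
    ∀ᶠ lam in atTop, ∀ t ∈ Icc 0 (delta (d 0) ν ε₁ ε₂ s lam),
      (1 + ‖d 0 (s.sign * t)‖) * bracket t ^ (2 * ν s) ≤
        η * lam * (1 + |imAlong (d 0) s t|) := by
  by_cases hb : BoundedAt (d 0) s
  · obtain ⟨M, hM0, hM⟩ := E.exists_norm_le_of_bounded hb
    filter_upwards [E.eventually_bracket_rpow_le hN hε₂ hbν (η := η / (1 + M)) (by positivity),
      eventually_gt_atTop 0] with lam h hlam t ht
    have h1 := h t ht
    have h2 := hM t ht.1
    have hX := (Real.rpow_pos_of_pos (bracket_pos t) (2 * ν s)).le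
    calc (1 + ‖d 0 (s.sign * t)‖) * bracket t ^ (2 * ν s)
        ≤ (1 + M) * (η / (1 + M) * lam) := by gcongr
      _ = η * lam * 1 := by field_simp
      _ ≤ η * lam * (1 + |imAlong (d 0) s t|) := by
        gcongr
        linarith [abs_nonneg (imAlong (d 0) s t)]
  · have h0 := E.C_pos
    have := E.cont
    obtain ⟨M, hM0, hM⟩ := exists_abs_le_on_Icc (g := fun t => ‖d 0 (s.sign * t)‖)
      (by fun_prop) R
    filter_upwards [E.eventually_bracket_rpow_le hN hε₂ hbν (η := η / (1 + M)) (by positivity),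
      E.eventually_bracket_rpow_le hN hε₂ hbν (η := η / 2) (by positivity),
      E.eventually_im_sq_le (ε₂ := ε₂) hb, eventually_ge_atTop ((2 * C / η) ^ 2),
      eventually_gt_atTop 0] with lam h h' h3 h4 hlam t ht
    have hX := (Real.rpow_pos_of_pos (bracket_pos t) (2 * ν s)).le
    rcases le_total t R with hR | hR
    · have h1 := h t ht
      have h2 := hM t ⟨ht.1, hR⟩
      rw [abs_norm] at h2
      calc (1 + ‖d 0 (s.sign * t)‖) * bracket t ^ (2 * ν s)
          ≤ (1 + M) * (η / (1 + M) * lam) := by gcongr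
        _ = η * lam * 1 := by field_simp
        _ ≤ η * lam * (1 + |imAlong (d 0) s t|) := by
          gcongr
          linarith [abs_nonneg (imAlong (d 0) s t)]
    · have hy := E.im_pos hR
      have hX0 := bracket_pos t
      have hs : 2 * C / η ≤ Real.sqrt lam := Real.le_sqrt_of_sq_le h4
      have hss := Real.mul_self_sqrt hlam.le
      have hsp := Real.sqrt_pos.2 hlam
      rw [E.abs_im hR]
      have hyle : imAlong (d 0) s t ≤ Real.sqrt lam * bracket t ^ (2 * ν s + ε₁ + 1) := by
        refine abs_le_of_sq_le_sq' ?_ (by positivity) |>.2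
        rw [mul_pow, Real.sq_sqrt hlam.le, sq (bracket t ^ _), ← Real.rpow_add hX0]
        refine (h3 t ht).trans (le_of_eq ?_)
        congr 2
        ring
      have hre : |(d 0 (s.sign * t)).re| * bracket t ^ (2 * ν s) ≤
          η / 2 * lam * imAlong (d 0) s t := by
        calc |(d 0 (s.sign * t)).re| * bracket t ^ (2 * ν s)
            ≤ C * imAlong (d 0) s t ^ 2 * bracket t ^ (-(4 * (ν s + ε₁) + 2)) *
              bracket t ^ (2 * ν s) := by
              have := E.abs_re_le hb hR
              gcongr
          _ = C * imAlong (d 0) s t * imAlong (d 0) s t *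
              bracket t ^ (-(4 * (ν s + ε₁) + 2) + 2 * ν s) := by
              rw [Real.rpow_add hX0]; ring
          _ ≤ C * imAlong (d 0) s t * (Real.sqrt lam * bracket t ^ (2 * ν s + ε₁ + 1)) *
              bracket t ^ (-(4 * (ν s + ε₁) + 2) + 2 * ν s) := by gcongr
          _ = C * imAlong (d 0) s t * Real.sqrt lam *
              bracket t ^ (2 * ν s + ε₁ + 1 + (-(4 * (ν s + ε₁) + 2) + 2 * ν s)) := by
              rw [Real.rpow_add hX0 (2 * ν s + ε₁ + 1)]; ring
          _ ≤ C * imAlong (d 0) s t * Real.sqrt lam * 1 := by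
              gcongr
              exact Real.rpow_le_one_of_one_le_of_nonpos (one_le_bracket t)
                (by linarith [E.eps_pos])
          _ ≤ η / 2 * lam * imAlong (d 0) s t := by
              rw [div_le_iff₀ hη] at hs
              have : C * Real.sqrt lam ≤ η / 2 * lam := by
                have : η / 2 * lam = η / 2 * (Real.sqrt lam * Real.sqrt lam) := by rw [hss]
                nlinarith
              nlinarith
      have him : (1 + imAlong (d 0) s t) * bracket t ^ (2 * ν s) ≤
          (1 + imAlong (d 0) s t) * (η / 2 * lam) := by
        have := h' t ht
        gcongr
      have hn := Complex.norm_le_abs_re_add_abs_im (d 0 (s.sign * t))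
      rw [← abs_imAlong, E.abs_im hR] at hn
      have hfin : (1 + ‖d 0 (s.sign * t)‖) * bracket t ^ (2 * ν s) ≤
          (1 + (|(d 0 (s.sign * t)).re| + imAlong (d 0) s t)) * bracket t ^ (2 * ν s) := by
        gcongr
      nlinarith [mul_pos hη hlam]

theorem eventually_Delta (E : EndData N d (ν s) ε₁ s R C c) (hN : 1 ≤ N)
    (hε₂ : 0 < ε₂) (hbν : BoundedAt (d 0) s → ε₂ < 1 - ν s) :
    ∃ B, 0 < B ∧ ∀ᶠ lam in atTop, 0 < Delta (d 0) ν ε₁ ε₂ s lam ∧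
      Delta (d 0) ν ε₁ ε₂ s lam ≤ delta (d 0) ν ε₁ ε₂ s lam / 4 ∧
      (Delta (d 0) ν ε₁ ε₂ s lam)⁻¹ ≤ B * Real.sqrt lam := by
  refine ⟨4 * 2 ^ |ν s|, by positivity, ?_⟩
  filter_upwards [(E.tendsto_delta hε₂).eventually_ge_atTop 1, eventually_ge_atTop 1,
    E.eventually_bracket_rpow_le_sqrt hN hε₂ hbν] with lam h1 h2 h3
  have h2' : (1 : ℝ) ≤ 2 ^ |ν s| := Real.one_le_rpow (by norm_num) (abs_nonneg _)
  by_cases hb : BoundedAt (d 0) s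
  · rw [Delta, if_pos hb]
    refine ⟨by linarith, le_rfl, ?_⟩
    have h4 : 1 ≤ Real.sqrt lam := by rwa [Real.one_le_sqrt]
    have h5 : (delta (d 0) ν ε₁ ε₂ s lam / 4)⁻¹ ≤ 4 := by
      rw [inv_div, div_le_iff₀ (by linarith)]
      linarith
    nlinarith
  · rw [Delta, if_neg hb]
    set x := delta (d 0) ν ε₁ ε₂ s lam
    have hx : 0 < x := by linarith
    refine ⟨by positivity, ?_, ?_⟩
    -- Here ν ≥ -1 is needed: it gives δ^{-ν} ≤ δ, so that the transition region fits inside the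
    -- interval.
    · have := Real.rpow_le_rpow_of_exponent_le h1
        (show -ν s ≤ 1 by linarith [E.neg_one_le_of_not_bounded hN hb])
      rw [Real.rpow_one] at this
      linarith
    · rw [inv_div, Real.rpow_neg hx.le, div_inv_eq_mul, mul_assoc]
      have := rpow_le_bracket_rpow h1 (ν s)
      have := h3 x ⟨hx.le, le_rfl⟩
      calc 4 * x ^ ν s ≤ 4 * (2 ^ |ν s| * bracket x ^ ν s) := by gcongr
        _ ≤ 4 * (2 ^ |ν s| * Real.sqrt lam) := by gcongr

/-- At a bounded end Im V is bounded below, and the interval has length comparable to δ = λ^{ε₂/2}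
√λ. At an unbounded end only the window from δ - 2Δ to δ - Δ is used. Within distance 2Δ of δ, log
|Im V| varies by a bounded amount by Grönwall, because Δ is a multiple of δ^{-ν}. There Im V is
therefore at least a multiple of its value √λ ⟨δ⟩^{2ν+ε₁+1} at δ. -/
theorem exists_cutoffExponent_le_integral (E : EndData N d (ν s) ε₁ s R C c) (hN : 1 ≤ N)
    (hε₂ : 0 < ε₂) (hbν : BoundedAt (d 0) s → ε₂ < 1 - ν s) :
    ∃ c', 0 < c' ∧ ∀ᶠ lam in atTop,
      c' * cutoffExponent (d 0) ν ε₁ ε₂ s lam * Real.sqrt lam ≤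
        ∫ t in (0 : ℝ)..(delta (d 0) ν ε₁ ε₂ s lam - Delta (d 0) ν ε₁ ε₂ s lam),
          |imAlong (d 0) s t| := by
  obtain ⟨B, _, hΔ⟩ := E.eventually_Delta hN hε₂ hbν
  have hc := E.c_pos
  have hRpos := E.one_le_R
  have hci : Continuous fun t => |imAlong (d 0) s t| := E.cont_im.abs
  have hsub : ∀ a b : ℝ, ∀ m : ℝ, 0 ≤ a → a ≤ b → (∀ t ∈ Icc a b, m ≤ |imAlong (d 0) s t|) →
      (b - a) * m ≤ ∫ t in (0 : ℝ)..b, |imAlong (d 0) s t| := by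
    intro a b m ha hab h
    have h1 : ∫ _ in a..b, m ≤ ∫ t in a..b, |imAlong (d 0) s t| :=
      intervalIntegral.integral_mono_on hab (by simp) (hci.intervalIntegrable _ _) h
    have h2 : 0 ≤ ∫ t in (0 : ℝ)..a, |imAlong (d 0) s t| :=
      intervalIntegral.integral_nonneg ha fun _ _ => abs_nonneg _
    have h3 := intervalIntegral.integral_add_adjacent_intervals
      (hci.intervalIntegrable (μ := volume) 0 a) (hci.intervalIntegrable a b)
    rw [intervalIntegral.integral_const, smul_eq_mul] at h1
    linarith
  by_cases hb : BoundedAt (d 0) s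
  · refine ⟨c / 4, by positivity, ?_⟩
    filter_upwards [hΔ, (E.tendsto_delta hε₂).eventually_ge_atTop (2 * R),
      eventually_gt_atTop 0] with lam h1 h2 hlam
    set x := delta (d 0) ν ε₁ ε₂ s lam with hx
    have h3 := hsub R (x - Delta (d 0) ν ε₁ ε₂ s lam) c (by linarith) (by linarith)
      (fun t ht => by rw [E.abs_im ht.1]; exact E.im_ge t ht.1)
    refine le_trans ?_ h3
    have h4 : cutoffExponent (d 0) ν ε₁ ε₂ s lam * Real.sqrt lam = x := by
      rw [cutoffExponent, if_pos hb, hx, delta, if_pos hb, Real.sqrt_eq_rpow,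
        ← Real.rpow_add hlam]
      congr 1
      ring
    rw [mul_assoc, h4]
    nlinarith
  · have h0 := E.C_pos
    set K := C * (2 ^ |ν s| * 2 ^ |ν s|) with hK
    have hK0 : 0 < K := by positivity
    set p := 2 * ν s + ε₁ + 1 with hp
    -- exp(-K/2) is the Grönwall loss over the distance 2Δ, the factor 4 comes from Δ = δ^{-ν}/4,
    -- and 2^|p| from exchanging ⟨δ⟩ for δ.
    refine ⟨Real.exp (-(K / 2)) / (4 * 2 ^ |p|), by positivity, ?_⟩
    filter_upwards [hΔ, (E.tendsto_delta hε₂).eventually_ge_atTop (2 * R),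
      eventually_gt_atTop 0, E.eventually_im_sq_eq (ε₂ := ε₂) hb] with lam h1 h2 hlam h5
    have hDel : Delta (d 0) ν ε₁ ε₂ s lam = delta (d 0) ν ε₁ ε₂ s lam ^ (-ν s) / 4 := by
      rw [Delta, if_neg hb]
    set x := delta (d 0) ν ε₁ ε₂ s lam with hx
    set D := Delta (d 0) ν ε₁ ε₂ s lam with hD
    have hx1 : 1 ≤ x := by linarith
    have hx0 : 0 < x := by linarith
    have hyx := E.im_pos (t := x) (by linarith)
    have hlow : ∀ t ∈ Icc (x - 2 * D) (x - D),
        Real.exp (-(K / 2)) * imAlong (d 0) s x ≤ |imAlong (d 0) s t| := by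
      intro t ht
      have htR : R ≤ t := by linarith [ht.1]
      have hyt := E.im_pos htR
      rw [E.abs_im htR]
      have h6 := E.log_im_sub_le (φ := fun u => K * x ^ ν s * u) (φ' := fun _ => K * x ^ ν s)
        htR (by linarith [ht.2] : t ≤ x)
        (fun u _ => by simpa using (hasDerivAt_id u).const_mul (K * x ^ ν s))
        (fun u hu => by
          have h7 := bracket_rpow_le (x := u) (by linarith [hu.1]) (ν s)
          have h8 := rpow_le_two_rpow_mul hx0 (t := u) (by linarith [hu.1, ht.1]) hu.2 (ν s)
          calc C * bracket u ^ ν s ≤ C * (2 ^ |ν s| * (2 ^ |ν s| * x ^ ν s)) := by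
                have : bracket u ^ ν s ≤ 2 ^ |ν s| * (2 ^ |ν s| * x ^ ν s) :=
                  h7.trans (by gcongr)
                gcongr
            _ = K * x ^ ν s := by rw [hK]; ring)
      have h9 : K * x ^ ν s * x - K * x ^ ν s * t ≤ K / 2 := by
        have : x ^ ν s * x ^ (-ν s) = 1 := by rw [← Real.rpow_add hx0]; simp
        calc K * x ^ ν s * x - K * x ^ ν s * t = K * x ^ ν s * (x - t) := by ring
          _ ≤ K * x ^ ν s * (2 * D) := by
            have := ht.1
            gcongr
            linarith
          _ = K * (x ^ ν s * x ^ (-ν s)) / 2 := by rw [hDel]; ring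
          _ = K / 2 := by rw [this, mul_one]
      have h10 : Real.log (imAlong (d 0) s x) - K / 2 ≤ Real.log (imAlong (d 0) s t) := by
        linarith
      have h11 := Real.exp_le_exp.2 h10
      rw [Real.exp_log hyt, sub_eq_add_neg, Real.exp_add, Real.exp_log hyx, mul_comm] at h11
      exact h11
    have h12 := hsub (x - 2 * D) (x - D) _ (by linarith) (by linarith) hlow
    refine le_trans ?_ h12
    have hy : imAlong (d 0) s x = Real.sqrt lam * bracket x ^ p := by
      have hX0 := bracket_pos x
      have : imAlong (d 0) s x ^ 2 = (Real.sqrt lam * bracket x ^ p) ^ 2 := by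
        rw [h5, mul_pow, Real.sq_sqrt hlam.le, sq (bracket x ^ p), ← Real.rpow_add hX0]
        congr 2
        rw [hp]; ring
      exact (sq_eq_sq₀ hyx.le (by positivity)).1 this
    have h13 := rpow_le_bracket_rpow hx1 p
    rw [show x - D - (x - 2 * D) = D by ring, hy, hDel, cutoffExponent, if_neg hb, ← hx]
    have h14 : x ^ (ν s + 1 + ε₁) = x ^ (-ν s) * x ^ p := by
      rw [← Real.rpow_add hx0]; congr 1; rw [hp]; ring
    rw [h14]
    calc Real.exp (-(K / 2)) / (4 * 2 ^ |p|) * (x ^ (-ν s) * x ^ p) * Real.sqrt lam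
        ≤ Real.exp (-(K / 2)) / (4 * 2 ^ |p|) * (x ^ (-ν s) * (2 ^ |p| * bracket x ^ p)) *
          Real.sqrt lam := by gcongr
      _ = _ := by field_simp

/-- Polynomial factors in λ and δ can thus be absorbed by the exponential of the cut-off exponent.
At an unbounded end λ may be exponentially large in δ: the defining equation expresses log λ through
log |Im V(δ)|, which Grönwall bounds by a power of δ smaller than δ^{ν+1+ε₁}. -/
theorem eventually_log_le (E : EndData N d (ν s) ε₁ s R C c) (hN : 1 ≤ N)
    (hε₂ : 0 < ε₂) {η : ℝ} (hη : 0 < η) :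
    ∀ᶠ lam in atTop, 1 ≤ η * cutoffExponent (d 0) ν ε₁ ε₂ s lam ∧
      Real.log lam ≤ η * cutoffExponent (d 0) ν ε₁ ε₂ s lam ∧
      Real.log (delta (d 0) ν ε₁ ε₂ s lam) ≤ η * cutoffExponent (d 0) ν ε₁ ε₂ s lam := by
  by_cases hb : BoundedAt (d 0) s
  · have h1 := eventually_const_mul_log_le (f := ε₂ / 2) (by linarith) 1 hη
    have h2 := eventually_const_mul_log_le (f := ε₂ / 2) (by linarith) ((1 + ε₂) / 2) hη
    have h3 := eventually_const_mul_rpow_le (e := 0) (f := ε₂ / 2) (by linarith) 1 hη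
    filter_upwards [h1, h2, h3, eventually_gt_atTop 0] with lam h1 h2 h3 h4
    rw [cutoffExponent, if_pos hb, delta, if_pos hb, Real.log_rpow h4]
    rw [Real.rpow_zero] at h3
    exact ⟨by linarith, by linarith, h2⟩
  · have hν := E.neg_one_le_of_not_bounded hN hb
    have he := E.eps_pos
    have h0 := E.C_pos
    have hR := E.one_le_R
    -- The exponent a lies strictly between ν + 1 and ν + 1 + ε₁ and is positive even for ν = -1,
    -- when t^ν itself would integrate to a logarithm.
    set a := ν s + 1 + ε₁ / 2 with ha
    have ha0 : 0 < a := by linarith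
    set b := ν s + 1 + ε₁ with hb'
    set K := C * 2 ^ |ν s| / a with hK
    have hK0 : 0 < K := by positivity
    set p := 4 * ν s + 2 * ε₁ + 2 with hp
    set y₀ := Real.log (imAlong (d 0) s R) with hy₀
    have e1 := eventually_const_mul_rpow_le (e := a) (f := b) (by linarith) (2 * K)
      (show 0 < η / 4 by linarith)
    have e2 := eventually_const_mul_log_le (f := b) (by linarith) |p| (show 0 < η / 4 by linarith)
    have e3 := eventually_const_mul_rpow_le (e := 0) (f := b) (by linarith)
      (2 * y₀ + |p| * Real.log 2) (show 0 < η / 4 by linarith)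
    have e4 := eventually_const_mul_log_le (f := b) (by linarith) 1 hη
    have e5 := eventually_const_mul_rpow_le (e := 0) (f := b) (by linarith) 1 hη
    have hT := E.tendsto_delta (ε₂ := ε₂) hε₂
    filter_upwards [hT.eventually e1, hT.eventually e2, hT.eventually e3, hT.eventually e4,
      hT.eventually_ge_atTop R, eventually_gt_atTop 0, E.eventually_im_sq_eq (ε₂ := ε₂) hb,
      hT.eventually e5] with lam e1 e2 e3 e4 hxR hlam h5 e5
    rw [cutoffExponent, if_neg hb, ← hb']
    set x := delta (d 0) ν ε₁ ε₂ s lam with hx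
    have hx1 : 1 ≤ x := by linarith
    have hx0 : 0 < x := by linarith
    refine ⟨by rw [Real.rpow_zero] at e5; linarith, ?_, by linarith⟩
    have h6 := E.log_im_sub_le (φ := fun u => K * u ^ a) (φ' := fun u => C * 2 ^ |ν s| * u ^ (a - 1))
      le_rfl hxR (fun u hu => by
        have hu0 : u ≠ 0 := by linarith [hu.1]
        refine ((Real.hasDerivAt_rpow_const (Or.inl hu0)).const_mul K).congr_deriv ?_
        rw [hK]
        field_simp) (fun u hu => by
        have hu1 : 1 ≤ u := by linarith [hu.1]
        calc C * bracket u ^ ν s ≤ C * (2 ^ |ν s| * u ^ ν s) := by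
              have := bracket_rpow_le hu1 (ν s)
              gcongr
          _ ≤ C * (2 ^ |ν s| * u ^ (a - 1)) := by
              have := Real.rpow_le_rpow_of_exponent_le hu1 (show ν s ≤ a - 1 by
                rw [ha]; linarith)
              gcongr
          _ = _ := by ring)
    have hyx := E.im_pos (t := x) hxR
    have h7 : Real.log lam = 2 * Real.log (imAlong (d 0) s x) - p * Real.log (bracket x) := by
      have := congrArg Real.log h5
      rw [Real.log_pow, Real.log_mul hlam.ne' (Real.rpow_pos_of_pos (bracket_pos x) _).ne',
        Real.log_rpow (bracket_pos x), Nat.cast_ofNat] at this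
      linarith
    have h8 : Real.log (bracket x) ≤ Real.log 2 + Real.log x := by
      rw [← Real.log_mul two_ne_zero hx0.ne']
      exact Real.log_le_log (bracket_pos x) (bracket_le_two_mul hx1)
    have h9 : 0 ≤ Real.log (bracket x) := Real.log_nonneg (one_le_bracket x)
    have h10 : -(p * Real.log (bracket x)) ≤ |p| * (Real.log 2 + Real.log x) := by
      calc -(p * Real.log (bracket x)) = (-p) * Real.log (bracket x) := by ring
        _ ≤ |p| * Real.log (bracket x) := by
          gcongr
          exact neg_le_abs p
        _ ≤ _ := by gcongr
    have h11 : 0 ≤ K * R ^ a := by positivity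
    have h12 : 0 ≤ η * x ^ b := by positivity
    rw [Real.rpow_zero, mul_one] at e3
    rw [h7]
    rw [← hy₀] at h6
    have h13 : 2 * Real.log (imAlong (d 0) s x) ≤ 2 * y₀ + 2 * K * x ^ a := by linarith
    have h14 : -(p * Real.log (bracket x)) ≤ |p| * Real.log 2 + |p| * Real.log x := by
      rw [← mul_add]; exact h10
    have h15 : 2 * Real.log (imAlong (d 0) s x) - p * Real.log (bracket x) ≤
      η / 4 * x ^ b + η / 4 * x ^ b + η / 4 * x ^ b := by linarith
    refine h15.trans ?_
    generalize x ^ b = z at h12 ⊢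
    linarith

/-- Since ν ≥ -1, the bracket exponent in the level is at least -2. Hence λ ≤ |Im V(δ)|² ⟨δ⟩² =
O(δ^{2(γ+1)}). -/
theorem exists_rpow_le_delta (E : EndData N d (ν s) ε₁ s R C c) (hN : 1 ≤ N)
    (hε₂ : 0 < ε₂) {γ Cγ : ℝ} (hγ : 0 ≤ γ)
    (hup : ∀ᶠ t in atTop, |imAlong (d 0) s t| ≤ Cγ * t ^ γ) :
    ∃ c', 0 < c' ∧ ∀ᶠ lam in atTop,
      c' * lam ^ (1 / (2 * (γ + 1))) ≤ delta (d 0) ν ε₁ ε₂ s lam := by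
  have hT := E.tendsto_delta (ε₂ := ε₂) hε₂
  by_cases hb : BoundedAt (d 0) s
  · refine ⟨1, one_pos, ?_⟩
    filter_upwards [eventually_ge_atTop 1] with lam h1
    rw [delta, if_pos hb, one_mul]
    refine Real.rpow_le_rpow_of_exponent_le h1 ?_
    calc 1 / (2 * (γ + 1)) ≤ 1 / 2 := by
          apply one_div_le_one_div_of_le <;> linarith
      _ ≤ (1 + ε₂) / 2 := by linarith
  · have hν := E.neg_one_le_of_not_bounded hN hb
    have he := E.eps_pos
    set K := 2 * (|Cγ| + 1) with hK
    have hK0 : 0 < K := by positivity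
    have hg1 : 0 < γ + 1 := by linarith
    refine ⟨(1 / K) ^ (1 / (γ + 1)), by positivity, ?_⟩
    filter_upwards [hT.eventually hup, hT.eventually_ge_atTop R, eventually_gt_atTop 0,
      E.eventually_im_sq_eq (ε₂ := ε₂) hb] with lam h1 h2 hlam h3
    set x := delta (d 0) ν ε₁ ε₂ s lam with hx
    have hx1 : 1 ≤ x := by linarith [E.one_le_R]
    have hx0 : 0 < x := by linarith
    have hX0 := bracket_pos x
    have h4 : lam * bracket x ^ (-2 : ℝ) ≤ imAlong (d 0) s x ^ 2 := by
      rw [h3]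
      gcongr
      · exact one_le_bracket x
      · linarith
    have h5 : lam ≤ (K * x ^ (γ + 1)) ^ 2 := by
      have h6 : imAlong (d 0) s x ^ 2 ≤ ((|Cγ| + 1) * x ^ γ) ^ 2 := by
        rw [← sq_abs]
        have : |imAlong (d 0) s x| ≤ (|Cγ| + 1) * x ^ γ := h1.trans (by
          gcongr
          linarith [le_abs_self Cγ])
        gcongr
      have h7 : lam = lam * bracket x ^ (-2 : ℝ) * bracket x ^ 2 := by
        rw [mul_assoc, ← Real.rpow_natCast (bracket x), ← Real.rpow_add hX0]
        norm_num
      calc lam = lam * bracket x ^ (-2 : ℝ) * bracket x ^ 2 := h7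
        _ ≤ ((|Cγ| + 1) * x ^ γ) ^ 2 * (2 * x) ^ 2 := by
          have := bracket_le_two_mul hx1
          have := h4.trans h6
          gcongr
        _ = (K * x ^ (γ + 1)) ^ 2 := by
          rw [Real.rpow_add_one hx0.ne', hK]; ring
    have h8 : lam ^ (1 / (2 * (γ + 1))) ≤ K ^ (1 / (γ + 1)) * x := by
      calc lam ^ (1 / (2 * (γ + 1))) ≤ ((K * x ^ (γ + 1)) ^ 2) ^ (1 / (2 * (γ + 1))) :=
            Real.rpow_le_rpow hlam.le h5 (by positivity)
        _ = (K * x ^ (γ + 1)) ^ (1 / (γ + 1)) := by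
            rw [← Real.rpow_natCast, ← Real.rpow_mul (by positivity)]
            congr 1
            field_simp
            norm_num
        _ = K ^ (1 / (γ + 1)) * x := by
            rw [Real.mul_rpow hK0.le (by positivity), ← Real.rpow_mul hx0.le,
              mul_one_div_cancel hg1.ne', Real.rpow_one]
    calc (1 / K) ^ (1 / (γ + 1)) * lam ^ (1 / (2 * (γ + 1)))
        ≤ (1 / K) ^ (1 / (γ + 1)) * (K ^ (1 / (γ + 1)) * x) := by gcongr
      _ = x := by
        rw [← mul_assoc, ← Real.mul_rpow (by positivity) hK0.le, one_div_mul_cancel hK0.ne',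
          Real.one_rpow, one_mul]

end EndData

/-- On a compact set Re(λ - V) is positive for large λ; outside it Im V does not vanish. The square
root is therefore smooth at every x, not only up to the cut-off radii. -/
theorem eventually_mem_slitPlane {N : ℕ} {d : ℕ → ℝ → ℂ} {ν : Side → ℝ} {ε₁ : ℝ}
    (hE : ∀ s, ∃ R C c : ℝ, EndData N d (ν s) ε₁ s R C c) :
    ∀ᶠ lam : ℝ in atTop, ∀ x, (lam : ℂ) - d 0 x ∈ Complex.slitPlane := by
  have hside : ∀ s : Side, ∀ᶠ lam : ℝ in atTop, ∀ t, 0 ≤ t →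
      (lam : ℂ) - d 0 (s.sign * t) ∈ Complex.slitPlane := by
    intro s
    obtain ⟨R, C, c, E⟩ := hE s
    have := E.cont
    obtain ⟨M, hM0, hM⟩ := exists_abs_le_on_Icc (g := fun t => (d 0 (s.sign * t)).re)
      (by fun_prop) R
    filter_upwards [eventually_gt_atTop M] with lam hlam t ht
    rw [Complex.mem_slitPlane_iff]
    rcases le_total t R with h | h
    · left
      have := (le_abs_self _).trans (hM t ⟨ht, h⟩)
      simp only [Complex.sub_re, Complex.ofReal_re]
      linarith
    · right
      have := E.im_pos h
      simp only [Complex.sub_im, Complex.ofReal_im, zero_sub, ne_eq, neg_eq_zero]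
      intro h0
      rw [imAlong, h0, mul_zero] at this
      exact lt_irrefl _ this
  filter_upwards [hside .minus, hside .plus] with lam h1 h2 x
  rcases le_total 0 x with h | h
  · simpa [Side.sign] using h2 x h
  · simpa [Side.sign] using h1 (-x) (by linarith)

/-! ### The phase -/

/-- The exponent of the ansatz, up to sign. -/
noncomputable def phase (V : ℝ → ℂ) (N : ℕ) (lam x : ℝ) : ℂ :=
  ∫ t in (0 : ℝ)..x, phaseDeriv V N lam t

theorem continuous_wkbTerm {d : ℕ → ℝ → ℂ} {N : ℕ} {lam : ℝ} (hlam : 0 < lam)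
    (hU : ∀ x, (lam : ℂ) - d 0 x ∈ Complex.slitPlane)
    (hd : ∀ i < N, ∀ x, HasDerivAt (d i) (d (i + 1) x) x) (hN : 1 ≤ N)
    (hc : ∀ i ≤ N, Continuous (d i)) {j : ℕ} (hj : j ≤ N) :
    Continuous (wkbTerm (d 0) lam j) := by
  have h0 : Continuous (wkbTerm (d 0) lam 0) := continuous_iff_continuousAt.2 fun x =>
    (hasDerivAt_wkbTerm_zero (hU x) (hd 0 (by omega) x)).continuousAt
  rcases Nat.eq_zero_or_pos j with rfl | hj0
  · exact h0
  obtain ⟨c, G, hG, h⟩ := exists_isobaric_wkbTerm d N j hj0 hj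
  rw [show wkbTerm (d 0) lam j = fun x => (c * quot d j lam x + G lam x) /
    wkbTerm (d 0) lam 0 x ^ (j - 1) from funext fun x => h lam hlam hU hd x]
  have hne := fun x => Complex.slitPlane_ne_zero (hU x)
  have hQ : Isobaric d N j (fun lam x => c * quot d j lam x + G lam x) :=
    .add (.smul _ (.gen j hj0 hj)) (hG.mono (by omega))
  exact (hQ.continuous hne hc).div (h0.pow _) fun x =>
    pow_ne_zero _ (wkbTerm_zero_ne_zero hlam (hU x))

theorem continuous_phaseDeriv {d : ℕ → ℝ → ℂ} {N : ℕ} {lam : ℝ} (hlam : 0 < lam)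
    (hU : ∀ x, (lam : ℂ) - d 0 x ∈ Complex.slitPlane)
    (hd : ∀ i < N, ∀ x, HasDerivAt (d i) (d (i + 1) x) x) (hN : 1 ≤ N)
    (hc : ∀ i ≤ N, Continuous (d i)) : Continuous (phaseDeriv (d 0) N lam) :=
  continuous_finsetSum _ fun j hj =>
    continuous_wkbTerm hlam hU hd hN hc (by have := Finset.mem_range.1 hj; omega)

theorem sum_integral_wkbTerm {d : ℕ → ℝ → ℂ} {N : ℕ} {lam : ℝ} (hlam : 0 < lam)
    (hU : ∀ x, (lam : ℂ) - d 0 x ∈ Complex.slitPlane)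
    (hd : ∀ i < N, ∀ x, HasDerivAt (d i) (d (i + 1) x) x) (hN : 1 ≤ N)
    (hc : ∀ i ≤ N, Continuous (d i)) (x : ℝ) :
    phase (d 0) N lam x = ∑ j ∈ Finset.range (N + 1), ∫ t in (0 : ℝ)..x, wkbTerm (d 0) lam j t := by
  unfold phase phaseDeriv
  rw [intervalIntegral.integral_finsetSum]
  intro j hj
  exact (continuous_wkbTerm hlam hU hd hN hc
    (by have := Finset.mem_range.1 hj; omega)).intervalIntegrable _ _

theorem ansatz_eq_exp_phase {d : ℕ → ℝ → ℂ} {N : ℕ} {lam : ℝ} (hlam : 0 < lam)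
    (hU : ∀ x, (lam : ℂ) - d 0 x ∈ Complex.slitPlane)
    (hd : ∀ i < N, ∀ x, HasDerivAt (d i) (d (i + 1) x) x) (hN : 1 ≤ N)
    (hc : ∀ i ≤ N, Continuous (d i)) (x : ℝ) :
    ansatz (d 0) N lam x = Complex.exp (-phase (d 0) N lam x) := by
  rw [ansatz, sum_integral_wkbTerm hlam hU hd hN hc]
  congr 2
  refine Finset.sum_congr rfl fun j _ => ?_
  unfold wkbTerm
  rw [intervalIntegral.integral_const_mul]

theorem hasDerivAt_phase {d : ℕ → ℝ → ℂ} {N : ℕ} {lam : ℝ} (hlam : 0 < lam)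
    (hU : ∀ x, (lam : ℂ) - d 0 x ∈ Complex.slitPlane)
    (hd : ∀ i < N, ∀ x, HasDerivAt (d i) (d (i + 1) x) x) (hN : 1 ≤ N)
    (hc : ∀ i ≤ N, Continuous (d i)) (x : ℝ) :
    HasDerivAt (phase (d 0) N lam) (phaseDeriv (d 0) N lam x) x := by
  have h := continuous_phaseDeriv hlam hU hd hN hc
  exact intervalIntegral.integral_hasDerivAt_right (h.intervalIntegrable _ _)
    h.stronglyMeasurable.stronglyMeasurableAtFilter h.continuousAt

/-- The term with k = 0 equals -q_1/4, the derivative of log(λ - V)/4. This exact integration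
replaces any smallness estimate: the real part stays bounded as soon as |λ - V| is comparable with
λ. -/
theorem integral_wkbTerm_one {d : ℕ → ℝ → ℂ} {N : ℕ} {lam : ℝ} (hlam : 0 < lam)
    (hU : ∀ x, (lam : ℂ) - d 0 x ∈ Complex.slitPlane)
    (hd : ∀ i < N, ∀ x, HasDerivAt (d i) (d (i + 1) x) x) (hN : 1 ≤ N)
    (hc : ∀ i ≤ N, Continuous (d i)) (x : ℝ) :
    ∫ t in (0 : ℝ)..x, wkbTerm (d 0) lam 1 t =
      (1 / 4 : ℂ) * Complex.log ((lam : ℂ) - d 0 x) -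
        (1 / 4 : ℂ) * Complex.log ((lam : ℂ) - d 0 0) := by
  apply intervalIntegral.integral_eq_sub_of_hasDerivAt
    (f := fun x => (1 / 4 : ℂ) * Complex.log ((lam : ℂ) - d 0 x))
  · intro t _
    have h := (((hd 0 (by omega) t).const_sub (lam : ℂ)).clog_real (hU t)).const_mul (1 / 4 : ℂ)
    refine h.congr_deriv ?_
    have h1 := wkbTerm_succ hlam (hU t) 0
    rw [(hasDerivAt_wkbTerm_zero (hU t) (hd 0 (by omega) t)).deriv] at h1
    simp only [Finset.range_zero, Finset.sum_empty, sub_zero, zero_add] at h1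
    have h2 := wkbTerm_zero_ne_zero hlam (hU t)
    have h3 : 4 * wkbTerm (d 0) lam 1 t = -quot d 1 lam t := by
      apply mul_left_cancel₀ h2
      linear_combination 2 * h1
    rw [quot] at h3
    rw [zero_add]
    linear_combination -h3 / 4
  · exact (continuous_wkbTerm hlam hU hd hN hc hN).intervalIntegrable _ _

theorem abs_re_integral_wkbTerm_one_le {d : ℕ → ℝ → ℂ} {N : ℕ} {lam : ℝ} (hlam : 0 < lam)
    (hU : ∀ x, (lam : ℂ) - d 0 x ∈ Complex.slitPlane)
    (hd : ∀ i < N, ∀ x, HasDerivAt (d i) (d (i + 1) x) x) (hN : 1 ≤ N)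
    (hc : ∀ i ≤ N, Continuous (d i)) {x B : ℝ}
    (h1 : lam / 2 ≤ ‖(lam : ℂ) - d 0 x‖) (h2 : ‖(lam : ℂ) - d 0 x‖ ≤ B * lam)
    (h3 : lam / 2 ≤ ‖(lam : ℂ) - d 0 0‖) (h4 : ‖(lam : ℂ) - d 0 0‖ ≤ B * lam) :
    |(∫ t in (0 : ℝ)..x, wkbTerm (d 0) lam 1 t).re| ≤ Real.log (2 * B) := by
  rw [integral_wkbTerm_one hlam hU hd hN hc]
  have e : ((1 / 4 : ℂ) * Complex.log ((lam : ℂ) - d 0 x) -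
        (1 / 4 : ℂ) * Complex.log ((lam : ℂ) - d 0 0)).re =
      (Real.log ‖(lam : ℂ) - d 0 x‖ - Real.log ‖(lam : ℂ) - d 0 0‖) / 4 := by
    have : (1 / 4 : ℂ) = ((1 / 4 : ℝ) : ℂ) := by push_cast; rfl
    rw [this, Complex.sub_re, Complex.re_ofReal_mul, Complex.re_ofReal_mul, Complex.log_re,
      Complex.log_re]
    ring
  have hp : 0 < lam / 2 := by linarith
  have l1 := Real.log_le_log hp h1
  have l2 := Real.log_le_log (hp.trans_le h1) h2
  have l3 := Real.log_le_log hp h3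
  have l4 := Real.log_le_log (hp.trans_le h3) h4
  have hB : 0 < B := by
    by_contra hB
    nlinarith
  have l5 : Real.log (B * lam) - Real.log (lam / 2) = Real.log (2 * B) := by
    rw [← Real.log_div (by positivity) (by positivity)]
    congr 1
    field_simp
  rw [e, abs_le]
  constructor <;> linarith

/-- The real part of the leading term. -/
theorem re_wkbTerm_zero_bounds {V : ℝ → ℂ} {lam x B : ℝ} (hlam : 0 < lam) (hB : 1 ≤ B)
    (h1 : lam / 2 ≤ ((lam : ℂ) - V x).re) (h2 : ‖(lam : ℂ) - V x‖ ≤ B * lam) (σ : ℝ) :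
    (|σ * (V x).im| / (2 * B) - (|σ * (V x).im| - σ * (V x).im)) / Real.sqrt lam ≤
      σ * (wkbTerm V lam 0 x).re ∧
    |σ * (wkbTerm V lam 0 x).re| ≤ |σ * (V x).im| / Real.sqrt lam := by
  -- From w² = λ - V one reads off 2 Re w Im w = -Im V, so the real part of the leading term is -Im
  -- w = Im V / (2 Re w). Everything then rests on √λ/2 ≤ Re w ≤ B √λ, where Re w ≥ 0 comes from the
  -- principal branch.
  set w := ((lam : ℂ) - V x) ^ (1 / 2 : ℂ) with hw
  have hsq : w ^ 2 = (lam : ℂ) - V x := by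
    have h := wkbTerm_zero_sq V hlam x
    rw [wkbTerm_zero V hlam, ← hw, mul_pow, Complex.I_sq] at h
    linear_combination -h
  have hre : (wkbTerm V lam 0 x).re = -w.im := by
    rw [wkbTerm_zero V hlam, ← hw]; simp
  have hwre : 0 ≤ w.re := by
    rw [hw]
    have h0 : (lam : ℂ) - V x ≠ 0 := by
      intro h; rw [h] at h1; simp at h1; linarith
    rw [Complex.cpow_def_of_ne_zero h0, Complex.exp_re]
    refine mul_nonneg (Real.exp_pos _).le (Real.cos_nonneg_of_mem_Icc ?_)
    have e : (Complex.log ((lam : ℂ) - V x) * (1 / 2 : ℂ)).im =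
        ((lam : ℂ) - V x).arg / 2 := by
      have : (1 / 2 : ℂ) = ((1 / 2 : ℝ) : ℂ) := by push_cast; rfl
      rw [this, Complex.im_mul_ofReal, Complex.log_im]; ring
    rw [e]
    have := Complex.neg_pi_lt_arg ((lam : ℂ) - V x)
    have := Complex.arg_le_pi ((lam : ℂ) - V x)
    constructor <;> linarith
  have hs := Real.sqrt_pos.2 hlam
  have hss := Real.mul_self_sqrt hlam.le
  have e1 : w.re ^ 2 - w.im ^ 2 = ((lam : ℂ) - V x).re := by
    rw [← hsq, sq w, Complex.mul_re]; ring
  have e2 : 2 * (w.re * w.im) = -(V x).im := by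
    have : (w ^ 2).im = ((lam : ℂ) - V x).im := by rw [hsq]
    rw [sq w, Complex.mul_im] at this
    simp only [Complex.sub_im, Complex.ofReal_im, zero_sub] at this
    linarith
  have hnorm : w.re ^ 2 + w.im ^ 2 ≤ B * lam := by
    have : ‖w‖ ^ 2 = ‖(lam : ℂ) - V x‖ := by rw [← norm_pow, hsq]
    rw [← Complex.normSq_eq_norm_sq, Complex.normSq_apply] at this
    nlinarith
  have hlow : Real.sqrt lam / 2 ≤ w.re := by
    refine abs_le_of_sq_le_sq' ?_ hwre |>.2
    nlinarith [sq_nonneg w.im]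
  have hup : w.re ≤ B * Real.sqrt lam := by
    refine abs_le_of_sq_le_sq' ?_ (by positivity) |>.2
    rw [mul_pow, Real.sq_sqrt hlam.le]
    nlinarith [sq_nonneg w.im, mul_le_mul_of_nonneg_right hB (mul_nonneg (by linarith) hlam.le :
      0 ≤ B * lam)]
  have hwpos : 0 < w.re := by linarith
  have hval : σ * (wkbTerm V lam 0 x).re = σ * (V x).im / (2 * w.re) := by
    rw [hre, eq_div_iff (by positivity)]
    linear_combination (-σ) * e2
  rw [hval]
  set Y := σ * (V x).im
  constructor
  -- For Y ≤ 0 the correction |Y| - Y pulls the left side below Y / √λ, which suffices because 2 Re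
  -- w ≥ √λ.
  · rcases le_total 0 Y with h | h
    · rw [abs_of_nonneg h, sub_self, sub_zero, div_div]
      apply div_le_div_of_nonneg_left h (by positivity)
      nlinarith
    · rw [abs_of_nonpos h, div_le_div_iff₀ hs (by positivity)]
      have hB' : -Y / (2 * B) ≤ -Y := by
        rw [div_le_iff₀ (by positivity)]; nlinarith
      have : (-Y / (2 * B) - (-Y - Y)) ≤ Y := by linarith
      nlinarith
  · rw [abs_div, abs_of_pos (show 0 < 2 * w.re by positivity)]
    apply div_le_div_of_nonneg_left (abs_nonneg _) hs
    linarith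

/-! ### Bounds on the JWKB terms along one end -/

namespace EndData

variable {N : ℕ} {d : ℕ → ℝ → ℂ} {ν : Side → ℝ} {ε₁ ε₂ : ℝ} {s : Side} {R C c : ℝ}

/-- The assumptions speak only of large |x|. On the remaining compact piece V may vanish, so |V| is
replaced by 1 + |V|. -/
theorem exists_deriv_le (E : EndData N d (ν s) ε₁ s R C c) (hc : ∀ i ≤ N, Continuous (d i)) :
    ∃ A, 0 < A ∧ ∀ i, 1 ≤ i → i ≤ N → ∀ t, 0 ≤ t →
      ‖d i (s.sign * t)‖ ≤ A * ((1 + ‖d 0 (s.sign * t)‖) * bracket t ^ ((i : ℝ) * ν s)) := by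
  have h : ∀ i, ∃ A, 0 < A ∧ (i ≤ N → ∀ t ∈ Icc 0 R,
      |‖d i (s.sign * t)‖ * bracket t ^ (-((i : ℝ) * ν s))| ≤ A) := by
    intro i
    by_cases hi : i ≤ N
    · have := hc i hi
      obtain ⟨M, h1, h2⟩ := exists_abs_le_on_Icc
        (g := fun t => ‖d i (s.sign * t)‖ * bracket t ^ (-((i : ℝ) * ν s)))
        ((by fun_prop : Continuous fun t => ‖d i (s.sign * t)‖).mul (continuous_bracket_rpow _)) R
      exact ⟨M, h1, fun _ => h2⟩
    · exact ⟨1, one_pos, fun h => absurd h hi⟩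
  choose A hA0 hA using h
  set K := ∑ i ∈ Finset.range (N + 1), A i
  have hK0 : 0 ≤ K := Finset.sum_nonneg fun j _ => (hA0 j).le
  have hK : ∀ i ≤ N, A i ≤ K := fun j hj =>
    Finset.single_le_sum (f := A) (fun i _ => (hA0 i).le) (Finset.mem_range.2 (by omega))
  have hC := E.C_pos
  refine ⟨K + C, by linarith, fun i h1 h2 t ht => ?_⟩
  have hX := Real.rpow_pos_of_pos (bracket_pos t) ((i : ℝ) * ν s)
  have hn := norm_nonneg (d 0 (s.sign * t))
  rcases le_total t R with h | h
  · have h3 := (le_abs_self _).trans (hA i h2 t ⟨ht, h⟩)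
    rw [Real.rpow_neg (bracket_pos t).le, ← div_eq_mul_inv, div_le_iff₀ hX] at h3
    refine h3.trans ?_
    have := hK i h2
    calc A i * bracket t ^ ((i : ℝ) * ν s)
        ≤ (K + C) * ((1 + 0) * bracket t ^ ((i : ℝ) * ν s)) := by
          rw [add_zero, one_mul]; gcongr; linarith
      _ ≤ _ := by gcongr
  · refine (E.deriv_le i h1 h2 t h).trans ?_
    gcongr <;> linarith

/-- Uniform bounds on the JWKB terms up to the cut-off radius. -/
theorem exists_eventually_wkb_bounds (E : EndData N d (ν s) ε₁ s R C c) (hN : 1 ≤ N)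
    (hε₂ : 0 < ε₂) (hbν : BoundedAt (d 0) s → ε₂ < 1 - ν s) (hc : ∀ i ≤ N, Continuous (d i))
    (hd : ∀ i < N, ∀ x, HasDerivAt (d i) (d (i + 1) x) x)
    (hU : ∀ᶠ lam : ℝ in atTop, ∀ x, (lam : ℂ) - d 0 x ∈ Complex.slitPlane) :
    ∃ B, 1 ≤ B ∧ ∀ᶠ lam : ℝ in atTop, ∀ t ∈ Icc 0 (delta (d 0) ν ε₁ ε₂ s lam),
      lam / 2 ≤ ((lam : ℂ) - d 0 (s.sign * t)).re ∧
      ‖(lam : ℂ) - d 0 (s.sign * t)‖ ≤ B * lam ∧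
      (∀ j, 1 ≤ j → j ≤ N → ‖wkbTerm (d 0) lam j (s.sign * t)‖ ≤
        B * ((1 + ‖d 0 (s.sign * t)‖) / lam * (bracket t ^ ν s) ^ j) / Real.sqrt lam ^ (j - 1)) ∧
      (HasDerivAt (d N) (d (N + 1) (s.sign * t)) (s.sign * t) →
        ∃ D, HasDerivAt (phaseDeriv (d 0) N lam) D (s.sign * t) ∧
        ‖D - phaseDeriv (d 0) N lam (s.sign * t) ^ 2 + d 0 (s.sign * t) - lam‖ ≤
          B * ((1 + ‖d 0 (s.sign * t)‖) / lam * (bracket t ^ ν s) ^ (N + 1) /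
            Real.sqrt lam ^ (N - 1)) +
          B * ‖d (N + 1) (s.sign * t)‖ / Real.sqrt lam ^ (N + 1)) := by
  obtain ⟨A, hA0, hA⟩ := E.exists_deriv_le hc
  obtain ⟨B, hB0, hB⟩ := E.exists_eventually_norm_le (ε₂ := ε₂)
  obtain ⟨K, hK0, hK⟩ := exists_wkb_bounds d N hN (2 * A) (B + 1)
  refine ⟨1 + B + K, by linarith, ?_⟩
  filter_upwards [hB, hU, E.eventually_abs_re_le (ε₂ := ε₂), eventually_ge_atTop 1,
    E.eventually_bracket_rpow_le_sqrt hN hε₂ hbν] with lam h1 h2 h3 hlam1 h4 t ht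
  have hlam : 0 < lam := by linarith
  have hs := Real.sqrt_pos.2 hlam
  have hre : lam / 2 ≤ ((lam : ℂ) - d 0 (s.sign * t)).re := by
    have := (abs_le.1 (h3 t ht)).2
    simp only [Complex.sub_re, Complex.ofReal_re]
    linarith
  have hnorm : lam / 2 ≤ ‖(lam : ℂ) - d 0 (s.sign * t)‖ :=
    hre.trans (Complex.re_le_norm _)
  have hX := Real.rpow_pos_of_pos (bracket_pos t) (ν s)
  have hn := norm_nonneg (d 0 (s.sign * t))
  have key := hK lam ((1 + ‖d 0 (s.sign * t)‖) / lam) (bracket t ^ ν s) (s.sign * t) hlam h2 hd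
    (by positivity) (by
      rw [div_le_iff₀ hlam]
      have := h1 t ht
      nlinarith) hX.le (by
      have := h4 t ht
      nlinarith) hnorm (by
      intro i hi1 hi2
      have h5 := hA i hi1 hi2 t ht.1
      rw [quot, norm_div]
      calc ‖d i (s.sign * t)‖ / ‖(lam : ℂ) - d 0 (s.sign * t)‖ ≤
          (A * ((1 + ‖d 0 (s.sign * t)‖) * bracket t ^ ((i : ℝ) * ν s))) / (lam / 2) :=
            div_le_div₀ ((norm_nonneg _).trans h5) h5 (by positivity) hnorm
        _ = _ := by
          rw [mul_comm (i : ℝ), Real.rpow_mul (bracket_pos t).le, Real.rpow_natCast]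
          field_simp)
  refine ⟨hre, ?_, fun j hj1 hj2 => (key.1 j hj1 hj2).trans ?_, fun h => ?_⟩
  · refine (norm_sub_le _ _).trans ?_
    rw [Complex.norm_real, Real.norm_of_nonneg hlam.le]
    have := h1 t ht
    nlinarith
  · gcongr
    linarith
  · obtain ⟨D, hD, hDb⟩ := key.2 h
    refine ⟨D, hD, hDb.trans ?_⟩
    gcongr <;> linarith

end EndData

theorem integral_sign_mul (f : ℝ → ℂ) (s : Side) (t : ℝ) :
    ∫ u in (0 : ℝ)..(s.sign * t), f u = s.sign * ∫ u in (0 : ℝ)..t, f (s.sign * u) := by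
  have h0 : s.sign ≠ 0 := by cases s <;> simp [Side.sign]
  have h := intervalIntegral.integral_comp_mul_left (a := 0) (b := t) f h0
  rw [mul_zero] at h
  rw [h, Complex.real_smul, ← mul_assoc, ← Complex.ofReal_mul, mul_inv_cancel₀ h0]
  simp

theorem re_integral_sign_mul {f : ℝ → ℂ} (hf : Continuous f) (s : Side) (t : ℝ) :
    (∫ u in (0 : ℝ)..(s.sign * t), f u).re = ∫ u in (0 : ℝ)..t, s.sign * (f (s.sign * u)).re := by
  rw [integral_sign_mul, Complex.re_ofReal_mul, intervalIntegral.integral_const_mul]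
  congr 1
  have hc : Continuous fun u => f (s.sign * u) := by fun_prop
  exact (Complex.reCLM.intervalIntegral_comp_comm (hc.intervalIntegrable 0 t)).symm

theorem integral_le_of_eq_zero_beyond {e : ℝ → ℝ} (he : Continuous e) (h0 : ∀ t, 0 ≤ e t)
    {R t : ℝ} (hz : ∀ t, R ≤ t → e t = 0) :
    ∫ u in (0 : ℝ)..t, e u ≤ ∫ u in (0 : ℝ)..R, e u := by
  rcases le_total t R with h | h
  · have := intervalIntegral.integral_add_adjacent_intervals
      (he.intervalIntegrable (μ := volume) 0 t) (he.intervalIntegrable t R)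
    have := intervalIntegral.integral_nonneg (μ := volume) h (f := e) fun u _ => h0 u
    linarith
  · have h1 := intervalIntegral.integral_add_adjacent_intervals
      (he.intervalIntegrable (μ := volume) 0 R) (he.intervalIntegrable R t)
    have h2 : ∫ u in R..t, e u = 0 := by
      apply intervalIntegral.integral_zero_ae
      refine Eventually.of_forall fun u hu => hz u ?_
      rw [uIoc_of_le h] at hu
      exact hu.1.le
    linarith

/-! ### The real part of the phase -/

namespace EndData

variable {N : ℕ} {d : ℕ → ℝ → ℂ} {ν : Side → ℝ} {ε₁ ε₂ : ℝ} {s : Side} {R C c : ℝ}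

/-- The modulus of the ansatz is governed by the leading term of the phase. -/
theorem exists_eventually_phase_bounds (E : EndData N d (ν s) ε₁ s R C c) (hN : 1 ≤ N)
    (hε₂ : 0 < ε₂) (hbν : BoundedAt (d 0) s → ε₂ < 1 - ν s) (hc : ∀ i ≤ N, Continuous (d i))
    (hd : ∀ i < N, ∀ x, HasDerivAt (d i) (d (i + 1) x) x)
    (hU : ∀ᶠ lam : ℝ in atTop, ∀ x, (lam : ℂ) - d 0 x ∈ Complex.slitPlane) :
    ∃ c₀ K : ℝ, 0 < c₀ ∧ 0 < K ∧ ∀ᶠ lam : ℝ in atTop, ∀ t ∈ Icc 0 (delta (d 0) ν ε₁ ε₂ s lam),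
      c₀ * (∫ u in (0 : ℝ)..t, |imAlong (d 0) s u|) / Real.sqrt lam - K ≤
        (phase (d 0) N lam (s.sign * t)).re ∧
      (phase (d 0) N lam (s.sign * t)).re ≤
        K * (∫ u in (0 : ℝ)..t, |imAlong (d 0) s u|) / Real.sqrt lam + K ∧
      ‖phaseDeriv (d 0) N lam (s.sign * t)‖ ≤ K * Real.sqrt lam := by
  obtain ⟨B, hB1, hB⟩ := E.exists_eventually_wkb_bounds (ε₂ := ε₂) hN hε₂ hbν hc hd hU
  obtain ⟨M, rfl⟩ : ∃ M, N = M + 1 := ⟨N - 1, by omega⟩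
  have hB0 : 0 < B := by linarith
  have hcpos := E.c_pos
  have hR := E.one_le_R
  set y := imAlong (d 0) s with hy
  have hyc : Continuous y := E.cont_im
  -- The defect e vanishes beyond R, so its integral is bounded. Its first summand repairs a wrong
  -- sign of Im V near the origin, its second the points where |Im V| < c.
  set e : ℝ → ℝ := fun u => (|y u| - y u) + max 0 (1 - |y u| / c) with he
  have hec : Continuous e := by
    simp only [he]
    fun_prop
  have he0 : ∀ u, 0 ≤ e u := fun u =>
    add_nonneg (by linarith [le_abs_self (y u)]) (le_max_left _ _)
  have hez : ∀ u, R ≤ u → e u = 0 := by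
    intro u hu
    have h1 := E.im_ge u hu
    have h2 := E.abs_im hu
    simp only [he]
    rw [h2, sub_self, zero_add, max_eq_left]
    rw [sub_nonpos, one_le_div hcpos]
    exact h1
  -- With this κ the higher terms use up at most half of the lower coefficient 1/(2B) of the leading
  -- term, leaving 1/(4B).
  set κ := 1 / (4 * B * (1 + 1 / c)) with hκ
  have hκ0 : 0 < κ := by positivity
  have hκ1 : κ * (1 + 1 / c) = 1 / (4 * B) := by rw [hκ]; field_simp
  have hκle : κ ≤ 1 := by
    rw [hκ, div_le_one (by positivity)]
    have : 0 < 1 / c := by positivity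
    nlinarith
  have h4B : 1 / (4 * B) ≤ 1 := by
    rw [div_le_one (by positivity)]; linarith
  -- There are M = N - 1 terms with k ≥ 1, each at most B η (1 + |Im V|)/√λ; together they stay
  -- below κ (1 + |Im V|)/√λ.
  set η := κ / ((M + 1) * B) with hη
  have hη0 : 0 < η := by positivity
  set E₀ := ∫ u in (0 : ℝ)..R, e u with hE₀
  have hE₀0 : 0 ≤ E₀ := intervalIntegral.integral_nonneg (by linarith) fun u _ => he0 u
  have hlog : 0 ≤ Real.log (2 * B) := Real.log_nonneg (by linarith)
  refine ⟨1 / (4 * B), 2 + E₀ + Real.log (2 * B) + B * (1 + (M + 1) * (B + 2)), by positivity,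
    by positivity, ?_⟩
  obtain ⟨B', hB'0, hB'⟩ := E.exists_eventually_norm_le (ε₂ := ε₂)
  filter_upwards [hB, hU, eventually_ge_atTop 1, E.eventually_bracket_rpow_le_sqrt hN hε₂ hbν,
    E.eventually_weighted_norm_le hN hε₂ hbν hη0, (E.tendsto_delta hε₂).eventually_ge_atTop 1]
    with lam h1 h2 hlam1 h3 h4 hδ
  have hlam : 0 < lam := by linarith
  have hS1 : 1 ≤ Real.sqrt lam := by rwa [Real.one_le_sqrt]
  have hS := Real.sqrt_pos.2 hlam
  have hss := Real.mul_self_sqrt hlam.le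
  have hcw : ∀ j ≤ M + 1, Continuous (wkbTerm (d 0) lam j) := fun j hj =>
    continuous_wkbTerm hlam h2 hd hN hc hj
  -- q is the phase derivative without the term k = 0, which is integrated exactly.
  set q : ℝ → ℂ := fun x => wkbTerm (d 0) lam 0 x +
    ∑ j ∈ Finset.range M, wkbTerm (d 0) lam (j + 2) x with hq
  have hqc : Continuous q := (hcw 0 (by omega)).add (continuous_finsetSum _ fun j hj =>
    hcw (j + 2) (by have := Finset.mem_range.1 hj; omega))
  have hrest : ∀ u ∈ Icc 0 (delta (d 0) ν ε₁ ε₂ s lam),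
      ‖∑ j ∈ Finset.range M, wkbTerm (d 0) lam (j + 2) (s.sign * u)‖ ≤
        κ * (1 + |y u|) / Real.sqrt lam := by
    intro u hu
    have hμ := Real.rpow_pos_of_pos (bracket_pos u) (ν s)
    have hμS := h3 u hu
    have hw := h4 u hu
    have hterm : ∀ j ∈ Finset.range M, ‖wkbTerm (d 0) lam (j + 2) (s.sign * u)‖ ≤
        B * η * (1 + |y u|) / Real.sqrt lam := by
      intro j hj
      have hj := Finset.mem_range.1 hj
      refine ((h1 u hu).2.2.1 (j + 2) (by omega) (by omega)).trans ?_
      rw [show j + 2 - 1 = j + 1 by omega]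
      have h5 : (bracket u ^ ν s) ^ (j + 2) ≤ (bracket u ^ (2 * ν s)) * Real.sqrt lam ^ j := by
        rw [pow_add, mul_comm]
        have : bracket u ^ (2 * ν s) = (bracket u ^ ν s) ^ 2 := by
          rw [mul_comm, Real.rpow_mul (bracket_pos u).le]; norm_cast
        rw [this]
        gcongr
      calc B * ((1 + ‖d 0 (s.sign * u)‖) / lam * (bracket u ^ ν s) ^ (j + 2)) /
            Real.sqrt lam ^ (j + 1) ≤
          B * ((1 + ‖d 0 (s.sign * u)‖) / lam * (bracket u ^ (2 * ν s) * Real.sqrt lam ^ j)) /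
            Real.sqrt lam ^ (j + 1) := by gcongr
        _ = B * ((1 + ‖d 0 (s.sign * u)‖) * bracket u ^ (2 * ν s)) / lam / Real.sqrt lam := by
          rw [pow_succ]; field_simp
        _ ≤ B * (η * lam * (1 + |y u|)) / lam / Real.sqrt lam := by gcongr
        _ = _ := by field_simp
    calc ‖∑ j ∈ Finset.range M, wkbTerm (d 0) lam (j + 2) (s.sign * u)‖
        ≤ ∑ j ∈ Finset.range M, ‖wkbTerm (d 0) lam (j + 2) (s.sign * u)‖ := norm_sum_le _ _
      _ ≤ ∑ j ∈ Finset.range M, B * η * (1 + |y u|) / Real.sqrt lam := Finset.sum_le_sum hterm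
      _ = M * (B * η * (1 + |y u|) / Real.sqrt lam) := by simp
      _ ≤ (M + 1) * (B * η * (1 + |y u|) / Real.sqrt lam) := by
        gcongr
        linarith
      _ = κ * (1 + |y u|) / Real.sqrt lam := by
        rw [hη]; field_simp
  have hpoint : ∀ u ∈ Icc 0 (delta (d 0) ν ε₁ ε₂ s lam),
      (1 / (4 * B) * |y u| - e u) / Real.sqrt lam ≤ s.sign * (q (s.sign * u)).re ∧
      s.sign * (q (s.sign * u)).re ≤ (2 * |y u| + e u) / Real.sqrt lam := by
    intro u hu
    have hz := re_wkbTerm_zero_bounds hlam hB1 (h1 u hu).1 (h1 u hu).2.1 s.sign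
    have hyu : s.sign * (d 0 (s.sign * u)).im = y u := rfl
    rw [hyu] at hz
    have hr := (Complex.abs_re_le_norm _).trans (hrest u hu)
    have hsr : |s.sign * (∑ j ∈ Finset.range M, wkbTerm (d 0) lam (j + 2) (s.sign * u)).re| ≤
        κ * (1 + |y u|) / Real.sqrt lam := by
      rwa [abs_mul, s.abs_sign, one_mul]
    have hsum : s.sign * (q (s.sign * u)).re = s.sign * (wkbTerm (d 0) lam 0 (s.sign * u)).re +
        s.sign * (∑ j ∈ Finset.range M, wkbTerm (d 0) lam (j + 2) (s.sign * u)).re := by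
      simp only [hq, Complex.add_re]; ring
    have hkey : κ * (1 + |y u|) ≤ 1 / (4 * B) * |y u| + max 0 (1 - |y u| / c) := by
      have h5 : 1 ≤ |y u| / c + max 0 (1 - |y u| / c) := by
        linarith [le_max_right 0 (1 - |y u| / c)]
      have h6 : 0 ≤ max 0 (1 - |y u| / c) := le_max_left _ _
      have h7 : κ * (1 + |y u|) ≤ κ * (1 + 1 / c) * |y u| + κ * max 0 (1 - |y u| / c) := by
        have : κ * 1 ≤ κ * (|y u| / c + max 0 (1 - |y u| / c)) := by gcongr
        have e1 : κ * (|y u| / c) = κ * (1 / c) * |y u| := by ring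
        linarith
      rw [hκ1] at h7
      nlinarith
    have hkey' : κ * (1 + |y u|) / Real.sqrt lam ≤
        (1 / (4 * B) * |y u| + max 0 (1 - |y u| / c)) / Real.sqrt lam := by gcongr
    have habs := abs_le.1 hsr
    have habs0 := abs_le.1 hz.2
    rw [hsum]
    constructor
    · have e1 : (1 / (4 * B) * |y u| - e u) / Real.sqrt lam =
          (|y u| / (2 * B) - (|y u| - y u)) / Real.sqrt lam -
          (1 / (4 * B) * |y u| + max 0 (1 - |y u| / c)) / Real.sqrt lam := by
        simp only [he]; field_simp; ring
      linarith [hz.1, habs.1]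
    · have e2 : |y u| / Real.sqrt lam + (1 / (4 * B) * |y u| + max 0 (1 - |y u| / c)) /
          Real.sqrt lam ≤ (2 * |y u| + e u) / Real.sqrt lam := by
        rw [← add_div]
        refine div_le_div_of_nonneg_right ?_ hS.le
        have h5 := mul_le_mul_of_nonneg_right h4B (abs_nonneg (y u))
        have h6 := le_abs_self (y u)
        simp only [he]
        linarith
      linarith [habs0.2, habs.2]
  intro t ht
  have hIcc : ∀ u ∈ Icc 0 t, u ∈ Icc 0 (delta (d 0) ν ε₁ ε₂ s lam) := fun u hu =>
    ⟨hu.1, hu.2.trans ht.2⟩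
  have hphase : (phase (d 0) (M + 1) lam (s.sign * t)).re =
      (∫ u in (0 : ℝ)..t, s.sign * (q (s.sign * u)).re) +
        (∫ u in (0 : ℝ)..(s.sign * t), wkbTerm (d 0) lam 1 u).re := by
    have hqi : ∫ u in (0 : ℝ)..(s.sign * t), q u =
        (∫ u in (0 : ℝ)..(s.sign * t), wkbTerm (d 0) lam 0 u) + ∑ j ∈ Finset.range M,
          ∫ u in (0 : ℝ)..(s.sign * t), wkbTerm (d 0) lam (j + 2) u := by
      rw [intervalIntegral.integral_add ((hcw 0 (by omega)).intervalIntegrable _ _)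
      ((continuous_finsetSum _ fun j hj => hcw (j + 2) (by
        have := Finset.mem_range.1 hj; omega)).intervalIntegrable _ _),
      intervalIntegral.integral_finsetSum fun j hj => (hcw (j + 2) (by
        have := Finset.mem_range.1 hj; omega)).intervalIntegrable _ _]
    rw [← re_integral_sign_mul hqc, sum_integral_wkbTerm hlam h2 hd hN hc,
      Finset.sum_range_succ', Finset.sum_range_succ', hqi]
    simp only [Complex.add_re]
    ring
  have hzero : (0 : ℝ) ∈ Icc 0 (delta (d 0) ν ε₁ ε₂ s lam) := ⟨le_rfl, by linarith⟩
  have h0b := h1 0 hzero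
  rw [mul_zero] at h0b
  have hone := abs_le.1 (abs_re_integral_wkbTerm_one_le hlam h2 hd hN hc
    ((h1 t ht).1.trans (Complex.re_le_norm _)) (h1 t ht).2.1
    (h0b.1.trans (Complex.re_le_norm _)) h0b.2.1)
  have hEt := integral_le_of_eq_zero_beyond (t := t) hec he0 hez
  have hEt0 : 0 ≤ ∫ u in (0 : ℝ)..t, e u := intervalIntegral.integral_nonneg ht.1 fun u _ => he0 u
  have hEtS : (∫ u in (0 : ℝ)..t, e u) / Real.sqrt lam ≤ E₀ :=
    (div_le_self hEt0 hS1).trans hEt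
  have hY0 : 0 ≤ ∫ u in (0 : ℝ)..t, |y u| :=
    intervalIntegral.integral_nonneg ht.1 fun u _ => abs_nonneg _
  have hii : IntervalIntegrable (fun u => s.sign * (q (s.sign * u)).re) volume 0 t :=
    Continuous.intervalIntegrable (by fun_prop) _ _
  have hlower := intervalIntegral.integral_mono_on ht.1
    (Continuous.intervalIntegrable (μ := volume) (by fun_prop) 0 t) hii
    fun u hu => (hpoint u (hIcc u hu)).1
  have hupper := intervalIntegral.integral_mono_on ht.1 hii
    (Continuous.intervalIntegrable (μ := volume) (by fun_prop) 0 t)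
    fun u hu => (hpoint u (hIcc u hu)).2
  have il : ∫ u in (0 : ℝ)..t, (1 / (4 * B) * |y u| - e u) / Real.sqrt lam =
      1 / (4 * B) * (∫ u in (0 : ℝ)..t, |y u|) / Real.sqrt lam -
        (∫ u in (0 : ℝ)..t, e u) / Real.sqrt lam := by
    rw [intervalIntegral.integral_div, intervalIntegral.integral_sub
      (Continuous.intervalIntegrable (by fun_prop) _ _) (hec.intervalIntegrable _ _),
      intervalIntegral.integral_const_mul]
    ring
  have iu : ∫ u in (0 : ℝ)..t, (2 * |y u| + e u) / Real.sqrt lam =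
      2 * (∫ u in (0 : ℝ)..t, |y u|) / Real.sqrt lam +
        (∫ u in (0 : ℝ)..t, e u) / Real.sqrt lam := by
    rw [intervalIntegral.integral_div, intervalIntegral.integral_add
      (Continuous.intervalIntegrable (by fun_prop) _ _) (hec.intervalIntegrable _ _),
      intervalIntegral.integral_const_mul]
    ring
  rw [il] at hlower
  rw [iu] at hupper
  have hBM : 0 ≤ B * (1 + (M + 1) * (B + 2)) := by positivity
  rw [hphase]
  refine ⟨by linarith, ?_, ?_⟩
  · have : 2 * (∫ u in (0 : ℝ)..t, |y u|) / Real.sqrt lam ≤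
        (2 + E₀ + Real.log (2 * B) + B * (1 + (M + 1) * (B + 2))) *
          (∫ u in (0 : ℝ)..t, |y u|) / Real.sqrt lam := by
      gcongr
      linarith
    linarith
  · have hw0 : ‖wkbTerm (d 0) lam 0 (s.sign * t)‖ ≤ B * Real.sqrt lam := by
      refine abs_le_of_sq_le_sq' ?_ (by positivity) |>.2
      rw [norm_wkbTerm_zero_sq _ hlam, mul_pow, Real.sq_sqrt hlam.le]
      refine (h1 t ht).2.1.trans ?_
      have := mul_le_mul_of_nonneg_right hB1 (mul_nonneg hB0.le hlam.le)
      rw [sq, mul_assoc]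
      linarith
    have hρ : (1 + ‖d 0 (s.sign * t)‖) / lam ≤ B + 2 := by
      have h5 : ‖d 0 (s.sign * t)‖ ≤ lam + B * lam := by
        have h6 := norm_sub_le (lam : ℂ) ((lam : ℂ) - d 0 (s.sign * t))
        rw [sub_sub_cancel, Complex.norm_real, Real.norm_of_nonneg hlam.le] at h6
        linarith [(h1 t ht).2.1]
      rw [div_le_iff₀ hlam]
      nlinarith
    have hwj : ∀ j ∈ Finset.range (M + 1), ‖wkbTerm (d 0) lam (j + 1) (s.sign * t)‖ ≤
        B * (B + 2) * Real.sqrt lam := by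
      intro j hj
      have hj := Finset.mem_range.1 hj
      refine ((h1 t ht).2.2.1 (j + 1) (by omega) (by omega)).trans ?_
      rw [show j + 1 - 1 = j by omega]
      have hμ := Real.rpow_pos_of_pos (bracket_pos t) (ν s)
      have hμS := h3 t ht
      calc B * ((1 + ‖d 0 (s.sign * t)‖) / lam * (bracket t ^ ν s) ^ (j + 1)) /
            Real.sqrt lam ^ j
          ≤ B * ((B + 2) * Real.sqrt lam ^ (j + 1)) / Real.sqrt lam ^ j := by gcongr
        _ = _ := by rw [pow_succ]; field_simp
    rw [phaseDeriv, Finset.sum_range_succ']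
    have hsum : ‖∑ j ∈ Finset.range (M + 1), wkbTerm (d 0) lam (j + 1) (s.sign * t)‖ ≤
        (M + 1) * (B * (B + 2) * Real.sqrt lam) := by
      refine (norm_sum_le _ _).trans ((Finset.sum_le_sum hwj).trans (le_of_eq ?_))
      simp
    refine (norm_add_le _ _).trans ?_
    have h5 : 0 ≤ (2 + E₀ + Real.log (2 * B)) * Real.sqrt lam := by positivity
    have h6 : (2 + E₀ + Real.log (2 * B) + B * (1 + (M + 1) * (B + 2))) * Real.sqrt lam =
      (2 + E₀ + Real.log (2 * B)) * Real.sqrt lam +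
        ((M + 1) * (B * (B + 2) * Real.sqrt lam) + B * Real.sqrt lam) := by ring
    rw [h6]
    linarith

end EndData

/-! ### The pseudomode in the domain of the maximal operator -/

theorem contDiff_one_of_hasDerivAt {f f' : ℝ → ℂ} (h : ∀ x, HasDerivAt f (f' x) x)
    (hc : Continuous f') : ContDiff ℝ 1 f := by
  rw [contDiff_one_iff_deriv]
  refine ⟨fun x => (h x).differentiableAt, ?_⟩
  rwa [show deriv f = f' from funext fun x => (h x).deriv]

/-- Only V^{(N)} fails to be of class C¹, and absolute continuity survives sums and products. It is
this property, not mere differentiability almost everywhere, that permits the second integration by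
parts. -/
theorem locallyAC_phaseDeriv {d : ℕ → ℝ → ℂ} {N : ℕ} {lam : ℝ} (hlam : 0 < lam)
    (hU : ∀ x, (lam : ℂ) - d 0 x ∈ Complex.slitPlane)
    (hd : ∀ i < N, ∀ x, HasDerivAt (d i) (d (i + 1) x) x) (hN : 1 ≤ N)
    (hc : ∀ i ≤ N, Continuous (d i)) (hAC : LocallyAC (d N)) :
    LocallyAC (phaseDeriv (d 0) N lam) := by
  have hne := fun x => Complex.slitPlane_ne_zero (hU x)
  have hdAC : ∀ i ≤ N, LocallyAC (d i) := by
    intro i hi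
    rcases hi.lt_or_eq with h | rfl
    · exact (contDiff_one_of_hasDerivAt (hd i h) (hc (i + 1) h)).locallyAC
    · exact hAC
  have hd0 : ContDiff ℝ 1 (d 0) := contDiff_one_of_hasDerivAt (hd 0 hN) (hc 1 hN)
  have hUinv : LocallyAC fun x => 1 / ((lam : ℂ) - d 0 x) := by
    simp only [one_div]
    exact ((contDiff_const.sub hd0).inv hne).locallyAC
  have hw0 : ContDiff ℝ 1 (wkbTerm (d 0) lam 0) := by
    refine contDiff_one_of_hasDerivAt
      (fun x => hasDerivAt_wkbTerm_zero (hU x) (hd 0 hN x)) ?_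
    have h1 := continuous_wkbTerm hlam hU hd hN hc (j := 0) (by omega)
    have h2 : Continuous (quot d 1 lam) :=
      (Isobaric.gen (M := N) 1 le_rfl hN).continuous hne hc
    exact ((h1.mul h2).div_const 2).neg
  have hw : ∀ j ≤ N, LocallyAC (wkbTerm (d 0) lam j) := by
    intro j hj
    rcases Nat.eq_zero_or_pos j with rfl | hj0
    · exact hw0.locallyAC
    obtain ⟨c, G, hG, h⟩ := exists_isobaric_wkbTerm d N j hj0 hj
    have hQ : Isobaric d N j (fun lam x => c * quot d j lam x + G lam x) :=
      .add (.smul _ (.gen j hj0 hj)) (hG.mono (by omega))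
    have hinv : LocallyAC fun x => 1 / wkbTerm (d 0) lam 0 x ^ (j - 1) := by
      simp only [one_div]
      exact ((hw0.pow _).inv fun x =>
        pow_ne_zero _ (wkbTerm_zero_ne_zero hlam (hU x))).locallyAC
    have := (hQ.locallyAC hUinv hdAC).mul hinv
    simp only [mul_one_div] at this
    rwa [show wkbTerm (d 0) lam j = fun x => (c * quot d j lam x + G lam x) /
      wkbTerm (d 0) lam 0 x ^ (j - 1) from funext fun x => h lam hlam hU hd x]
  have hsum : ∀ M ≤ N + 1, LocallyAC fun x => ∑ j ∈ Finset.range M, wkbTerm (d 0) lam j x := by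
    intro M
    induction M with
    | zero => intro _; simpa using (contDiff_const : ContDiff ℝ 1 fun _ : ℝ => (0 : ℂ)).locallyAC
    | succ M ih =>
      intro hM
      simp only [Finset.sum_range_succ]
      exact (ih (by omega)).add (hw M (by omega))
  exact hsum (N + 1) le_rfl

theorem ae_hasDerivAt_phaseDeriv {d : ℕ → ℝ → ℂ} {N : ℕ} {lam : ℝ} (hlam : 0 < lam)
    (hU : ∀ x, (lam : ℂ) - d 0 x ∈ Complex.slitPlane)
    (hd : ∀ i < N, ∀ x, HasDerivAt (d i) (d (i + 1) x) x)
    (hdN : ∀ᵐ x, HasDerivAt (d N) (d (N + 1) x) x) :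
    ∀ᵐ x, HasDerivAt (phaseDeriv (d 0) N lam) (deriv (phaseDeriv (d 0) N lam) x) x := by
  filter_upwards [hdN] with x hx
  refine DifferentiableAt.hasDerivAt ?_
  unfold phaseDeriv
  refine DifferentiableAt.fun_sum fun j hj => ?_
  have hj := Finset.mem_range.1 hj
  refine differentiableAt_wkbTerm hlam hU hd (by omega) fun i hi => ?_
  rcases (show i ≤ N by omega).lt_or_eq with h | rfl
  · exact hd i h x
  · exact hx

/-- The function `(H_V - λ) f` for the pseudomode `f`. -/
noncomputable def residual (V : ℝ → ℂ) (N : ℕ) (ξ : ℝ → ℝ) (lam x : ℝ) : ℂ :=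
  (-((deriv (deriv ξ) x : ℝ) : ℂ) + 2 * ((deriv ξ x : ℝ) : ℂ) * phaseDeriv V N lam x +
    (ξ x : ℂ) * (deriv (phaseDeriv V N lam) x - phaseDeriv V N lam x ^ 2 + V x - lam)) *
    ansatz V N lam x

/-- f is of class C¹ with f' = (ξ' - ξ p) g locally absolutely continuous, so both derivatives can
be moved off the test function; the almost everywhere derivative of f' equals V f minus the claimed
image. -/
theorem isSchrodingerImage_pseudomode {d : ℕ → ℝ → ℂ} {N : ℕ} {lam : ℝ} (hlam : 0 < lam)
    (hU : ∀ x, (lam : ℂ) - d 0 x ∈ Complex.slitPlane)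
    (hd : ∀ i < N, ∀ x, HasDerivAt (d i) (d (i + 1) x) x) (hN : 1 ≤ N)
    (hc : ∀ i ≤ N, Continuous (d i)) (hAC : LocallyAC (d N))
    (hdN : ∀ᵐ x, HasDerivAt (d N) (d (N + 1) x) x) {ξ : ℝ → ℝ → ℝ}
    (hξ : IsTestFunction (ξ lam)) (hres : MemLp (residual (d 0) N (ξ lam) lam) 2 volume) :
    IsSchrodingerImage (d 0) (pseudomode (d 0) N ξ lam)
      (fun x => residual (d 0) N (ξ lam) lam x + lam * pseudomode (d 0) N ξ lam x) := by
  set g := ansatz (d 0) N lam with hg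
  set p := phaseDeriv (d 0) N lam with hp
  have hpc : Continuous p := continuous_phaseDeriv hlam hU hd hN hc
  have hg' : ∀ x, HasDerivAt g (-p x * g x) x := by
    intro x
    have h := (hasDerivAt_phase hlam hU hd hN hc x).neg.cexp
    have e : g = fun x => Complex.exp (-phase (d 0) N lam x) :=
      funext fun x => ansatz_eq_exp_phase hlam hU hd hN hc x
    rw [e]
    refine h.congr_deriv ?_
    simp only [Pi.neg_apply]
    ring
  have hgc : Continuous g := continuous_iff_continuousAt.2 fun x => (hg' x).continuousAt
  have hg1 : ContDiff ℝ 1 g := contDiff_one_of_hasDerivAt hg' (hpc.neg.mul hgc)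
  set f := pseudomode (d 0) N ξ lam with hf
  have hfx : ∀ x, f x = (ξ lam x : ℂ) * g x := fun x => rfl
  set f' : ℝ → ℂ := fun x => (((deriv (ξ lam) x : ℝ) : ℂ) + (-1) * ((ξ lam x : ℂ) * p x)) * g x with hf'
  have hξ' := hξ.deriv
  have hfd : ∀ x, HasDerivAt f (f' x) x := by
    intro x
    have h := (hξ.hasDerivAt x).ofReal_comp.mul (hg' x)
    refine h.congr_deriv ?_
    simp only [hf']
    ring
  have hf'AC : LocallyAC f' := by
    have hpAC := locallyAC_phaseDeriv hlam hU hd hN hc hAC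
    have hm1 : LocallyAC fun _ => (-1 : ℂ) :=
      (contDiff_const : ContDiff ℝ 1 fun _ : ℝ => (-1 : ℂ)).locallyAC
    exact (hξ'.contDiff_ofReal.locallyAC.add
      (hm1.mul (hξ.contDiff_ofReal.locallyAC.mul hpAC))).mul hg1.locallyAC
  have hfc : Continuous f := continuous_iff_continuousAt.2 fun x => (hfd x).continuousAt
  have hfcs : HasCompactSupport f := by
    have h1 : HasCompactSupport fun x => (ξ lam x : ℂ) := hξ.2.comp_left Complex.ofReal_zero
    exact h1.mul_right
  have hfAC : LocallyAC f := (contDiff_one_of_hasDerivAt hfd hf'AC.continuous).locallyAC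
  have hf2 : MemLp f 2 volume := hfc.memLp_of_hasCompactSupport hfcs
  have hVc : Continuous (d 0) := hc 0 (by omega)
  have hVf : Continuous fun x => d 0 x * f x := hVc.mul hfc
  set r := residual (d 0) N (ξ lam) lam with hr
  have hu2 : MemLp (fun x => r x + lam * f x) 2 volume := hres.add (hf2.const_mul _)
  have hli : LocallyIntegrable (fun x => d 0 x * f x - (r x + lam * f x)) volume :=
    hVf.locallyIntegrable.sub (hu2.locallyIntegrable (by norm_num))
  have hdd : ∀ᵐ x, HasDerivAt f' (d 0 x * f x - (r x + lam * f x)) x := by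
    filter_upwards [ae_hasDerivAt_phaseDeriv hlam hU hd hdN] with x hx
    have h := ((hξ'.hasDerivAt x).ofReal_comp.add
      (((hξ.hasDerivAt x).ofReal_comp.mul hx).const_mul (-1 : ℂ))).mul (hg' x)
    refine h.congr_deriv ?_
    simp only [hr, residual, hfx, Pi.add_apply, Pi.mul_apply]
    ring
  refine ⟨hf2, hu2, hVf.locallyIntegrable, fun φ hφ => ?_⟩
  have h1 := hf'AC.integral_deriv_smul hli hdd hφ
  have h2 := hfAC.integral_deriv_smul hf'AC.continuous.locallyIntegrable
    (Eventually.of_forall hfd) hφ.deriv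
  have e2 : iteratedDeriv 2 φ = deriv (deriv φ) := by
    rw [iteratedDeriv_succ, iteratedDeriv_one]
  rw [e2]
  have i1 := hφ.deriv.deriv.integrable_smul hfc.locallyIntegrable
  have i2 := hφ.integrable_smul hVf.locallyIntegrable
  have i3 := hφ.integrable_smul (hu2.locallyIntegrable (by norm_num))
  simp only [neg_smul]
  rw [integral_add (show Integrable (fun x => -(deriv (deriv φ) x • f x)) volume from i1.neg) i2,
    integral_neg, h2, h1]
  simp only [smul_sub]
  rw [integral_sub i2 i3]
  ring

/-! ### The rate of the regular remainder and integrals of Im V -/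

namespace EndData

variable {N : ℕ} {d : ℕ → ℝ → ℂ} {ν : Side → ℝ} {ε₁ ε₂ : ℝ} {s : Side} {R C c : ℝ}

theorem sqrt_pow_eq_rpow {lam : ℝ} (hlam : 0 ≤ lam) (k : ℕ) :
    Real.sqrt lam ^ k = lam ^ ((k : ℝ) / 2) := by
  rw [Real.sqrt_eq_rpow, ← Real.rpow_natCast, ← Real.rpow_mul hlam]
  congr 1
  ring

/-- The left side equals λ^{-(N+1)/2} (1 + |V|) ⟨t⟩^{(N+1)ν}. It remains to bound V by a constant or
by a multiple of λ, and ⟨t⟩ by 1 or by a multiple of δ according to the sign of ν. At an unbounded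
end with ν < 0 the supremum is kept. -/
theorem exists_eventually_le_sigmaRate (E : EndData N d (ν s) ε₁ s R C c) (hN : 1 ≤ N)
    (hε₂ : 0 < ε₂) :
    ∃ B, 0 < B ∧ ∀ᶠ lam : ℝ in atTop, ∀ t ∈ Ioo 0 (delta (d 0) ν ε₁ ε₂ s lam),
      (1 + ‖d 0 (s.sign * t)‖) / lam * (bracket t ^ ν s) ^ (N + 1) / Real.sqrt lam ^ (N - 1) ≤
        B * sigmaRate (d 0) N ν ε₁ ε₂ s lam := by
  have hform : ∀ {lam t : ℝ}, 0 < lam →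
      (1 + ‖d 0 (s.sign * t)‖) / lam * (bracket t ^ ν s) ^ (N + 1) / Real.sqrt lam ^ (N - 1) =
      lam ^ (-((N : ℝ) + 1) / 2) *
        ((1 + ‖d 0 (s.sign * t)‖) * bracket t ^ (((N : ℝ) + 1) * ν s)) := by
    intro lam t hlam
    have e1 : lam ^ (-((N : ℝ) + 1) / 2) = 1 / (lam * Real.sqrt lam ^ (N - 1)) := by
      rw [sqrt_pow_eq_rpow hlam.le, ← Real.rpow_one_add' hlam.le, one_div, ← Real.rpow_neg hlam.le]
      · congr 1
        push_cast [hN]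
        ring
      · have : (0 : ℝ) ≤ ((N - 1 : ℕ) : ℝ) := Nat.cast_nonneg _
        positivity
    have e2 : (bracket t ^ ν s) ^ (N + 1) = bracket t ^ (((N : ℝ) + 1) * ν s) := by
      rw [mul_comm, Real.rpow_mul (bracket_pos t).le, ← Nat.cast_succ, Real.rpow_natCast]
    rw [e1, e2]
    field_simp
  have hδ := E.tendsto_delta (ε₂ := ε₂) hε₂
  have hN0 : (0 : ℝ) ≤ (N : ℝ) + 1 := by positivity
  have hXδ : ∀ {lam t : ℝ}, 0 ≤ ν s → 1 ≤ delta (d 0) ν ε₁ ε₂ s lam →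
      t ∈ Ioo 0 (delta (d 0) ν ε₁ ε₂ s lam) → bracket t ^ (((N : ℝ) + 1) * ν s) ≤
        2 ^ (((N : ℝ) + 1) * ν s) * delta (d 0) ν ε₁ ε₂ s lam ^ (((N : ℝ) + 1) * ν s) := by
    intro lam t hν h1 ht
    rw [← Real.mul_rpow (by norm_num) (by linarith)]
    exact Real.rpow_le_rpow (bracket_pos t).le
      ((bracket_mono ht.1.le ht.2.le).trans (bracket_le_two_mul h1)) (by positivity)
  by_cases hb : BoundedAt (d 0) s
  · obtain ⟨M, hM0, hM⟩ := E.exists_norm_le_of_bounded hb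
    by_cases hν : ν s < 0
    · refine ⟨1 + M, by linarith, ?_⟩
      filter_upwards [eventually_gt_atTop 0] with lam hlam t ht
      rw [hform hlam, sigmaRate, if_pos hb, if_pos hν, mul_comm]
      have h1 : bracket t ^ (((N : ℝ) + 1) * ν s) ≤ 1 :=
        Real.rpow_le_one_of_one_le_of_nonpos (one_le_bracket t)
          (mul_nonpos_of_nonneg_of_nonpos hN0 hν.le)
      have h2 := hM t ht.1.le
      have h3 := Real.rpow_pos_of_pos (bracket_pos t) (((N : ℝ) + 1) * ν s)
      gcongr
      calc (1 + ‖d 0 (s.sign * t)‖) * bracket t ^ (((N : ℝ) + 1) * ν s) ≤ (1 + M) * 1 := by gcongr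
        _ = 1 + M := mul_one _
    · have hν := not_lt.1 hν
      refine ⟨(1 + M) * 2 ^ (((N : ℝ) + 1) * ν s), by positivity, ?_⟩
      filter_upwards [eventually_gt_atTop 0, hδ.eventually_ge_atTop 1] with lam hlam h1 t ht
      have h2 := hM t ht.1.le
      have h3 := hXδ hν h1 ht
      have h4 : lam ^ (-((N : ℝ) + 1) / 2 * (1 - (1 + ε₂) * ν s)) = lam ^ (-((N : ℝ) + 1) / 2) *
          delta (d 0) ν ε₁ ε₂ s lam ^ (((N : ℝ) + 1) * ν s) := by
        rw [delta, if_pos hb, ← Real.rpow_mul hlam.le, ← Real.rpow_add hlam]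
        congr 1
        ring
      rw [hform hlam, sigmaRate, if_pos hb, if_neg (not_lt.2 hν), h4]
      have h5 := (Real.rpow_pos_of_pos (bracket_pos t) (((N : ℝ) + 1) * ν s)).le
      calc lam ^ (-((N : ℝ) + 1) / 2) *
            ((1 + ‖d 0 (s.sign * t)‖) * bracket t ^ (((N : ℝ) + 1) * ν s))
          ≤ lam ^ (-((N : ℝ) + 1) / 2) * ((1 + M) * (2 ^ (((N : ℝ) + 1) * ν s) *
            delta (d 0) ν ε₁ ε₂ s lam ^ (((N : ℝ) + 1) * ν s))) := by gcongr
        _ = _ := by ring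
  · have hcpos := E.c_pos
    by_cases hν : ν s < 0
    · have := E.cont
      have hFc : Continuous fun t => ‖d 0 (s.sign * t)‖ * bracket t ^ (((N : ℝ) + 1) * ν s) :=
        (by fun_prop : Continuous fun t => ‖d 0 (s.sign * t)‖).mul (continuous_bracket_rpow _)
      have hFc' : Continuous fun t => (1 + ‖d 0 (s.sign * t)‖) *
          bracket t ^ (((N : ℝ) + 1) * ν s) :=
        (by fun_prop : Continuous fun t => 1 + ‖d 0 (s.sign * t)‖).mul (continuous_bracket_rpow _)
      obtain ⟨M, hM0, hM⟩ := exists_abs_le_on_Icc hFc' R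
      -- The supremum is at least the positive value v₀ at R, which controls the piece t ≤ R. Beyond
      -- R the bound |V| ≥ c absorbs the summand 1.
      set v₀ := ‖d 0 (s.sign * R)‖ * bracket R ^ (((N : ℝ) + 1) * ν s) with hv₀
      have hv₀pos : 0 < v₀ := mul_pos (norm_pos_iff.2 (E.ne_zero le_rfl))
        (Real.rpow_pos_of_pos (bracket_pos R) _)
      refine ⟨M / v₀ + (1 + 1 / c), by positivity, ?_⟩
      filter_upwards [eventually_gt_atTop 0, hδ.eventually_gt_atTop R] with lam hlam h1 t ht
      rw [hform hlam, sigmaRate, if_neg hb, if_pos hν]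
      set S := sSup ((fun x => ‖d 0 x‖ * bracket x ^ (((N : ℝ) + 1) * ν s)) ''
        halfInterval (d 0) ν ε₁ ε₂ s lam) with hS
      have hle : ∀ u ∈ Ioo 0 (delta (d 0) ν ε₁ ε₂ s lam),
          ‖d 0 (s.sign * u)‖ * bracket u ^ (((N : ℝ) + 1) * ν s) ≤ S := by
        intro u hu
        apply le_csSup
        · obtain ⟨L, _, hL⟩ := exists_abs_le_on_Icc hFc (delta (d 0) ν ε₁ ε₂ s lam)
          refine ⟨L, ?_⟩
          rintro _ ⟨x, hx, rfl⟩
          have h2 := (s.mem_halfLine_iff x).1 hx.1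
          have h3 : x = s.sign * (s.sign * x) := by rw [← mul_assoc, s.sign_mul_self, one_mul]
          have h4 : |x| = s.sign * x := by
            rw [← abs_of_pos h2, abs_mul, s.abs_sign, one_mul]
          have h5 := (le_abs_self _).trans (hL (s.sign * x) ⟨h2.le, h4 ▸ hx.2.le⟩)
          rw [← h3, bracket_sign_mul] at h5
          exact h5
        · refine ⟨s.sign * u, ⟨?_, ?_⟩, ?_⟩
          · rw [s.mem_halfLine_iff, ← mul_assoc, s.sign_mul_self, one_mul]
            exact hu.1
          · rw [abs_mul, s.abs_sign, one_mul, abs_of_pos hu.1]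
            exact hu.2
          · simp only [bracket_sign_mul]
      have hR0 : 0 < R := by linarith [E.one_le_R]
      have hSv : v₀ ≤ S := hle R ⟨hR0, h1⟩
      have hS0 : 0 < S := hv₀pos.trans_le hSv
      have key : (1 + ‖d 0 (s.sign * t)‖) * bracket t ^ (((N : ℝ) + 1) * ν s) ≤
          (M / v₀ + (1 + 1 / c)) * S := by
        have hX := Real.rpow_pos_of_pos (bracket_pos t) (((N : ℝ) + 1) * ν s)
        rcases le_total t R with h | h
        · have h2 := (le_abs_self _).trans (hM t ⟨ht.1.le, h⟩)
          have h3 : M ≤ M / v₀ * S := by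
            rw [div_mul_eq_mul_div, le_div_iff₀ hv₀pos]
            gcongr
          have h4 : 0 ≤ (1 + 1 / c) * S := by positivity
          linarith
        · have h2 : c ≤ ‖d 0 (s.sign * t)‖ := by
            refine (E.im_ge t h).trans ((le_abs_self _).trans ?_)
            rw [abs_imAlong]
            exact Complex.abs_im_le_norm _
          have h3 : 1 + ‖d 0 (s.sign * t)‖ ≤ (1 + 1 / c) * ‖d 0 (s.sign * t)‖ := by
            have : 1 ≤ 1 / c * ‖d 0 (s.sign * t)‖ := by
              rw [one_div_mul_eq_div, one_le_div hcpos]; exact h2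
            linarith
          calc (1 + ‖d 0 (s.sign * t)‖) * bracket t ^ (((N : ℝ) + 1) * ν s)
              ≤ (1 + 1 / c) * ‖d 0 (s.sign * t)‖ * bracket t ^ (((N : ℝ) + 1) * ν s) := by gcongr
            _ = (1 + 1 / c) * (‖d 0 (s.sign * t)‖ * bracket t ^ (((N : ℝ) + 1) * ν s)) := by ring
            _ ≤ (1 + 1 / c) * S := by
              have := hle t ht
              gcongr
            _ ≤ (M / v₀ + (1 + 1 / c)) * S := by
              refine mul_le_mul_of_nonneg_right ?_ hS0.le
              have : 0 ≤ M / v₀ := by positivity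
              linarith
      calc lam ^ (-((N : ℝ) + 1) / 2) *
            ((1 + ‖d 0 (s.sign * t)‖) * bracket t ^ (((N : ℝ) + 1) * ν s))
          ≤ lam ^ (-((N : ℝ) + 1) / 2) * ((M / v₀ + (1 + 1 / c)) * S) := by gcongr
        _ = _ := by ring
    · have hν := not_lt.1 hν
      obtain ⟨B, hB0, hB⟩ := E.exists_eventually_norm_le (ε₂ := ε₂)
      refine ⟨(1 + B) * 2 ^ (((N : ℝ) + 1) * ν s), by positivity, ?_⟩
      filter_upwards [eventually_ge_atTop 1, hδ.eventually_ge_atTop 1, hB] with lam hlam1 h1 h2 t ht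
      have hlam : 0 < lam := by linarith
      have h3 := hXδ hν h1 ht
      have h4 := h2 t ⟨ht.1.le, ht.2.le⟩
      have h5 := (Real.rpow_pos_of_pos (bracket_pos t) (((N : ℝ) + 1) * ν s)).le
      have h6 : lam ^ ((1 - (N : ℝ)) / 2) = lam ^ (-((N : ℝ) + 1) / 2) * lam := by
        rw [← Real.rpow_add_one hlam.ne']
        congr 1
        ring
      rw [hform hlam, sigmaRate, if_neg hb, if_neg (not_lt.2 hν), h6]
      calc lam ^ (-((N : ℝ) + 1) / 2) *
            ((1 + ‖d 0 (s.sign * t)‖) * bracket t ^ (((N : ℝ) + 1) * ν s))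
          ≤ lam ^ (-((N : ℝ) + 1) / 2) * (((1 + B) * lam) * (2 ^ (((N : ℝ) + 1) * ν s) *
            delta (d 0) ν ε₁ ε₂ s lam ^ (((N : ℝ) + 1) * ν s))) := by
            gcongr
            linarith
        _ = _ := by ring

theorem sigmaRate_nonneg (V : ℝ → ℂ) (n : ℕ) (ν : Side → ℝ) (ε₁ ε₂ : ℝ) (s : Side) {lam : ℝ}
    (hlam : 0 ≤ lam) (hδ : 0 ≤ delta V ν ε₁ ε₂ s lam) : 0 ≤ sigmaRate V n ν ε₁ ε₂ s lam := by
  unfold sigmaRate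
  split_ifs
  · positivity
  · positivity
  · refine mul_nonneg (by positivity) (Real.sSup_nonneg ?_)
    rintro _ ⟨x, _, rfl⟩
    exact mul_nonneg (norm_nonneg _) (Real.rpow_nonneg (bracket_pos x).le _)
  · positivity

theorem exists_le_integral_im (E : EndData N d (ν s) ε₁ s R C c) {g' : ℝ} (hg : 0 ≤ g')
    (hlow : (fun x => |x| ^ g') =O[s.filter] (fun x => (d 0 x).im)) :
    ∃ c₁ c₂ : ℝ, 0 < c₁ ∧ 0 < c₂ ∧ ∀ t, 0 ≤ t →
      c₁ * t ^ (g' + 1) - c₂ ≤ ∫ u in (0 : ℝ)..t, |imAlong (d 0) s u| := by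
  obtain ⟨K, hK0, hK⟩ := hlow.exists_pos
  have h1 := s.tendsto_sign_mul.eventually hK.bound
  obtain ⟨T, hT⟩ := eventually_atTop.1 (h1.and (eventually_ge_atTop 1))
  set T' := max T 1 with hT'
  have hT1 : 1 ≤ T' := le_max_right _ _
  have hb : ∀ u, T' ≤ u → 1 / K * u ^ g' ≤ |imAlong (d 0) s u| := by
    intro u hu
    have h2 := (hT u ((le_max_left _ _).trans hu)).1
    have hu0 : 0 < u := by linarith
    rw [abs_mul, s.abs_sign, one_mul, abs_of_pos hu0, Real.norm_of_nonneg (by positivity),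
      Real.norm_eq_abs, ← abs_imAlong] at h2
    rw [one_div_mul_eq_div, div_le_iff₀ hK0]
    linarith
  have hy : Continuous fun u => |imAlong (d 0) s u| := E.cont_im.abs
  have hg1 : 0 < g' + 1 := by linarith
  refine ⟨1 / (K * (g' + 1)), 1 / (K * (g' + 1)) * T' ^ (g' + 1), by positivity, by positivity,
    fun t ht => ?_⟩
  rcases le_total t T' with h | h
  · have h3 : t ^ (g' + 1) ≤ T' ^ (g' + 1) := Real.rpow_le_rpow ht h hg1.le
    have h4 : 0 ≤ ∫ u in (0 : ℝ)..t, |imAlong (d 0) s u| :=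
      intervalIntegral.integral_nonneg ht fun _ _ => abs_nonneg _
    have : 1 / (K * (g' + 1)) * t ^ (g' + 1) ≤ 1 / (K * (g' + 1)) * T' ^ (g' + 1) := by gcongr
    linarith
  · have h3 : ∫ u in T'..t, 1 / K * u ^ g' ≤ ∫ u in T'..t, |imAlong (d 0) s u| := by
      refine intervalIntegral.integral_mono_on h ?_ (hy.intervalIntegrable _ _)
        fun u hu => hb u hu.1
      exact (intervalIntegral.intervalIntegrable_rpow' (by linarith)).const_mul _
    have h4 : 0 ≤ ∫ u in (0 : ℝ)..T', |imAlong (d 0) s u| :=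
      intervalIntegral.integral_nonneg (by linarith) fun _ _ => abs_nonneg _
    have h5 := intervalIntegral.integral_add_adjacent_intervals
      (hy.intervalIntegrable (μ := volume) 0 T') (hy.intervalIntegrable T' t)
    rw [intervalIntegral.integral_const_mul, integral_rpow (Or.inl (by linarith))] at h3
    have e : 1 / K * ((t ^ (g' + 1) - T' ^ (g' + 1)) / (g' + 1)) =
      1 / (K * (g' + 1)) * t ^ (g' + 1) - 1 / (K * (g' + 1)) * T' ^ (g' + 1) := by
      field_simp
    linarith

theorem exists_im_le_rpow {γ : ℝ}
    (hup : (fun x => (d 0 x).im) =O[s.filter] (fun x => |x| ^ γ)) :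
    ∃ K, 0 < K ∧ ∀ᶠ t in atTop, |imAlong (d 0) s t| ≤ K * t ^ γ := by
  obtain ⟨K, hK0, hK⟩ := hup.exists_pos
  refine ⟨K, hK0, ?_⟩
  filter_upwards [s.tendsto_sign_mul.eventually hK.bound, eventually_gt_atTop 0] with t h1 h2
  rw [abs_mul, s.abs_sign, one_mul, abs_of_pos h2, Real.norm_of_nonneg
    (Real.rpow_nonneg h2.le _), Real.norm_eq_abs, ← abs_imAlong] at h1
  exact h1

theorem exists_integral_im_le (E : EndData N d (ν s) ε₁ s R C c) {γ K : ℝ} (hγ : 0 ≤ γ)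
    (hK : 0 < K) (hup : ∀ᶠ t in atTop, |imAlong (d 0) s t| ≤ K * t ^ γ) :
    ∃ L : ℝ, 0 < L ∧ ∀ t, 0 ≤ t →
      ∫ u in (0 : ℝ)..t, |imAlong (d 0) s u| ≤ L * t + K * t ^ (γ + 1) := by
  obtain ⟨T, hT⟩ := eventually_atTop.1 hup
  obtain ⟨L, hL0, hL⟩ := exists_abs_le_on_Icc E.cont_im T
  have hy : Continuous fun u => |imAlong (d 0) s u| := E.cont_im.abs
  refine ⟨L, hL0, fun t ht => ?_⟩
  have h : ∫ u in (0 : ℝ)..t, |imAlong (d 0) s u| ≤ ∫ _ in (0 : ℝ)..t, (L + K * t ^ γ) := by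
    refine intervalIntegral.integral_mono_on ht (hy.intervalIntegrable _ _) (by simp)
      fun u hu => ?_
    rcases le_total u T with h | h
    · have := hL u ⟨hu.1, h⟩
      have : 0 ≤ K * t ^ γ := by positivity
      linarith
    · have h1 := hT u h
      have : K * u ^ γ ≤ K * t ^ γ := by
        have := Real.rpow_le_rpow hu.1 hu.2 hγ
        gcongr
      linarith
  refine h.trans (le_of_eq ?_)
  rw [intervalIntegral.integral_const, smul_eq_mul, sub_zero,
    Real.rpow_add_one' ht (by linarith)]
  ring

end EndData

/-! ### A scaled Gaussian-type weight -/

/-- The profile that dominates the weighted ansatz after rescaling. -/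
noncomputable def profile (a c p v : ℝ) : ℝ := bracket v ^ a * Real.exp (-(c * |v| ^ p))

theorem continuous_profile {a c p : ℝ} (hp : 0 < p) : Continuous (profile a c p) := by
  unfold profile
  refine (continuous_bracket_rpow a).mul (Real.continuous_exp.comp ?_)
  exact (continuous_const.mul (continuous_abs.rpow_const fun x => Or.inr hp.le)).neg

/-- One more power of the bracket still leaves a bounded function, so the profile is O(⟨v⟩^{-1}),
which is square integrable. -/
theorem memLp_profile {a c p : ℝ} (ha : 0 ≤ a) (hc : 0 < c) (hp : 1 ≤ p) :
    MemLp (profile a c p) 2 volume := by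
  have hcont := continuous_profile (a := a) (c := c) (show 0 < p by linarith)
  have hbd : ∃ K, 0 < K ∧ ∀ v, |profile a c p v| ≤ K * bracket v ^ (-1 : ℝ) := by
    have h1 := (isLittleO_rpow_exp_pos_mul_atTop (a + 1) hc).def one_pos
    obtain ⟨T, hT⟩ := eventually_atTop.1 (h1.and (eventually_ge_atTop 1))
    obtain ⟨M, hM0, hM⟩ := exists_abs_le_on_Icc (g := fun v => profile (a + 1) c p v)
      (continuous_profile (by linarith)) (max T 1)
    refine ⟨M + 2 ^ (a + 1), by positivity, fun v => ?_⟩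
    have hX := bracket_pos v
    have key : profile (a + 1) c p |v| ≤ M + 2 ^ (a + 1) := by
      rcases le_total |v| (max T 1) with h | h
      · have := (le_abs_self _).trans (hM |v| ⟨abs_nonneg v, h⟩)
        have : (0 : ℝ) ≤ 2 ^ (a + 1) := by positivity
        linarith
      · have h2 := (hT |v| ((le_max_left _ _).trans h)).1
        have hv1 : 1 ≤ |v| := (le_max_right _ _).trans h
        rw [Real.norm_of_nonneg (by positivity), Real.norm_of_nonneg (Real.exp_pos _).le,
          one_mul] at h2
        have h3 : |v| ≤ |v| ^ p := by
          calc |v| = |v| ^ (1 : ℝ) := (Real.rpow_one _).symm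
            _ ≤ |v| ^ p := Real.rpow_le_rpow_of_exponent_le hv1 hp
        unfold profile
        rw [abs_abs]
        calc bracket |v| ^ (a + 1) * Real.exp (-(c * |v| ^ p))
            ≤ (2 * |v|) ^ (a + 1) * Real.exp (-(c * |v|)) := by
              have := bracket_le_two_mul hv1
              have := (bracket_pos |v|).le
              gcongr
          _ = 2 ^ (a + 1) * (|v| ^ (a + 1) * Real.exp (-(c * |v|))) := by
              rw [Real.mul_rpow (by norm_num) (abs_nonneg v)]; ring
          _ ≤ 2 ^ (a + 1) * (Real.exp (c * |v|) * Real.exp (-(c * |v|))) := by gcongr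
          _ = 2 ^ (a + 1) := by rw [← Real.exp_add, add_neg_cancel, Real.exp_zero, mul_one]
          _ ≤ _ := by linarith
    have e : profile a c p v = profile (a + 1) c p |v| * bracket v ^ (-1 : ℝ) := by
      have hb : bracket |v| = bracket v := by rw [bracket, bracket, sq_abs]
      unfold profile
      rw [abs_abs, hb, mul_right_comm, ← Real.rpow_add hX]
      congr 2
      ring
    rw [e, abs_of_nonneg (by
      unfold profile
      have := (bracket_pos |v|)
      positivity)]
    gcongr
  obtain ⟨K, hK0, hK⟩ := hbd
  rw [memLp_two_iff_integrable_sq hcont.aestronglyMeasurable]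
  refine Integrable.mono' (integrable_inv_one_add_sq.const_mul (K ^ 2))
    (hcont.pow 2).aestronglyMeasurable (Eventually.of_forall fun v => ?_)
  have h1 := hK v
  rw [Real.norm_of_nonneg (sq_nonneg _), ← sq_abs]
  calc |profile a c p v| ^ 2 ≤ (K * bracket v ^ (-1 : ℝ)) ^ 2 := by gcongr
    _ = K ^ 2 * (1 + v ^ 2)⁻¹ := by
      rw [mul_pow, Real.rpow_neg_one, inv_pow, bracket, Real.sq_sqrt (by positivity)]

theorem eLpNorm_comp_inv_mul {W : ℝ → ℝ} (hW : Continuous W) {m : ℝ} (hm : 0 < m) :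
    eLpNorm (fun x => W (m⁻¹ * x)) 2 volume =
      ENNReal.ofReal (m ^ (1 / 2 : ℝ)) * eLpNorm W 2 volume := by
  have h := eLpNorm_map_measure (μ := volume) (p := 2) (f := fun x : ℝ => m⁻¹ * x) (g := W)
    hW.aestronglyMeasurable (by fun_prop)
  have e : (fun x => W (m⁻¹ * x)) = W ∘ fun x => m⁻¹ * x := rfl
  rw [e, ← h, Real.map_volume_mul_left (inv_ne_zero hm.ne'), inv_inv, abs_of_pos hm,
    eLpNorm_smul_measure_of_ne_top (by norm_num)]
  rw [smul_eq_mul, ENNReal.ofReal_rpow_of_pos hm]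
  norm_num

/-! ### Cut-offs -/

theorem exists_iteratedDeriv_smoothTransition_le (j : ℕ) (hj : 1 ≤ j) :
    ∃ M : ℝ, 0 < M ∧ ∀ x, |iteratedDeriv j Real.smoothTransition x| ≤ M := by
  have hc : Continuous (iteratedDeriv j Real.smoothTransition) :=
    (Real.smoothTransition.contDiff (n := j)).continuous_iteratedDeriv j le_rfl
  obtain ⟨M, hM0, hM⟩ := exists_abs_le_on_Icc hc 1
  refine ⟨M, hM0, fun x => ?_⟩
  have hzero : ∀ {a : ℝ}, Real.smoothTransition =ᶠ[𝓝 x] (fun _ => a) →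
      |iteratedDeriv j Real.smoothTransition x| ≤ M := by
    intro a h
    rw [h.iteratedDeriv_eq, iteratedDeriv_const, if_neg (by omega), abs_zero]
    exact hM0.le
  rcases lt_or_ge x 0 with h | h
  · exact hzero (a := 0) (by
      filter_upwards [Iio_mem_nhds h] with y hy
      exact Real.smoothTransition.zero_of_nonpos hy.le)
  rcases le_or_gt x 1 with h1 | h1
  · exact hM x ⟨h, h1⟩
  · exact hzero (a := 1) (by
      filter_upwards [Ioi_mem_nhds h1] with y hy
      exact Real.smoothTransition.one_of_one_le hy.le)

theorem iteratedDeriv_comp_affine {f : ℝ → ℝ} (hf : ContDiff ℝ ∞ f) (a b : ℝ) (n : ℕ) :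
    iteratedDeriv n (fun y => f (a * y + b)) = fun x => a ^ n * iteratedDeriv n f (a * x + b) := by
  induction n with
  | zero => simp
  | succ n ih =>
    rw [iteratedDeriv_succ, ih]
    ext x
    have h1 : HasDerivAt (iteratedDeriv n f) (iteratedDeriv (n + 1) f (a * x + b)) (a * x + b) := by
      rw [iteratedDeriv_succ]
      exact (hf.differentiable_iteratedDeriv n
        (by exact_mod_cast ENat.natCast_lt_top n)).differentiableAt.hasDerivAt
    have h2 : HasDerivAt (fun x => a * x + b) a x := by
      simpa using ((hasDerivAt_id x).const_mul a).add_const b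
    refine ((h1.comp x h2).const_mul (a ^ n)).deriv.trans ?_
    ring

/-- A product of two rescaled smooth steps. Because Δ < δ, each factor is identically 1 on the
opposite half-line, so on each side the derivatives are those of a single step; this makes C
independent of δ and Δ. -/
theorem exists_isCutoff : ∃ C : ℝ, ∀ δ Δ : Side → ℝ, (∀ s, 0 < Δ s ∧ Δ s ≤ δ s / 4) →
    ∃ ξ : ℝ → ℝ, IsCutoff δ Δ C ξ := by
  obtain ⟨M₁, hM₁, h1⟩ := exists_iteratedDeriv_smoothTransition_le 1 le_rfl
  obtain ⟨M₂, hM₂, h2⟩ := exists_iteratedDeriv_smoothTransition_le 2 one_le_two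
  refine ⟨M₁ + M₂, fun δ Δ h => ?_⟩
  have hδ : ∀ s, Δ s < δ s := fun s => by linarith [(h s).1, (h s).2]
  set χ : Side → ℝ → ℝ := fun s x => Real.smoothTransition ((-s.sign / Δ s) * x + δ s / Δ s)
    with hχ
  have harg : ∀ s x, (-s.sign / Δ s) * x + δ s / Δ s = (δ s - s.sign * x) / Δ s := by
    intro s x; ring
  have hχ1 : ∀ s x, s.sign * x ≤ δ s - Δ s → χ s x = 1 := by
    intro s x hx
    refine Real.smoothTransition.one_of_one_le ?_
    rw [harg, one_le_div (h s).1]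
    linarith
  have hχ0 : ∀ s x, δ s ≤ s.sign * x → χ s x = 0 := by
    intro s x hx
    refine Real.smoothTransition.zero_of_nonpos ?_
    rw [harg]
    exact div_nonpos_of_nonpos_of_nonneg (by linarith) (h s).1.le
  have hsm : ∀ s, ContDiff ℝ ∞ (χ s) := fun s =>
    Real.smoothTransition.contDiff.comp ((contDiff_const.mul contDiff_id).add contDiff_const)
  have hzero : ∀ x, x ∉ Ioo (-δ .minus) (δ .plus) → χ .minus x * χ .plus x = 0 := by
    intro x hx
    rw [mem_Ioo, not_and_or, not_lt, not_lt] at hx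
    rcases hx with hx | hx
    · rw [hχ0 .minus x (by simp only [Side.sign]; linarith), zero_mul]
    · rw [hχ0 .plus x (by simp only [Side.sign]; linarith), mul_zero]
  refine ⟨fun x => χ .minus x * χ .plus x, (hsm _).mul (hsm _), ?_, ?_, ?_, ?_, hzero, ?_⟩
  · exact HasCompactSupport.intro (isCompact_Icc (a := -δ .minus) (b := δ .plus))
      fun x hx => hzero x fun hx' => hx (Ioo_subset_Icc_self hx')
  · exact fun x => mul_nonneg (Real.smoothTransition.nonneg _) (Real.smoothTransition.nonneg _)
  · exact fun x => mul_le_one₀ (Real.smoothTransition.le_one _) (Real.smoothTransition.nonneg _)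
      (Real.smoothTransition.le_one _)
  · intro x hx
    rw [hχ1 .minus x (by simp only [Side.sign]; linarith [hx.1]),
      hχ1 .plus x (by simp only [Side.sign]; linarith [hx.2]), one_mul]
  · intro s j hj x hx
    have he : (fun x => χ .minus x * χ .plus x) =ᶠ[𝓝 x] χ s := by
      cases s with
      | minus =>
        filter_upwards [Iio_mem_nhds hx] with y hy
        rw [hχ1 .plus y, mul_one]
        simp only [Side.sign]
        linarith [hδ .plus, mem_Iio.1 hy]
      | plus =>
        filter_upwards [Ioi_mem_nhds hx] with y hy
        rw [hχ1 .minus y, one_mul]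
        simp only [Side.sign]
        linarith [hδ .minus, mem_Ioi.1 hy]
    rw [he.iteratedDeriv_eq, iteratedDeriv_comp_affine Real.smoothTransition.contDiff, abs_mul,
      abs_pow, abs_div, abs_neg, s.abs_sign, abs_of_pos (h s).1, one_div, inv_pow, mul_comm]
    have hΔ := (h s).1
    gcongr
    have : j = 1 ∨ j = 2 := by have := Finset.mem_Icc.1 hj; omega
    rcases this with rfl | rfl
    · exact (h1 _).trans (by linarith)
    · exact (h2 _).trans (by linarith)

namespace IsCutoff

variable {δ Δ : Side → ℝ} {C : ℝ} {ξ : ℝ → ℝ}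

theorem apply_eq_zero (h : IsCutoff δ Δ C ξ) {s : Side} {t : ℝ} (ht : δ s ≤ t) :
    ξ (s.sign * t) = 0 := by
  refine h.eq_zero _ fun hx => ?_
  cases s <;> simp only [Side.sign] at hx <;> linarith [hx.1, hx.2]

theorem eventuallyEq_one (h : IsCutoff δ Δ C ξ) (hδ : ∀ s, Δ s < δ s) {s : Side} {t : ℝ}
    (ht0 : 0 ≤ t) (ht : t < δ s - Δ s) : ξ =ᶠ[𝓝 (s.sign * t)] fun _ => 1 := by
  filter_upwards [Ioo_mem_nhds (a := -δ .minus + Δ .minus) (b := δ .plus - Δ .plus)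
    (x := s.sign * t)
    (by cases s <;> simp only [Side.sign] <;> linarith [hδ .minus])
    (by cases s <;> simp only [Side.sign] <;> linarith [hδ .plus])] with y hy
  exact h.eq_one y hy

theorem eventuallyEq_zero (h : IsCutoff δ Δ C ξ) {s : Side} {t : ℝ} (ht : δ s < t) :
    ξ =ᶠ[𝓝 (s.sign * t)] fun _ => 0 := by
  have hc : Tendsto (fun y => s.sign * y) (𝓝 (s.sign * t)) (𝓝 t) := by
    have : Continuous fun y => s.sign * y := by fun_prop
    have h1 := this.tendsto (s.sign * t)
    rwa [← mul_assoc, s.sign_mul_self, one_mul] at h1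
  filter_upwards [hc.eventually (lt_mem_nhds ht)] with y hy
  have := h.apply_eq_zero (s := s) hy.le
  rwa [← mul_assoc, s.sign_mul_self, one_mul] at this

theorem deriv_eq_zero_of_eventuallyEq {x a : ℝ} (h : ξ =ᶠ[𝓝 x] fun _ => a) :
    deriv ξ x = 0 ∧ deriv (deriv ξ) x = 0 := by
  have h1 := h.deriv
  refine ⟨by rw [h.deriv_eq, deriv_const], ?_⟩
  rw [h1.deriv_eq]
  simp

theorem abs_deriv_le (h : IsCutoff δ Δ C ξ) {s : Side} {t : ℝ} (ht : 0 < t) :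
    |deriv ξ (s.sign * t)| ≤ C * (Δ s)⁻¹ ∧ |deriv (deriv ξ) (s.sign * t)| ≤ C * (Δ s)⁻¹ ^ 2 := by
  have hx : s.sign * t ∈ s.halfLine := by
    rwa [s.mem_halfLine_iff, ← mul_assoc, s.sign_mul_self, one_mul]
  have h1 := h.deriv_bound s 1 (by simp) _ hx
  have h2 := h.deriv_bound s 2 (by simp) _ hx
  rw [iteratedDeriv_one, pow_one] at h1
  rw [iteratedDeriv_succ, iteratedDeriv_one, ← inv_pow] at h2
  exact ⟨h1, h2⟩

end IsCutoff

/-! ### Pointwise bounds on the residual and the pseudomode -/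

namespace EndData

variable {N : ℕ} {d : ℕ → ℝ → ℂ} {ν : Side → ℝ} {ε₁ ε₂ : ℝ} {s : Side} {R C c : ℝ}

set_option maxHeartbeats 800000 in
-- The terms with ξ' and ξ'' vanish for t < δ - Δ. For δ - Δ ≤ t ≤ δ their coefficients are O(λ),
-- since Δ^{-1} and the phase derivative are O(√λ), while |g| is exponentially small there. The
-- Riccati remainder multiplies f itself.
theorem exists_eventually_residual_le (E : EndData N d (ν s) ε₁ s R C c) (hN : 1 ≤ N)
    (hε₂ : 0 < ε₂) (hbν : BoundedAt (d 0) s → ε₂ < 1 - ν s) (hc : ∀ i ≤ N, Continuous (d i))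
    (hd : ∀ i < N, ∀ x, HasDerivAt (d i) (d (i + 1) x) x)
    (hU : ∀ᶠ lam : ℝ in atTop, ∀ x, (lam : ℂ) - d 0 x ∈ Complex.slitPlane)
    (hΔ : ∀ᶠ lam : ℝ in atTop, ∀ s, Delta (d 0) ν ε₁ ε₂ s lam < delta (d 0) ν ε₁ ε₂ s lam)
    {ξ : ℝ → ℝ → ℝ} (hξ : IsCutoffFamily (d 0) ν ε₁ ε₂ ξ) :
    ∃ A c₁ : ℝ, 0 < A ∧ 0 < c₁ ∧ ∀ᶠ lam : ℝ in atTop, ∀ t, 0 < t →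
      HasDerivAt (d N) (d (N + 1) (s.sign * t)) (s.sign * t) →
      ‖residual (d 0) N (ξ lam) lam (s.sign * t)‖ ≤
        (Iic (delta (d 0) ν ε₁ ε₂ s lam)).indicator
          (fun _ => A * lam * Real.exp (-c₁ * cutoffExponent (d 0) ν ε₁ ε₂ s lam)) t +
        A * sigmaRate (d 0) N ν ε₁ ε₂ s lam * ‖pseudomode (d 0) N ξ lam (s.sign * t)‖ +
        A / Real.sqrt lam ^ (N + 1) * (‖d (N + 1) (s.sign * t)‖ *
          ‖pseudomode (d 0) N ξ lam (s.sign * t)‖) := by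
  obtain ⟨B, hB1, hB⟩ := E.exists_eventually_wkb_bounds (ε₂ := ε₂) hN hε₂ hbν hc hd hU
  obtain ⟨c₀, K, hc₀, hK, hP⟩ := E.exists_eventually_phase_bounds (ε₂ := ε₂) hN hε₂ hbν hc hd hU
  obtain ⟨B₂, hB₂, hσ⟩ := E.exists_eventually_le_sigmaRate (ε₂ := ε₂) hN hε₂
  obtain ⟨B₃, hB₃, hD⟩ := E.eventually_Delta hN hε₂ hbν
  obtain ⟨c', hc', hI⟩ := E.exists_cutoffExponent_le_integral hN hε₂ hbν
  obtain ⟨Cξ, hξ⟩ := hξ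
  set A₁ := (|Cξ| * B₃ ^ 2 + 2 * (|Cξ| * B₃) * K) * Real.exp K with hA₁
  have hA₁0 : 0 ≤ A₁ := by positivity
  refine ⟨A₁ + B * B₂ + B, c₀ * c', by positivity, by positivity, ?_⟩
  filter_upwards [hB, hP, hσ, hD, hI, hξ, hΔ, hU, eventually_gt_atTop 0,
    (E.tendsto_delta (ε₂ := ε₂) hε₂).eventually_ge_atTop 0] with
    lam hB hP hσ hD hI hξ hΔ hU hlam hδ0 t ht hdt
  set δ := delta (d 0) ν ε₁ ε₂ s lam with hδ
  set Δ := Delta (d 0) ν ε₁ ε₂ s lam with hΔdef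
  set Kx := cutoffExponent (d 0) ν ε₁ ε₂ s lam with hKx
  have hsq : 0 < Real.sqrt lam := Real.sqrt_pos.2 hlam
  have hσ0 : 0 ≤ sigmaRate (d 0) N ν ε₁ ε₂ s lam := sigmaRate_nonneg _ _ _ _ _ _ hlam.le hδ0
  set x := s.sign * t with hx
  have hfx : pseudomode (d 0) N ξ lam x = (ξ lam x : ℂ) * ansatz (d 0) N lam x := rfl
  rcases lt_or_ge δ t with h | h
  · have h0 := IsCutoff.eventuallyEq_zero hξ (s := s) h
    obtain ⟨h1, h2⟩ := IsCutoff.deriv_eq_zero_of_eventuallyEq h0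
    have h3 : ξ lam x = 0 := h0.eq_of_nhds
    have : residual (d 0) N (ξ lam) lam x = 0 := by
      rw [residual, h1, h2, h3]; simp
    rw [this, hfx, h3, norm_zero, indicator_of_notMem (by simpa using h)]
    simp
  rw [indicator_of_mem (by simpa using h)]
  have htδ : t ∈ Icc 0 δ := ⟨ht.le, h⟩
  obtain ⟨hP1, hP2, hP3⟩ := hP t htδ
  obtain ⟨-, -, -, hrem⟩ := hB t htδ
  obtain ⟨D, hD1, hD2⟩ := hrem hdt
  set g := ansatz (d 0) N lam x with hg
  have hgn : ‖g‖ = Real.exp (-(phase (d 0) N lam x).re) := by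
    rw [hg, ansatz_eq_exp_phase hlam hU hd hN hc, Complex.norm_exp, Complex.neg_re]
  have hsplit : residual (d 0) N (ξ lam) lam x =
      (-((deriv (deriv (ξ lam)) x : ℝ) : ℂ) +
        2 * ((deriv (ξ lam) x : ℝ) : ℂ) * phaseDeriv (d 0) N lam x) * g +
      (D - phaseDeriv (d 0) N lam x ^ 2 + d 0 x - lam) * pseudomode (d 0) N ξ lam x := by
    rw [residual, hfx, hD1.deriv]; ring
  have hfirst : ‖(-((deriv (deriv (ξ lam)) x : ℝ) : ℂ) +
        2 * ((deriv (ξ lam) x : ℝ) : ℂ) * phaseDeriv (d 0) N lam x) * g‖ ≤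
      A₁ * lam * Real.exp (-(c₀ * c') * Kx) := by
    rcases lt_or_ge t (δ - Δ) with h' | h'
    · obtain ⟨h1, h2⟩ := IsCutoff.deriv_eq_zero_of_eventuallyEq
        (IsCutoff.eventuallyEq_one hξ hΔ (s := s) ht.le h')
      rw [h1, h2]
      simp only [Complex.ofReal_zero, neg_zero, mul_zero, zero_mul, add_zero, norm_zero]
      positivity
    · obtain ⟨h1, h2⟩ := IsCutoff.abs_deriv_le hξ (s := s) ht
      have hΔ0 : 0 < Δ := hD.1
      have hb1 : |deriv (ξ lam) x| ≤ |Cξ| * B₃ * Real.sqrt lam := by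
        refine h1.trans ?_
        calc Cξ * Δ⁻¹ ≤ |Cξ| * Δ⁻¹ := by gcongr; exact le_abs_self _
          _ ≤ |Cξ| * (B₃ * Real.sqrt lam) := by gcongr; exact hD.2.2
          _ = _ := by ring
      have hb2 : |deriv (deriv (ξ lam)) x| ≤ |Cξ| * B₃ ^ 2 * lam := by
        refine h2.trans ?_
        calc Cξ * Δ⁻¹ ^ 2 ≤ |Cξ| * Δ⁻¹ ^ 2 := by gcongr; exact le_abs_self _
          _ ≤ |Cξ| * (B₃ * Real.sqrt lam) ^ 2 := by gcongr; exact hD.2.2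
          _ = _ := by rw [mul_pow, Real.sq_sqrt hlam.le]; ring
      have hge : ‖g‖ ≤ Real.exp K * Real.exp (-(c₀ * c') * Kx) := by
        rw [hgn, ← Real.exp_add]
        apply Real.exp_le_exp.2
        have hmono : ∫ u in (0 : ℝ)..(δ - Δ), |imAlong (d 0) s u| ≤
            ∫ u in (0 : ℝ)..t, |imAlong (d 0) s u| := by
          refine intervalIntegral.integral_mono_interval le_rfl ?_ h'
            (Eventually.of_forall fun _ => abs_nonneg _)
            (E.cont_im.abs.intervalIntegrable _ _)
          have := hΔ s
          linarith
        have h4 : c₀ * c' * Kx ≤ c₀ * (∫ u in (0 : ℝ)..t, |imAlong (d 0) s u|) / Real.sqrt lam := by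
          rw [le_div_iff₀ hsq]
          calc c₀ * c' * Kx * Real.sqrt lam = c₀ * (c' * Kx * Real.sqrt lam) := by ring
            _ ≤ _ := by gcongr; exact hI.trans hmono
        linarith
      rw [norm_mul]
      have hb : ‖-((deriv (deriv (ξ lam)) x : ℝ) : ℂ) +
          2 * ((deriv (ξ lam) x : ℝ) : ℂ) * phaseDeriv (d 0) N lam x‖ ≤
          (|Cξ| * B₃ ^ 2 + 2 * (|Cξ| * B₃) * K) * lam := by
        refine (norm_add_le _ _).trans ?_
        rw [norm_neg, norm_mul, norm_mul, Complex.norm_real, Complex.norm_real, Complex.norm_two,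
          Real.norm_eq_abs, Real.norm_eq_abs]
        calc |deriv (deriv (ξ lam)) x| + 2 * |deriv (ξ lam) x| * ‖phaseDeriv (d 0) N lam x‖
            ≤ |Cξ| * B₃ ^ 2 * lam + 2 * (|Cξ| * B₃ * Real.sqrt lam) * (K * Real.sqrt lam) := by
              gcongr
          _ = |Cξ| * B₃ ^ 2 * lam + 2 * (|Cξ| * B₃) * K * (Real.sqrt lam * Real.sqrt lam) := by ring
          _ = _ := by rw [Real.mul_self_sqrt hlam.le]; ring
      calc _ ≤ (|Cξ| * B₃ ^ 2 + 2 * (|Cξ| * B₃) * K) * lam *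
            (Real.exp K * Real.exp (-(c₀ * c') * Kx)) := by gcongr
        _ = _ := by rw [hA₁]; ring
  have hsecond : ‖(D - phaseDeriv (d 0) N lam x ^ 2 + d 0 x - lam) * pseudomode (d 0) N ξ lam x‖ ≤
      B * B₂ * sigmaRate (d 0) N ν ε₁ ε₂ s lam * ‖pseudomode (d 0) N ξ lam x‖ +
      B / Real.sqrt lam ^ (N + 1) * (‖d (N + 1) x‖ * ‖pseudomode (d 0) N ξ lam x‖) := by
    -- The comparison with σ is available only for t < δ; at t = δ the cut-off vanishes.
    rcases h.lt_or_eq with h' | h'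
    · have h5 := hσ t ⟨ht, h'⟩
      rw [norm_mul]
      calc _ ≤ (B * (B₂ * sigmaRate (d 0) N ν ε₁ ε₂ s lam) +
            B * ‖d (N + 1) x‖ / Real.sqrt lam ^ (N + 1)) * ‖pseudomode (d 0) N ξ lam x‖ := by
            refine mul_le_mul_of_nonneg_right (hD2.trans ?_) (norm_nonneg _)
            gcongr
        _ = _ := by ring
    · have : pseudomode (d 0) N ξ lam x = 0 := by
        rw [hfx, IsCutoff.apply_eq_zero hξ (s := s) h'.ge]; simp
      rw [this]; simp
  rw [hsplit]
  refine (norm_add_le _ _).trans ((add_le_add hfirst hsecond).trans ?_)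
  rw [← add_assoc]
  have hn := norm_nonneg (pseudomode (d 0) N ξ lam x)
  gcongr <;> nlinarith [mul_pos (show 0 < B by linarith) hB₂]

/-- The lower bound on Im V integrates to a multiple of t^{γ'+1} minus a constant, which enters the
phase bound; beyond δ the pseudomode is zero, so the estimate holds for all t. -/
theorem exists_eventually_norm_pseudomode_le (E : EndData N d (ν s) ε₁ s R C c) (hN : 1 ≤ N)
    (hε₂ : 0 < ε₂) (hbν : BoundedAt (d 0) s → ε₂ < 1 - ν s) (hc : ∀ i ≤ N, Continuous (d i))
    (hd : ∀ i < N, ∀ x, HasDerivAt (d i) (d (i + 1) x) x)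
    (hU : ∀ᶠ lam : ℝ in atTop, ∀ x, (lam : ℂ) - d 0 x ∈ Complex.slitPlane)
    {ξ : ℝ → ℝ → ℝ} (hξ : IsCutoffFamily (d 0) ν ε₁ ε₂ ξ) {g' : ℝ} (hg : 0 ≤ g')
    (hlow : (fun x => |x| ^ g') =O[s.filter] (fun x => (d 0 x).im)) :
    ∃ A c₃ : ℝ, 0 < A ∧ 0 < c₃ ∧ ∀ᶠ lam : ℝ in atTop, ∀ t, 0 < t →
      ‖pseudomode (d 0) N ξ lam (s.sign * t)‖ ≤
        A * Real.exp (-(c₃ * (t ^ (g' + 1) / Real.sqrt lam))) := by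
  obtain ⟨c₀, K, hc₀, hK, hP⟩ := E.exists_eventually_phase_bounds (ε₂ := ε₂) hN hε₂ hbν hc hd hU
  obtain ⟨c₁, c₂, hc₁, hc₂, hI⟩ := E.exists_le_integral_im hg hlow
  obtain ⟨Cξ, hξ⟩ := hξ
  refine ⟨Real.exp (c₀ * c₂ + K), c₀ * c₁, Real.exp_pos _, by positivity, ?_⟩
  filter_upwards [hP, hξ, hU, eventually_ge_atTop 1] with lam hP hξ hU hlam1 t ht
  have hlam : 0 < lam := by linarith
  have hfx : pseudomode (d 0) N ξ lam (s.sign * t) =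
    (ξ lam (s.sign * t) : ℂ) * ansatz (d 0) N lam (s.sign * t) := rfl
  rcases le_total (delta (d 0) ν ε₁ ε₂ s lam) t with h | h
  · rw [hfx, IsCutoff.apply_eq_zero hξ (s := s) h]
    simp only [Complex.ofReal_zero, zero_mul, norm_zero]
    positivity
  · obtain ⟨h1, -, -⟩ := hP t ⟨ht.le, h⟩
    have hsq : 1 ≤ Real.sqrt lam := by rwa [Real.one_le_sqrt]
    rw [hfx, norm_mul, Complex.norm_real, Real.norm_of_nonneg (hξ.nonneg _),
      ansatz_eq_exp_phase hlam hU hd hN hc, Complex.norm_exp, Complex.neg_re, ← Real.exp_add]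
    refine (mul_le_of_le_one_left (Real.exp_pos _).le (hξ.le_one _)).trans ?_
    apply Real.exp_le_exp.2
    have h2 : c₀ * c₁ * (t ^ (g' + 1) / Real.sqrt lam) - c₀ * c₂ ≤
        c₀ * (∫ u in (0 : ℝ)..t, |imAlong (d 0) s u|) / Real.sqrt lam := by
      have h3 : c₀ * c₂ / Real.sqrt lam ≤ c₀ * c₂ := div_le_self (by positivity) hsq
      calc c₀ * c₁ * (t ^ (g' + 1) / Real.sqrt lam) - c₀ * c₂
          ≤ c₀ * c₁ * (t ^ (g' + 1) / Real.sqrt lam) - c₀ * c₂ / Real.sqrt lam := by linarith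
        _ = c₀ * (c₁ * t ^ (g' + 1) - c₂) / Real.sqrt lam := by ring
        _ ≤ _ := by gcongr; exact hI t ht.le
    linarith

/-- Up to a length T of order λ^{1/(2(γ+1))}, the integral of |Im V| is O(√λ). Hence the phase is
bounded above, |f| is bounded below, and the norm is at least a multiple of T^{1/2}. -/
theorem exists_eventually_le_eLpNorm (E : EndData N d (ν s) ε₁ s R C c) (hN : 1 ≤ N)
    (hε₂ : 0 < ε₂) (hbν : BoundedAt (d 0) s → ε₂ < 1 - ν s) (hc : ∀ i ≤ N, Continuous (d i))
    (hd : ∀ i < N, ∀ x, HasDerivAt (d i) (d (i + 1) x) x)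
    (hU : ∀ᶠ lam : ℝ in atTop, ∀ x, (lam : ℂ) - d 0 x ∈ Complex.slitPlane)
    (hΔ : ∀ᶠ lam : ℝ in atTop, ∀ s, 0 < Delta (d 0) ν ε₁ ε₂ s lam ∧
      Delta (d 0) ν ε₁ ε₂ s lam ≤ delta (d 0) ν ε₁ ε₂ s lam / 4)
    {ξ : ℝ → ℝ → ℝ} (hξ : IsCutoffFamily (d 0) ν ε₁ ε₂ ξ) {γ : ℝ} (hγ : 0 ≤ γ)
    (hup : (fun x => (d 0 x).im) =O[s.filter] (fun x => |x| ^ γ)) :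
    ∃ a : ℝ, 0 < a ∧ ∀ᶠ lam : ℝ in atTop,
      ENNReal.ofReal (a * lam ^ (1 / (4 * (γ + 1)))) ≤
        eLpNorm (pseudomode (d 0) N ξ lam) 2 volume := by
  obtain ⟨c₀, K, hc₀, hK, hP⟩ := E.exists_eventually_phase_bounds (ε₂ := ε₂) hN hε₂ hbν hc hd hU
  obtain ⟨Kγ, hKγ, hup⟩ := exists_im_le_rpow hup
  obtain ⟨L, hL, hI⟩ := E.exists_integral_im_le hγ hKγ hup
  obtain ⟨c', hc', hδ⟩ := E.exists_rpow_le_delta (ε₂ := ε₂) hN hε₂ hγ hup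
  obtain ⟨Cξ, hξ⟩ := hξ
  -- Half the constant gives T ≤ δ/2, which together with Δ ≤ δ/4 keeps the interval where ξ = 1.
  set b := c' / 2 with hb
  have hb0 : 0 < b := by positivity
  set e := 1 / (2 * (γ + 1)) with he
  set Q := K * (L * b + Kγ * b ^ (γ + 1)) + K with hQ
  refine ⟨Real.exp (-Q) * b ^ (1 / 2 : ℝ), by positivity, ?_⟩
  filter_upwards [hP, hξ, hU, hδ, hΔ, eventually_ge_atTop 1] with lam hP hξ hU hδ hΔ hlam1
  have hlam : 0 < lam := by linarith
  set T := b * lam ^ e with hT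
  have hT0 : 0 < T := by positivity
  have hδ0 : 0 < delta (d 0) ν ε₁ ε₂ s lam := lt_of_lt_of_le (by positivity) hδ
  have hTδ : T ≤ delta (d 0) ν ε₁ ε₂ s lam / 2 := by rw [hT, hb]; linarith
  have hsq : 0 < Real.sqrt lam := Real.sqrt_pos.2 hlam
  have hg1 : (0 : ℝ) < γ + 1 := by linarith
  have hTle : T ≤ b * Real.sqrt lam := by
    rw [hT, Real.sqrt_eq_rpow]
    have : e ≤ 1 / 2 := by
      rw [he, div_le_div_iff₀ (by positivity) (by norm_num)]; linarith
    gcongr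
  have hTp : T ^ (γ + 1) = b ^ (γ + 1) * Real.sqrt lam := by
    rw [hT, Real.mul_rpow hb0.le (by positivity), ← Real.rpow_mul hlam.le, Real.sqrt_eq_rpow]
    congr 2
    rw [he]; field_simp
  have hlow : ∀ t ∈ Ioo 0 T, Real.exp (-Q) ≤ ‖pseudomode (d 0) N ξ lam (s.sign * t)‖ := by
    intro t ht
    have htδ : t < delta (d 0) ν ε₁ ε₂ s lam - Delta (d 0) ν ε₁ ε₂ s lam := by
      have := (hΔ s).2
      linarith [ht.2]
    have h1 : ξ lam (s.sign * t) = 1 :=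
      (IsCutoff.eventuallyEq_one hξ (fun s => by linarith [(hΔ s).1, (hΔ s).2]) (s := s)
        ht.1.le htδ).eq_of_nhds
    obtain ⟨-, h2, -⟩ := hP t ⟨ht.1.le, by linarith [ht.2]⟩
    rw [pseudomode, h1, Complex.ofReal_one, one_mul, ansatz_eq_exp_phase hlam hU hd hN hc,
      Complex.norm_exp, Complex.neg_re]
    apply Real.exp_le_exp.2
    have h3 : ∫ u in (0 : ℝ)..t, |imAlong (d 0) s u| ≤
        (L * b + Kγ * b ^ (γ + 1)) * Real.sqrt lam := by
      have h4 : t ^ (γ + 1) ≤ T ^ (γ + 1) := Real.rpow_le_rpow ht.1.le ht.2.le hg1.le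
      have h5 := hI t ht.1.le
      have h6 : L * t ≤ L * (b * Real.sqrt lam) := by gcongr; linarith [ht.2]
      have h7 : Kγ * t ^ (γ + 1) ≤ Kγ * (b ^ (γ + 1) * Real.sqrt lam) := by
        rw [← hTp]; gcongr
      linarith
    have h8 : K * (∫ u in (0 : ℝ)..t, |imAlong (d 0) s u|) / Real.sqrt lam ≤
        K * (L * b + Kγ * b ^ (γ + 1)) := by
      rw [div_le_iff₀ hsq, mul_assoc]
      gcongr
    linarith
  set S : Set ℝ := (fun x => s.sign * x) ⁻¹' Ioo 0 T with hS
  have hSm : MeasurableSet S := measurableSet_Ioo.preimage (by fun_prop)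
  have hvol : volume S = ENNReal.ofReal T := by
    have := Real.volume_preimage_mul_left (a := s.sign) (by cases s <;> simp [Side.sign]) (Ioo 0 T)
    rw [hS, this, abs_inv, s.abs_sign]
    simp
  have hmono : eLpNorm (S.indicator fun _ => Real.exp (-Q)) 2 volume ≤
      eLpNorm (pseudomode (d 0) N ξ lam) 2 volume := by
    refine eLpNorm_mono fun x => ?_
    by_cases hx : x ∈ S
    · rw [indicator_of_mem hx, Real.norm_of_nonneg (Real.exp_pos _).le]
      have := hlow _ hx
      rwa [← mul_assoc, s.sign_mul_self, one_mul] at this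
    · rw [indicator_of_notMem hx, norm_zero]
      exact norm_nonneg _
  refine le_trans (le_of_eq ?_) hmono
  rw [eLpNorm_indicator_const hSm (by norm_num) (by norm_num), hvol,
    Real.enorm_of_nonneg (Real.exp_pos _).le, ENNReal.toReal_ofNat,
    ENNReal.ofReal_rpow_of_pos hT0, ← ENNReal.ofReal_mul (Real.exp_pos _).le, hT,
    Real.mul_rpow hb0.le (by positivity), ← Real.rpow_mul hlam.le, mul_assoc]
  congr 4
  rw [he]; field_simp; norm_num

end EndData

/-! ### The residual in L² -/

theorem Side.measurableSet_halfLine (s : Side) : MeasurableSet s.halfLine := by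
  cases s
  · exact measurableSet_Iio
  · exact measurableSet_Ioi

theorem bracket_le_mul_bracket {m : ℝ} (hm : 1 ≤ m) (x : ℝ) :
    bracket x ≤ m * bracket (m⁻¹ * x) := by
  have hm0 : 0 < m := by linarith
  have h : m * bracket (m⁻¹ * x) = Real.sqrt (m ^ 2 + x ^ 2) := by
    rw [bracket, ← Real.sqrt_sq hm0.le, ← Real.sqrt_mul (sq_nonneg m), Real.sqrt_sq hm0.le]
    congr 1
    field_simp
  rw [h, bracket]
  apply Real.sqrt_le_sqrt
  nlinarith

theorem eLpNorm_const_mul {b : ℝ} (hb : 0 ≤ b) (g : ℝ → ℝ) :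
    eLpNorm (fun x => b * g x) 2 volume = ENNReal.ofReal b * eLpNorm g 2 volume := by
  have := eLpNorm_const_smul b g 2 (volume : Measure ℝ)
  rw [Real.enorm_of_nonneg hb] at this
  exact this

theorem ofReal_le_ofReal_mul_of_le {x y z : ℝ} {F : ℝ≥0∞} (hy : 0 ≤ y)
    (hz : ENNReal.ofReal z ≤ F) (h : x ≤ y * z) : ENNReal.ofReal x ≤ ENNReal.ofReal y * F := by
  refine (ENNReal.ofReal_le_ofReal h).trans ?_
  rw [ENNReal.ofReal_mul hy]
  gcongr

theorem exists_norm_le_of_memLp_top {α : ℝ} {s : Side} {k : ℝ → ℂ}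
    (hk : MemLp (fun x => ((bracket x ^ (-α) : ℝ) : ℂ) * k x) ∞ (volume.restrict s.halfLine)) :
    ∃ M, 0 < M ∧ ∀ᵐ x, x ∈ s.halfLine → ‖k x‖ ≤ M * bracket x ^ α := by
  have hfin := hk.eLpNorm_ne_top
  rw [eLpNorm_exponent_top] at hfin
  refine ⟨(eLpNormEssSup (fun x => ((bracket x ^ (-α) : ℝ) : ℂ) * k x)
    (volume.restrict s.halfLine)).toReal + 1, add_pos_of_nonneg_of_pos ENNReal.toReal_nonneg one_pos, ?_⟩
  filter_upwards [(ae_restrict_iff' s.measurableSet_halfLine).1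
    (ae_le_eLpNormEssSup (f := fun x => ((bracket x ^ (-α) : ℝ) : ℂ) * k x))] with x hx hxs
  have h1 := ENNReal.toReal_mono hfin (hx hxs)
  have hX := Real.rpow_pos_of_pos (bracket_pos x) α
  rw [toReal_enorm, norm_mul, Complex.norm_real, Real.norm_of_nonneg
    (Real.rpow_nonneg (bracket_pos x).le _), Real.rpow_neg (bracket_pos x).le, inv_mul_le_iff₀ hX]
    at h1
  rw [mul_comm]
  exact h1.trans (by gcongr; linarith)

namespace EndData

variable {N : ℕ} {d : ℕ → ℝ → ℂ} {ν : Side → ℝ} {ε₁ ε₂ : ℝ} {s : Side} {R C c : ℝ}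

/-- The factors λ and δ^{1/2} are exponentials of logarithms that are small against the cut-off
exponent; half of the constant c₁ pays for them. -/
theorem eventually_cutoff_le_kappaRate (E : EndData N d (ν s) ε₁ s R C c) (hN : 1 ≤ N)
    (hε₂ : 0 < ε₂) {c₁ : ℝ} (hc₁ : 0 < c₁) :
    ∀ᶠ lam : ℝ in atTop, lam * Real.exp (-c₁ * cutoffExponent (d 0) ν ε₁ ε₂ s lam) *
        (2 * delta (d 0) ν ε₁ ε₂ s lam) ^ (1 / 2 : ℝ) ≤
      2 * kappaRate (d 0) ν ε₁ ε₂ (c₁ / 2) s lam := by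
  filter_upwards [E.eventually_log_le (ε₂ := ε₂) hN hε₂ (show 0 < c₁ / 4 by positivity),
    eventually_gt_atTop 0, (E.tendsto_delta (ε₂ := ε₂) hε₂).eventually_gt_atTop 0] with
    lam ⟨h1, h2, h3⟩ hlam hδ
  set K := cutoffExponent (d 0) ν ε₁ ε₂ s lam
  set δ := delta (d 0) ν ε₁ ε₂ s lam
  have e1 : lam = Real.exp (Real.log lam) := (Real.exp_log hlam).symm
  have e2 : δ ^ (1 / 2 : ℝ) = Real.exp (Real.log δ * (1 / 2)) := Real.rpow_def_of_pos hδ _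
  have e3 : (2 : ℝ) ^ (1 / 2 : ℝ) ≤ 2 := by
    calc (2 : ℝ) ^ (1 / 2 : ℝ) ≤ 2 ^ (1 : ℝ) :=
          Real.rpow_le_rpow_of_exponent_le (by norm_num) (by norm_num)
      _ = 2 := Real.rpow_one 2
  rw [kappaRate_eq, Real.mul_rpow (by norm_num) hδ.le, e2]
  calc lam * Real.exp (-c₁ * K) * (2 ^ (1 / 2 : ℝ) * Real.exp (Real.log δ * (1 / 2)))
      = 2 ^ (1 / 2 : ℝ) * (Real.exp (Real.log lam) * Real.exp (-c₁ * K) *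
          Real.exp (Real.log δ * (1 / 2))) := by rw [← e1]; ring
    _ = 2 ^ (1 / 2 : ℝ) * Real.exp (Real.log lam + -c₁ * K + Real.log δ * (1 / 2)) := by
        rw [Real.exp_add, Real.exp_add]
    _ ≤ 2 * Real.exp (-(c₁ / 2) * K) := by
        gcongr
        linarith

/-- The pointwise bound is integrated over one half-line. The norm of f appears as a factor on the
right, so every contribution not already containing it is compared with the lower bound a
λ^{1/(4(γ+1))}, which may come from the other end. -/
theorem exists_eventually_eLpNorm_residual_le (E : EndData N d (ν s) ε₁ s R C c) (hN : 1 ≤ N)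
    (hε₂ : 0 < ε₂) (hbν : BoundedAt (d 0) s → ε₂ < 1 - ν s) (hc : ∀ i ≤ N, Continuous (d i))
    (hd : ∀ i < N, ∀ x, HasDerivAt (d i) (d (i + 1) x) x)
    (hdN : ∀ᵐ x, HasDerivAt (d N) (d (N + 1) x) x)
    (hU : ∀ᶠ lam : ℝ in atTop, ∀ x, (lam : ℂ) - d 0 x ∈ Complex.slitPlane)
    (hΔ : ∀ᶠ lam : ℝ in atTop, ∀ s, Delta (d 0) ν ε₁ ε₂ s lam < delta (d 0) ν ε₁ ε₂ s lam)
    {ξ : ℝ → ℝ → ℝ} (hξ : IsCutoffFamily (d 0) ν ε₁ ε₂ ξ) {γ : ℝ} (hγ : 0 ≤ γ)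
    {γ' α : Side → ℝ} (hγ' : 0 ≤ γ' s)
    (hlow : (fun x => |x| ^ γ' s) =O[s.filter] (fun x => (d 0 x).im)) (hα : 0 ≤ α s)
    {h₂ k : ℝ → ℂ} (hh₂ : MemLp h₂ 2 volume)
    (hk : MemLp (fun x => ((bracket x ^ (-α s) : ℝ) : ℂ) * k x) ∞ (volume.restrict s.halfLine))
    (hsum : ∀ᵐ x, x ∈ s.halfLine → d (N + 1) x = h₂ x + k x)
    (hmeas : ∀ᶠ lam : ℝ in atTop, AEStronglyMeasurable (pseudomode (d 0) N ξ lam) volume)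
    {a : ℝ} (ha : 0 < a) (hF : ∀ᶠ lam : ℝ in atTop,
      ENNReal.ofReal (a * lam ^ (1 / (4 * (γ + 1)))) ≤
        eLpNorm (pseudomode (d 0) N ξ lam) 2 volume) :
    ∃ A c : ℝ, 0 < A ∧ 0 < c ∧ ∀ᶠ lam : ℝ in atTop,
      eLpNorm (s.halfLine.indicator (residual (d 0) N (ξ lam) lam)) 2 volume ≤
        ENNReal.ofReal (A * (kappaRate (d 0) ν ε₁ ε₂ c s lam +
          sigmaRate (d 0) N ν ε₁ ε₂ s lam + tauRate N γ γ' α s lam)) *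
          eLpNorm (pseudomode (d 0) N ξ lam) 2 volume := by
  obtain ⟨A₁, c₁, hA₁, hc₁, hres⟩ := E.exists_eventually_residual_le hN hε₂ hbν hc hd hU hΔ hξ
  obtain ⟨A₃, c₃, hA₃, hc₃, hdec⟩ :=
    E.exists_eventually_norm_pseudomode_le hN hε₂ hbν hc hd hU hξ hγ' hlow
  obtain ⟨M, hM, hkM⟩ := exists_norm_le_of_memLp_top hk
  set q := γ' s + 1 with hq
  have hq1 : 1 ≤ q := by linarith
  have hq0 : 0 < q := by linarith
  have hprof := memLp_profile hα hc₃ hq1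
  set P := (eLpNorm (profile (α s) c₃ q) 2 volume).toReal with hP
  have hPe : eLpNorm (profile (α s) c₃ q) 2 volume = ENNReal.ofReal P :=
    (ENNReal.ofReal_toReal hprof.eLpNorm_ne_top).symm
  set H := (eLpNorm h₂ 2 volume).toReal with hH
  have hHe : eLpNorm h₂ 2 volume = ENNReal.ofReal H :=
    (ENNReal.ofReal_toReal hh₂.eLpNorm_ne_top).symm
  have hP0 : 0 ≤ P := ENNReal.toReal_nonneg
  have hH0 : 0 ≤ H := ENNReal.toReal_nonneg
  refine ⟨2 * A₁ / a + A₁ + A₁ * A₃ * H / a + A₁ * (M * A₃) * P / a, c₁ / 2, by positivity,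
    by positivity, ?_⟩
  filter_upwards [hres, hdec, hF, hmeas, E.eventually_cutoff_le_kappaRate (ε₂ := ε₂) hN hε₂ hc₁,
    eventually_ge_atTop 1, (E.tendsto_delta (ε₂ := ε₂) hε₂).eventually_gt_atTop 0] with
    lam hres hdec hF hmeas hκ hlam1 hδ
  have hlam : 0 < lam := by linarith
  set e := 1 / (4 * (γ + 1)) with he
  set δ := delta (d 0) ν ε₁ ε₂ s lam
  set K := cutoffExponent (d 0) ν ε₁ ε₂ s lam
  set σ := sigmaRate (d 0) N ν ε₁ ε₂ s lam
  set κ := kappaRate (d 0) ν ε₁ ε₂ (c₁ / 2) s lam with hκdef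
  set f := pseudomode (d 0) N ξ lam with hf
  set F := eLpNorm f 2 volume
  have hσ0 : 0 ≤ σ := sigmaRate_nonneg _ _ _ _ _ _ hlam.le hδ.le
  have hκ0 : 0 ≤ κ := by rw [hκdef, kappaRate_eq]; positivity
  -- m is the width of the decay: m^q = √λ turns t^q / √λ into (t/m)^q.
  set m := lam ^ (1 / (2 * q)) with hm
  have hm1 : 1 ≤ m := Real.one_le_rpow hlam1 (by positivity)
  have hm0 : 0 < m := by linarith
  have hmq : m ^ q = Real.sqrt lam := by
    rw [hm, ← Real.rpow_mul hlam.le, Real.sqrt_eq_rpow]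
    congr 1
    field_simp
  set ρ := A₁ / Real.sqrt lam ^ (N + 1) with hρ
  have hsq : 0 < Real.sqrt lam := Real.sqrt_pos.2 hlam
  have hρ0 : 0 ≤ ρ := by positivity
  have hρe : ρ = A₁ * lam ^ (-((N : ℝ) + 1) / 2) := by
    rw [hρ, sqrt_pow_eq_rpow hlam.le, div_eq_mul_inv, ← Real.rpow_neg hlam.le]
    congr 2
    push_cast
    ring
  set Kap := A₁ * lam * Real.exp (-c₁ * K) with hKap
  have hKap0 : 0 ≤ Kap := by positivity
  -- Four majorants: the cut-off terms, the regular remainder, and the square integrable and the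
  -- weighted bounded parts of the derivative of order N + 1.
  set G₁ : ℝ → ℝ := (Icc (-δ) δ).indicator fun _ => Kap
  set G₂ : ℝ → ℝ := fun x => A₁ * σ * ‖f x‖
  set G₃ : ℝ → ℝ := fun x => ρ * A₃ * ‖h₂ x‖
  set G₄ : ℝ → ℝ := fun x => ρ * (M * A₃ * m ^ α s) * profile (α s) c₃ q (m⁻¹ * x)
  have hbound : ∀ᵐ x, ‖s.halfLine.indicator (residual (d 0) N (ξ lam) lam) x‖ ≤
      (G₁ + G₂ + G₃ + G₄) x := by
    filter_upwards [hdN, hkM, hsum] with x hx hkx hsx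
    simp only [Pi.add_apply]
    have hprof0 : 0 ≤ profile (α s) c₃ q (m⁻¹ * x) := by
      unfold profile
      have := bracket_pos (m⁻¹ * x)
      positivity
    by_cases hxs : x ∈ s.halfLine
    · rw [indicator_of_mem hxs]
      have ht : 0 < s.sign * x := (s.mem_halfLine_iff x).1 hxs
      have hxt : s.sign * (s.sign * x) = x := by rw [← mul_assoc, s.sign_mul_self, one_mul]
      have habs : |x| = s.sign * x := by
        rw [← abs_of_pos ht, abs_mul, s.abs_sign, one_mul]
      have h1 := hres (s.sign * x) ht (by rwa [hxt])
      have h2 := hdec (s.sign * x) ht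
      rw [hxt] at h1 h2
      have h3 : (Iic δ).indicator (fun _ => Kap) (s.sign * x) = G₁ x := by
        by_cases h : s.sign * x ≤ δ
        · rw [indicator_of_mem (by exact h)]
          have hx' : x ∈ Icc (-δ) δ := abs_le.1 (habs.trans_le h)
          have h0 : G₁ x = Kap := indicator_of_mem hx' _
          exact h0.symm
        · rw [indicator_of_notMem (show s.sign * x ∉ Iic δ from h)]
          have hx' : x ∉ Icc (-δ) δ := fun hx => h (habs.symm.trans_le (abs_le.2 hx))
          have h0 : G₁ x = 0 := indicator_of_notMem hx' _
          exact h0.symm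
      rw [h3] at h1
      have h4 : ‖f x‖ ≤ A₃ := h2.trans (mul_le_of_le_one_right hA₃.le
        (Real.exp_le_one_iff.2 (neg_nonpos.2 (by positivity))))
      have h5 : (s.sign * x) ^ q / Real.sqrt lam = |m⁻¹ * x| ^ q := by
        rw [abs_mul, abs_of_pos (inv_pos.2 hm0), habs, Real.mul_rpow (inv_pos.2 hm0).le ht.le,
          Real.inv_rpow hm0.le, hmq]
        ring
      rw [h5] at h2
      have h6 : bracket x ^ α s ≤ m ^ α s * bracket (m⁻¹ * x) ^ α s := by
        rw [← Real.mul_rpow hm0.le (bracket_pos _).le]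
        exact Real.rpow_le_rpow (bracket_pos x).le (bracket_le_mul_bracket hm1 x) hα
      have h7 : ‖k x‖ * ‖f x‖ ≤ M * A₃ * m ^ α s * profile (α s) c₃ q (m⁻¹ * x) := by
        calc ‖k x‖ * ‖f x‖ ≤ (M * (m ^ α s * bracket (m⁻¹ * x) ^ α s)) *
              (A₃ * Real.exp (-(c₃ * |m⁻¹ * x| ^ q))) := by
              refine mul_le_mul ((hkx hxs).trans ?_) h2 (norm_nonneg _) ?_
              · gcongr
              · have := bracket_pos (m⁻¹ * x)
                positivity
          _ = _ := by unfold profile; ring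
      have h8 : ‖d (N + 1) x‖ * ‖f x‖ ≤
          A₃ * ‖h₂ x‖ + M * A₃ * m ^ α s * profile (α s) c₃ q (m⁻¹ * x) := by
        rw [hsx hxs]
        calc ‖h₂ x + k x‖ * ‖f x‖ ≤ (‖h₂ x‖ + ‖k x‖) * ‖f x‖ := by
              gcongr; exact norm_add_le _ _
          _ = ‖h₂ x‖ * ‖f x‖ + ‖k x‖ * ‖f x‖ := by ring
          _ ≤ ‖h₂ x‖ * A₃ + M * A₃ * m ^ α s * profile (α s) c₃ q (m⁻¹ * x) := by gcongr
          _ = _ := by ring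
      refine h1.trans ?_
      have h9 := mul_le_mul_of_nonneg_left h8 hρ0
      have e1 : G₂ x = A₁ * σ * ‖f x‖ := rfl
      have e2 : G₃ x = ρ * A₃ * ‖h₂ x‖ := rfl
      have e3 : G₄ x = ρ * (M * A₃ * m ^ α s) * profile (α s) c₃ q (m⁻¹ * x) := rfl
      rw [e1, e2, e3]
      linarith
    · rw [indicator_of_notMem hxs, norm_zero]
      have : 0 ≤ G₁ x := indicator_nonneg (fun _ _ => hKap0) x
      positivity
  have hm1' : AEStronglyMeasurable G₁ volume :=
    (measurable_const.indicator measurableSet_Icc).aestronglyMeasurable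
  have hm2' : AEStronglyMeasurable G₂ volume := hmeas.norm.const_mul _
  have hm3' : AEStronglyMeasurable G₃ volume := hh₂.1.norm.const_mul _
  have hm4' : AEStronglyMeasurable G₄ volume :=
    (continuous_const.mul ((continuous_profile hq0).comp
      (continuous_const.mul continuous_id))).aestronglyMeasurable
  have n1 : eLpNorm G₁ 2 volume ≤ ENNReal.ofReal (2 * A₁ / a * κ) * F := by
    rw [eLpNorm_indicator_const measurableSet_Icc (by norm_num) (by norm_num),
      Real.volume_Icc, Real.enorm_of_nonneg hKap0, ENNReal.toReal_ofNat,
      ENNReal.ofReal_rpow_of_pos (by linarith), ← ENNReal.ofReal_mul hKap0]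
    refine ofReal_le_ofReal_mul_of_le (by positivity) hF ?_
    have h1 : (1 : ℝ) ≤ lam ^ e := Real.one_le_rpow hlam1 (by positivity)
    calc Kap * (δ - -δ) ^ (1 / 2 : ℝ)
        = A₁ * (lam * Real.exp (-c₁ * K) * (2 * δ) ^ (1 / 2 : ℝ)) := by
          rw [hKap]
          ring_nf
      _ ≤ A₁ * (2 * κ) := by gcongr
      _ = 2 * A₁ * κ * 1 := by ring
      _ ≤ 2 * A₁ * κ * lam ^ e := by gcongr
      _ = _ := by field_simp
  have n2 : eLpNorm G₂ 2 volume = ENNReal.ofReal (A₁ * σ) * F := by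
    rw [eLpNorm_const_mul (by positivity), eLpNorm_norm]
  have n3 : eLpNorm G₃ 2 volume ≤
      ENNReal.ofReal (A₁ * A₃ * H / a * lam ^ (-((N : ℝ) + 1) / 2 - e)) * F := by
    rw [eLpNorm_const_mul (by positivity), eLpNorm_norm, hHe,
      ← ENNReal.ofReal_mul (by positivity)]
    refine ofReal_le_ofReal_mul_of_le (by positivity) hF (le_of_eq ?_)
    have : lam ^ (-((N : ℝ) + 1) / 2) = lam ^ (-((N : ℝ) + 1) / 2 - e) * lam ^ e := by
      rw [← Real.rpow_add hlam]; congr 1; ring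
    rw [hρe, this]
    field_simp
  have n4 : eLpNorm G₄ 2 volume ≤
      ENNReal.ofReal (A₁ * (M * A₃) * P / a * lam ^ (-((N : ℝ) + 1) / 2 +
        (γ - γ' s + 2 * α s * (γ + 1)) / (4 * (γ' s + 1) * (γ + 1)))) * F := by
    rw [eLpNorm_const_mul (by positivity), eLpNorm_comp_inv_mul (continuous_profile hq0) hm0, hPe,
      ← ENNReal.ofReal_mul (by positivity), ← ENNReal.ofReal_mul (by positivity)]
    refine ofReal_le_ofReal_mul_of_le (by positivity) hF (le_of_eq ?_)
    -- The weight contributes m^α and the dilation of the L² norm m^{1/2}. The second exponent in τ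
    -- is (α + 1/2)/(2(γ' + 1)) - 1/(4(γ + 1)) over a common denominator, shifted by -(N + 1)/2.
    have h1 : lam ^ (-((N : ℝ) + 1) / 2 +
        (γ - γ' s + 2 * α s * (γ + 1)) / (4 * (γ' s + 1) * (γ + 1))) * lam ^ e =
        lam ^ (-((N : ℝ) + 1) / 2) * (m ^ α s * m ^ (1 / 2 : ℝ)) := by
      rw [hm, ← Real.rpow_mul hlam.le, ← Real.rpow_mul hlam.le, ← Real.rpow_add hlam,
        ← Real.rpow_add hlam, ← Real.rpow_add hlam]
      congr 1
      have : γ + 1 ≠ 0 := by positivity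
      rw [hq, he] at *
      field_simp
      ring
    calc ρ * (M * A₃ * m ^ α s) * (m ^ (1 / 2 : ℝ) * P)
        = A₁ * (M * A₃) * P *
          (lam ^ (-((N : ℝ) + 1) / 2) * (m ^ α s * m ^ (1 / 2 : ℝ))) := by rw [hρe]; ring
      _ = _ := by rw [← h1]; field_simp
  calc eLpNorm (s.halfLine.indicator (residual (d 0) N (ξ lam) lam)) 2 volume
      ≤ eLpNorm (G₁ + G₂ + G₃ + G₄) 2 volume := eLpNorm_mono_ae_real hbound
    _ ≤ eLpNorm G₁ 2 volume + eLpNorm G₂ 2 volume + eLpNorm G₃ 2 volume +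
        eLpNorm G₄ 2 volume := by
        refine (eLpNorm_add_le ((hm1'.add hm2').add hm3') hm4' one_le_two).trans ?_
        gcongr
        refine (eLpNorm_add_le (hm1'.add hm2') hm3' one_le_two).trans ?_
        gcongr
        exact eLpNorm_add_le hm1' hm2' one_le_two
    _ ≤ _ := add_le_add (add_le_add (add_le_add n1 n2.le) n3) n4
    _ = ENNReal.ofReal (2 * A₁ / a * κ + A₁ * σ +
          A₁ * A₃ * H / a * lam ^ (-((N : ℝ) + 1) / 2 - e) +
          A₁ * (M * A₃) * P / a * lam ^ (-((N : ℝ) + 1) / 2 +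
            (γ - γ' s + 2 * α s * (γ + 1)) / (4 * (γ' s + 1) * (γ + 1)))) * F := by
        rw [ENNReal.ofReal_add (by positivity) (by positivity),
          ENNReal.ofReal_add (by positivity) (by positivity),
          ENNReal.ofReal_add (by positivity) (by positivity)]
        ring
    _ ≤ _ := by
        refine mul_le_mul_left (ENNReal.ofReal_le_ofReal ?_) _
        rw [tauRate, ← he]
        set τ₁ := lam ^ (-((N : ℝ) + 1) / 2 - e)
        set τ₂ := lam ^ (-((N : ℝ) + 1) / 2 +
          (γ - γ' s + 2 * α s * (γ + 1)) / (4 * (γ' s + 1) * (γ + 1)))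
        have t1 : 0 ≤ τ₁ := by positivity
        have t2 : 0 ≤ τ₂ := by positivity
        set A := 2 * A₁ / a + A₁ + A₁ * A₃ * H / a + A₁ * (M * A₃) * P / a with hA
        have p1 : 0 ≤ 2 * A₁ / a := by positivity
        have p2 : 0 ≤ A₁ * A₃ * H / a := by positivity
        have p3 : 0 ≤ A₁ * (M * A₃) * P / a := by positivity
        calc _ ≤ A * κ + A * σ + A * τ₁ + A * τ₂ := by
              refine add_le_add (add_le_add (add_le_add ?_ ?_) ?_) ?_ <;>
                refine mul_le_mul_of_nonneg_right (by linarith) (by assumption)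
          _ = _ := by ring

end EndData

/-! ### Assembling the theorem -/

theorem exists_derivative_sequence {N : ℕ} {V : ℝ → ℂ} {ν : Side → ℝ} {ε₁ : ℝ}
    (hV : BasicAssumption N V ν ε₁) {h : ℝ → ℂ} (hh : IsWeakDeriv (N + 1) V h) :
    ∃ d : ℕ → ℝ → ℂ, d 0 = V ∧ d (N + 1) = h ∧ (∀ i ≤ N, Continuous (d i)) ∧
      (∀ i < N, ∀ x, HasDerivAt (d i) (d (i + 1) x) x) ∧ (∀ i ≤ N, IsWeakDeriv i V (d i)) ∧
      LocallyAC (d N) ∧ ∀ᵐ x, HasDerivAt (d N) (d (N + 1) x) x := by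
  obtain ⟨hC, hint, hw⟩ := contDiff_of_isWeakDeriv hV.cont
    (fun m hm => (hV.sobolev m hm).imp fun _ hw => hw.1) hh
  have e : ∀ i ≤ N, (if i ≤ N then iteratedDeriv i V else h) = iteratedDeriv i V :=
    fun i hi => if_pos hi
  have eN : (if N + 1 ≤ N then iteratedDeriv (N + 1) V else h) = h := if_neg (by omega)
  have eI : iteratedDeriv N V = fun x => iteratedDeriv N V 0 + ∫ t in (0 : ℝ)..x, h t := funext hint
  refine ⟨fun i => if i ≤ N then iteratedDeriv i V else h, ?_, eN, ?_, ?_, ?_, ?_, ?_⟩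
  · simp
  · intro i hi
    simp only [e i hi]
    exact hC.continuous_iteratedDeriv i (by exact_mod_cast hi)
  · intro i hi x
    simp only [e i hi.le, e (i + 1) hi]
    rw [iteratedDeriv_succ]
    exact (hC.differentiable_iteratedDeriv i (by exact_mod_cast hi)).differentiableAt.hasDerivAt
  · intro i hi
    simp only [e i hi]
    exact hw i hi
  · simp only [e N le_rfl]
    rw [eI]
    exact locallyAC_integral hh.2.1 _
  · simp only [e N le_rfl, eN]
    filter_upwards [LocallyIntegrable.ae_hasDerivAt_integral hh.2.1] with x hx
    rw [eI]
    exact (hx 0).const_add _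

theorem aestronglyMeasurable_residual {d : ℕ → ℝ → ℂ} {N : ℕ} {lam : ℝ} (hlam : 0 < lam)
    (hU : ∀ x, (lam : ℂ) - d 0 x ∈ Complex.slitPlane)
    (hd : ∀ i < N, ∀ x, HasDerivAt (d i) (d (i + 1) x) x) (hN : 1 ≤ N)
    (hc : ∀ i ≤ N, Continuous (d i)) (ξ : ℝ → ℝ) (hξ : Continuous ξ) :
    AEStronglyMeasurable (residual (d 0) N ξ lam) volume := by
  have h1 := (continuous_phaseDeriv hlam hU hd hN hc).measurable
  have h2 : Measurable (ansatz (d 0) N lam) := by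
    have h : Continuous (phase (d 0) N lam) :=
      continuous_iff_continuousAt.2 fun x => (hasDerivAt_phase hlam hU hd hN hc x).continuousAt
    have e : ansatz (d 0) N lam = fun x => Complex.exp (-phase (d 0) N lam x) :=
      funext fun x => ansatz_eq_exp_phase hlam hU hd hN hc x
    rw [e]
    exact (Complex.continuous_exp.comp h.neg).measurable
  have h3 := measurable_deriv ξ
  have h4 := measurable_deriv (deriv ξ)
  have h5 := measurable_deriv (phaseDeriv (d 0) N lam)
  have h6 := (hc 0 (Nat.zero_le N)).measurable
  have h7 := hξ.measurable
  have : Measurable (residual (d 0) N ξ lam) := by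
    unfold residual
    fun_prop
  exact this.aestronglyMeasurable

theorem memLp_pseudomode {d : ℕ → ℝ → ℂ} {N : ℕ} {lam : ℝ} (hlam : 0 < lam)
    (hU : ∀ x, (lam : ℂ) - d 0 x ∈ Complex.slitPlane)
    (hd : ∀ i < N, ∀ x, HasDerivAt (d i) (d (i + 1) x) x) (hN : 1 ≤ N)
    (hc : ∀ i ≤ N, Continuous (d i)) {ξ : ℝ → ℝ → ℝ} (hξ : IsTestFunction (ξ lam)) :
    MemLp (pseudomode (d 0) N ξ lam) 2 volume := by
  have h : Continuous (phase (d 0) N lam) :=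
    continuous_iff_continuousAt.2 fun x => (hasDerivAt_phase hlam hU hd hN hc x).continuousAt
  have e : pseudomode (d 0) N ξ lam =
      fun x => (ξ lam x : ℂ) * Complex.exp (-phase (d 0) N lam x) :=
    funext fun x => by rw [pseudomode, ansatz_eq_exp_phase hlam hU hd hN hc]
  have hcs : HasCompactSupport fun x => (ξ lam x : ℂ) := hξ.2.comp_left Complex.ofReal_zero
  rw [e]
  exact ((Complex.continuous_ofReal.comp hξ.1.continuous).mul
    (Complex.continuous_exp.comp h.neg)).memLp_of_hasCompactSupport hcs.mul_right

/-- The sum of the three rates at one end. -/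
noncomputable def totalRate (V : ℝ → ℂ) (N : ℕ) (ν : Side → ℝ) (ε₁ ε₂ γ : ℝ) (γ' α c : Side → ℝ)
    (s : Side) (lam : ℝ) : ℝ :=
  kappaRate V ν ε₁ ε₂ (c s) s lam + sigmaRate V N ν ε₁ ε₂ s lam + tauRate N γ γ' α s lam

theorem eLpNorm_le_add_indicator_halfLine {f : ℝ → ℂ} (hf : AEStronglyMeasurable f volume) :
    eLpNorm f 2 volume ≤ eLpNorm (Side.minus.halfLine.indicator f) 2 volume +
      eLpNorm (Side.plus.halfLine.indicator f) 2 volume := by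
  have h : f =ᵐ[volume] Side.minus.halfLine.indicator f + Side.plus.halfLine.indicator f := by
    filter_upwards [compl_mem_ae_iff.2 (measure_singleton (μ := volume) (0 : ℝ))] with x hx
    rcases lt_or_gt_of_ne (show x ≠ 0 from hx) with h | h
    · simp [Side.halfLine, h, h.le]
    · simp [Side.halfLine, h, h.le]
  rw [eLpNorm_congr_ae h]
  exact eLpNorm_add_le (hf.indicator Side.minus.measurableSet_halfLine)
    (hf.indicator Side.plus.measurableSet_halfLine) one_le_two

theorem tauRate_nonneg (N : ℕ) (γ : ℝ) (γ' α : Side → ℝ) (s : Side) {lam : ℝ} (hlam : 0 ≤ lam) :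
    0 ≤ tauRate N γ γ' α s lam := by
  unfold tauRate
  positivity

/-- The lower bound on ‖f‖ is drawn from the one end where Im V is bounded above by a power, and
serves both half-lines. The same estimates show that the residual is square integrable, which
membership in the domain requires. -/
theorem exists_eventually_quotient_le {N : ℕ} {d : ℕ → ℝ → ℂ} {ν : Side → ℝ} {ε₁ ε₂ : ℝ}
    (hE : ∀ s, ∃ R C c : ℝ, EndData N d (ν s) ε₁ s R C c) (hN : 1 ≤ N)
    (hε₂ : 0 < ε₂) (hbν : ∀ s, BoundedAt (d 0) s → ε₂ < 1 - ν s)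
    (hc : ∀ i ≤ N, Continuous (d i)) (hd : ∀ i < N, ∀ x, HasDerivAt (d i) (d (i + 1) x) x)
    (hAC : LocallyAC (d N)) (hdN : ∀ᵐ x, HasDerivAt (d N) (d (N + 1) x) x)
    (hΔ : ∀ᶠ lam : ℝ in atTop, ∀ s, 0 < Delta (d 0) ν ε₁ ε₂ s lam ∧
      Delta (d 0) ν ε₁ ε₂ s lam ≤ delta (d 0) ν ε₁ ε₂ s lam / 4)
    {ξ : ℝ → ℝ → ℝ} (hξ : IsCutoffFamily (d 0) ν ε₁ ε₂ ξ) {γ : ℝ} (hγ : 0 ≤ γ)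
    {γ' α : Side → ℝ} (hγ' : ∀ s, 0 ≤ γ' s)
    (hup : ∃ s : Side, (fun x => (d 0 x).im) =O[s.filter] (fun x => |x| ^ γ))
    (hlow : ∀ s : Side, (fun x => |x| ^ γ' s) =O[s.filter] (fun x => (d 0 x).im))
    (hα : ∀ s, 0 ≤ α s) (hmem : MemL2AddWeightedLInfty α (d (N + 1))) :
    ∃ A : ℝ, ∃ c : Side → ℝ, 0 < A ∧ (∀ s, 0 < c s) ∧ ∀ᶠ lam : ℝ in atTop,
      IsSchrodingerImage (d 0) (pseudomode (d 0) N ξ lam)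
        (fun x => residual (d 0) N (ξ lam) lam x + lam * pseudomode (d 0) N ξ lam x) ∧
      0 < eLpNorm (pseudomode (d 0) N ξ lam) 2 volume ∧
      (∀ s, 0 ≤ sigmaRate (d 0) N ν ε₁ ε₂ s lam) ∧
      (eLpNorm (residual (d 0) N (ξ lam) lam) 2 volume).toReal /
        (eLpNorm (pseudomode (d 0) N ξ lam) 2 volume).toReal ≤
        A * (totalRate (d 0) N ν ε₁ ε₂ γ γ' α c .minus lam +
          totalRate (d 0) N ν ε₁ ε₂ γ γ' α c .plus lam) := by
  have hU := eventually_mem_slitPlane hE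
  have hξ' := hξ
  obtain ⟨Cξ, hCξ⟩ := hξ
  have hf : ∀ᶠ lam : ℝ in atTop, MemLp (pseudomode (d 0) N ξ lam) 2 volume := by
    filter_upwards [hU, hCξ, eventually_gt_atTop 0] with lam hU hξ hlam
    exact memLp_pseudomode hlam hU hd hN hc ⟨hξ.smooth, hξ.compact⟩
  obtain ⟨a, ha, hF⟩ : ∃ a : ℝ, 0 < a ∧ ∀ᶠ lam : ℝ in atTop,
      ENNReal.ofReal (a * lam ^ (1 / (4 * (γ + 1)))) ≤
        eLpNorm (pseudomode (d 0) N ξ lam) 2 volume := by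
    obtain ⟨s, hs⟩ := hup
    obtain ⟨R, C, c, E⟩ := hE s
    exact E.exists_eventually_le_eLpNorm hN hε₂ (hbν s) hc hd hU hΔ hξ' hγ hs
  obtain ⟨h₂, k, hh₂, hk, hsum⟩ := hmem
  have hΔ' : ∀ᶠ lam : ℝ in atTop, ∀ s,
      Delta (d 0) ν ε₁ ε₂ s lam < delta (d 0) ν ε₁ ε₂ s lam := by
    filter_upwards [hΔ] with lam h s
    linarith [(h s).1, (h s).2]
  have hside : ∀ s, ∃ A c : ℝ, 0 < A ∧ 0 < c ∧ ∀ᶠ lam : ℝ in atTop,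
      eLpNorm (s.halfLine.indicator (residual (d 0) N (ξ lam) lam)) 2 volume ≤
        ENNReal.ofReal (A * (kappaRate (d 0) ν ε₁ ε₂ c s lam +
          sigmaRate (d 0) N ν ε₁ ε₂ s lam + tauRate N γ γ' α s lam)) *
          eLpNorm (pseudomode (d 0) N ξ lam) 2 volume := by
    intro s
    obtain ⟨R, C, c, E⟩ := hE s
    refine E.exists_eventually_eLpNorm_residual_le hN hε₂ (hbν s) hc hd hdN hU hΔ' hξ' hγ (hγ' s)
      (hlow s) (hα s) hh₂ (hk s) ?_ (hf.mono fun _ h => h.1) ha hF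
    filter_upwards [hsum] with x hx hxs
    rw [hx]
    cases s with
    | minus => simp [Side.halfLine, mem_Iio.1 hxs, (mem_Iio.1 hxs).le]
    | plus => simp [Side.halfLine, mem_Ioi.1 hxs, (mem_Ioi.1 hxs).le]
  choose A c hA hc0 hbound using hside
  have hδ : ∀ s, ∀ᶠ lam in atTop, 0 ≤ delta (d 0) ν ε₁ ε₂ s lam := fun s => by
    obtain ⟨R, C, c, E⟩ := hE s
    exact (E.tendsto_delta hε₂).eventually_ge_atTop 0
  refine ⟨A .minus + A .plus, c, add_pos (hA _) (hA _), hc0, ?_⟩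
  filter_upwards [hbound .minus, hbound .plus, hU, hCξ, hf, hF, hδ .minus, hδ .plus,
    eventually_gt_atTop 0] with lam hm hp hU hξ hf hF hδm hδp hlam
  have hσ : ∀ s, 0 ≤ sigmaRate (d 0) N ν ε₁ ε₂ s lam := by
    intro s
    cases s
    · exact EndData.sigmaRate_nonneg _ _ _ _ _ _ hlam.le hδm
    · exact EndData.sigmaRate_nonneg _ _ _ _ _ _ hlam.le hδp
  have htot : ∀ s, 0 ≤ totalRate (d 0) N ν ε₁ ε₂ γ γ' α c s lam := by
    intro s
    refine add_nonneg (add_nonneg ?_ (hσ s)) (tauRate_nonneg N γ γ' α s hlam.le)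
    rw [kappaRate_eq]
    positivity
  have hFpos : 0 < eLpNorm (pseudomode (d 0) N ξ lam) 2 volume :=
    (ENNReal.ofReal_pos.2 (by positivity)).trans_le hF
  have hFtop := hf.eLpNorm_ne_top
  have hmeas := aestronglyMeasurable_residual hlam hU hd hN hc (ξ lam) hξ.smooth.continuous
  set T := (A .minus + A .plus) * (totalRate (d 0) N ν ε₁ ε₂ γ γ' α c .minus lam +
          totalRate (d 0) N ν ε₁ ε₂ γ γ' α c .plus lam) with hT
  have hle : eLpNorm (residual (d 0) N (ξ lam) lam) 2 volume ≤
      ENNReal.ofReal T * eLpNorm (pseudomode (d 0) N ξ lam) 2 volume := by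
    refine (eLpNorm_le_add_indicator_halfLine hmeas).trans ((add_le_add hm hp).trans ?_)
    have h1 := mul_nonneg (hA .minus).le (htot .minus)
    have h2 := mul_nonneg (hA .plus).le (htot .plus)
    have h3 := mul_nonneg (hA .minus).le (htot .plus)
    have h4 := mul_nonneg (hA .plus).le (htot .minus)
    rw [← add_mul]
    refine mul_le_mul_left ?_ _
    refine (ENNReal.ofReal_add h1 h2).ge.trans (ENNReal.ofReal_le_ofReal ?_)
    rw [hT]
    linarith
  have hres : MemLp (residual (d 0) N (ξ lam) lam) 2 volume :=
    ⟨hmeas, hle.trans_lt (ENNReal.mul_lt_top ENNReal.ofReal_lt_top hf.eLpNorm_lt_top)⟩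
  refine ⟨isSchrodingerImage_pseudomode hlam hU hd hN hc hAC hdN ⟨hξ.smooth, hξ.compact⟩ hres,
    hFpos, hσ, ?_⟩
  rw [div_le_iff₀ (ENNReal.toReal_pos hFpos.ne' hFtop)]
  have h := ENNReal.toReal_mono (ENNReal.mul_ne_top ENNReal.ofReal_ne_top hFtop) hle
  rwa [ENNReal.toReal_mul, ENNReal.toReal_ofReal
    (mul_nonneg (add_pos (hA _) (hA _)).le (add_nonneg (htot _) (htot _)))] at h

end Pseudomode

theorem mainTheorem5
    (N : ℕ) (hN : 1 ≤ N) (V : ℝ → ℂ) (ν : Side → ℝ) (ε₁ ε₂ : ℝ)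
    (hV : BasicAssumption N V ν ε₁)
    (hε₂ : 0 < ε₂) (hε₂ν : ∀ s : Side, BoundedAt V s → ε₂ < 1 - ν s)
    (γ : ℝ) (hγ : 0 ≤ γ) (γ' : Side → ℝ) (hγ' : ∀ s : Side, 0 ≤ γ' s)
    (hIm_upper : ∃ s : Side, (fun x => (V x).im) =O[s.filter] (fun x => |x| ^ γ))
    (hIm_lower : ∀ s : Side, (fun x => |x| ^ γ' s) =O[s.filter] (fun x => (V x).im))
    (α : Side → ℝ) (hα : ∀ s : Side, 0 ≤ α s)
    (hVN : ∃ h : ℝ → ℂ, IsWeakDeriv (N + 1) V h ∧ MemL2AddWeightedLInfty α h) :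
    (∃ ξ : ℝ → ℝ → ℝ, IsCutoffFamily V ν ε₁ ε₂ ξ) ∧
    ∀ ξ : ℝ → ℝ → ℝ, IsCutoffFamily V ν ε₁ ε₂ ξ →
      ∃ u : ℝ → ℝ → ℂ, ∃ κ σ τ : Side → ℝ → ℝ,
        (∀ᶠ lam in atTop,
          IsSchrodingerImage V (pseudomode V N ξ lam) (u lam) ∧
          0 < eLpNorm (pseudomode V N ξ lam) 2 volume ∧
          (eLpNorm (fun x => u lam x - (lam : ℂ) * pseudomode V N ξ lam x) 2 volume).toReal
              / (eLpNorm (pseudomode V N ξ lam) 2 volume).toReal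
            = (κ .minus lam + κ .plus lam) + (σ .minus lam + σ .plus lam)
              + (τ .minus lam + τ .plus lam)) ∧
        ∀ s : Side,
          (∃ c : ℝ, 0 < c ∧ κ s =O[atTop] kappaRate V ν ε₁ ε₂ c s) ∧
          σ s =O[atTop] sigmaRate V N ν ε₁ ε₂ s ∧
          τ s =O[atTop] tauRate N γ γ' α s := by
  obtain ⟨h, hh, hmem⟩ := hVN
  obtain ⟨d, rfl, rfl, hc, hd, hw, hAC, hdN⟩ := exists_derivative_sequence hV hh
  have hE : ∀ s, ∃ R C c : ℝ, EndData N d (ν s) ε₁ s R C c :=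
    exists_endData hN hV rfl hc hd hw
  have hΔs : ∀ s, ∀ᶠ lam : ℝ in atTop, 0 < Delta (d 0) ν ε₁ ε₂ s lam ∧
      Delta (d 0) ν ε₁ ε₂ s lam ≤ delta (d 0) ν ε₁ ε₂ s lam / 4 := by
    intro s
    obtain ⟨R, C, c, E⟩ := hE s
    obtain ⟨B, -, hB⟩ := E.eventually_Delta hN hε₂ (hε₂ν s)
    exact hB.mono fun lam h => ⟨h.1, h.2.1⟩
  have hΔ : ∀ᶠ lam : ℝ in atTop, ∀ s, 0 < Delta (d 0) ν ε₁ ε₂ s lam ∧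
      Delta (d 0) ν ε₁ ε₂ s lam ≤ delta (d 0) ν ε₁ ε₂ s lam / 4 := by
    filter_upwards [hΔs .minus, hΔs .plus] with lam hm hp s
    cases s
    · exact hm
    · exact hp
  refine ⟨?_, fun ξ hξ => ?_⟩
  · obtain ⟨C, hC⟩ := exists_isCutoff
    -- For those λ at which the widths are not yet admissible an arbitrary function is taken.
    have hex : ∀ lam : ℝ, ∃ ξ : ℝ → ℝ, (∀ s, 0 < Delta (d 0) ν ε₁ ε₂ s lam ∧
        Delta (d 0) ν ε₁ ε₂ s lam ≤ delta (d 0) ν ε₁ ε₂ s lam / 4) →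
        IsCutoff (fun s => delta (d 0) ν ε₁ ε₂ s lam) (fun s => Delta (d 0) ν ε₁ ε₂ s lam) C ξ := by
      intro lam
      by_cases h : ∀ s, 0 < Delta (d 0) ν ε₁ ε₂ s lam ∧
          Delta (d 0) ν ε₁ ε₂ s lam ≤ delta (d 0) ν ε₁ ε₂ s lam / 4
      · exact (hC _ _ h).imp fun _ h' _ => h'
      · exact ⟨0, fun h' => absurd h' h⟩
    choose ξ hξ using hex
    exact ⟨ξ, C, hΔ.mono fun lam h => hξ lam h⟩
  obtain ⟨A, c, hA, hc0, hmain⟩ := exists_eventually_quotient_le hE hN hε₂ hε₂ν hc hd hAC hdN hΔ hξ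
    hγ hγ' hIm_upper hIm_lower hα hmem
  -- Each remainder is its rate times the common factor q/T, where T is the sum of all rates,
  -- positive because of the exponentials in κ. The factor is bounded by A, and the six pieces add
  -- up to q exactly.
  set q : ℝ → ℝ := fun lam => (eLpNorm (residual (d 0) N (ξ lam) lam) 2 volume).toReal /
    (eLpNorm (pseudomode (d 0) N ξ lam) 2 volume).toReal with hq
  set T : ℝ → ℝ := fun lam => totalRate (d 0) N ν ε₁ ε₂ γ γ' α c .minus lam +
    totalRate (d 0) N ν ε₁ ε₂ γ γ' α c .plus lam with hT
  have hκ : ∀ s lam, 0 < kappaRate (d 0) ν ε₁ ε₂ (c s) s lam := fun s lam => by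
    rw [kappaRate_eq]
    exact Real.exp_pos _
  have hev : ∀ᶠ lam in atTop, 0 < T lam ∧ 0 ≤ q lam / T lam ∧ q lam / T lam ≤ A := by
    filter_upwards [hmain, eventually_gt_atTop 0] with lam h hlam
    have hpos : ∀ s, 0 < totalRate (d 0) N ν ε₁ ε₂ γ γ' α c s lam := fun s =>
      add_pos_of_pos_of_nonneg (add_pos_of_pos_of_nonneg (hκ s lam) (h.2.2.1 s))
        (tauRate_nonneg N γ γ' α s hlam.le)
    have hTpos : 0 < T lam := add_pos (hpos _) (hpos _)
    exact ⟨hTpos, div_nonneg (div_nonneg ENNReal.toReal_nonneg ENNReal.toReal_nonneg) hTpos.le,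
      (div_le_iff₀ hTpos).2 h.2.2.2⟩
  have hO : ∀ r : ℝ → ℝ, (fun lam => q lam / T lam * r lam) =O[atTop] r := by
    intro r
    refine IsBigO.of_bound A ?_
    filter_upwards [hev] with lam h
    rw [norm_mul, Real.norm_of_nonneg h.2.1]
    exact mul_le_mul_of_nonneg_right h.2.2 (norm_nonneg _)
  refine ⟨fun lam x => residual (d 0) N (ξ lam) lam x + lam * pseudomode (d 0) N ξ lam x,
    fun s lam => q lam / T lam * kappaRate (d 0) ν ε₁ ε₂ (c s) s lam,
    fun s lam => q lam / T lam * sigmaRate (d 0) N ν ε₁ ε₂ s lam,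
    fun s lam => q lam / T lam * tauRate N γ γ' α s lam, ?_,
    fun s => ⟨⟨c s, hc0 s, hO _⟩, hO _, hO _⟩⟩
  filter_upwards [hmain, hev] with lam h h'
  refine ⟨h.1, h.2.1, ?_⟩
  simp only [add_sub_cancel_right]
  change q lam = _
  calc q lam = q lam / T lam * T lam := (div_mul_cancel₀ _ h'.1.ne').symm
    _ = _ := by
      generalize q lam / T lam = r
      simp only [hT, totalRate]
      ring
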